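/- Let $\log$ denote the binary logarithm, and for $c>0$ put $$\beta_c(\epsilon,\kappa,\rho)=\left(c\cdot\frac{\log(\kappa\rho)+\rho^{-1}}{\epsilon\rho}\right)^{\log(\kappa\rho)+\rho^{-1}+c}.$$ A weighted undirected graph $H$ (with edge weights in $\mathbb N$) on the vertex set of an unweighted undirected graph $G$ is a $(1+\epsilon,\beta)$-emulator of $G$ if $d_G(u,v)\le d_H(u,v)\le(1+\epsilon)\,d_G(u,v)+\beta$ for all vertices $u,v$ (distances between different components are infinite). There are a deterministic algorithm and an absolute constant $C>0$ such that the following holds for all real $0<\epsilon<1$, $\kappa\ge 2$, $1/\kappa<\rho<1/2$, every $n\ge 1$ and every unweighted undirected simple graph $G=(V,E)$ on $V=\{0,\dots,n-1\}$. Given the list of the edges of $G$ (each edge once, in any order) together with $n$, $|E|$ and the integers $\lceil 1/\epsilon\rceil,\lceil\kappa\rceil,\lceil 1/\rho\rceil$, the algorithm computes a $(1+\epsilon,\beta)$-emulator $H$ of $G$ with at most $n^{1+1/\kappa}$ edges, where $\beta=\beta_C(\epsilon,\kappa,\rho)$, in at most $$C\cdot\max(|E|,1)\cdot\beta\cdot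 n^{\rho}$$ steps. The algorithm is a single program, independent of $G$ and of the parameters, for a unit-cost word RAM (addition, truncated subtraction, multiplication, integer division, indirect memory access, zero-initialised memory) whose words have $O\big(\log(n+\lceil 1/\epsilon\rceil+\lceil\kappa\rceil+\lceil 1/\rho\rceil)\big)$ bits. -/

import Mathlib

/-! ## Weighted graphs, distances and emulators -/

/-- `WWalk H u v d`: in the undirected weighted graph whose edges are the triples
`(endpoint, endpoint, weight)` in the list `H`, there is a walk from `u` to `v` of total
weight `d`. -/
inductive WWalk {V : Type*} (H : List (V × V × ℕ)) : V → V → ℕ → Prop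
  | nil (u : V) : WWalk H u u 0
  | fwd {u v x : V} {w d : ℕ} : (u, v, w) ∈ H → WWalk H v x d → WWalk H u x (w + d)
  | bwd {u v x : V} {w d : ℕ} : (v, u, w) ∈ H → WWalk H v x d → WWalk H u x (w + d)

/-- The distance in the weighted graph `H`: the least weight of a walk, `⊤` if there is none. -/
noncomputable def wdist {V : Type*} (H : List (V × V × ℕ)) (u v : V) : ℕ∞ :=
  ⨅ (d : ℕ) (_ : WWalk H u v d), (d : ℕ∞)

/-- The weighted graph `H` is an `(α, β)`-emulator of the unweighted graph `G`:
`d_G(u,v) ≤ d_H(u,v) ≤ α * d_G(u,v) + β` for all vertices `u, v`, the distance between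
vertices of different components being infinite. Used for `0 < α` and `0 ≤ β`. -/
def IsEmulator {V : Type*} (G : SimpleGraph V) (H : List (V × V × ℕ)) (α β : ℝ) : Prop :=
  ∀ u v : V, G.edist u v ≤ wdist H u v ∧
    ((wdist H u v : ℕ∞) : ENNReal) ≤
      ENNReal.ofReal α * ((G.edist u v : ℕ∞) : ENNReal) + ENNReal.ofReal β

/-! ## Word RAM programs with a step count -/

namespace RAM

/-- The arithmetic operations of the machine (on natural numbers; subtraction is truncated at
`0`, division is rounded down and division by `0` gives `0`). -/
inductive Op
  | add
  | sub
  | mul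
  | div

def Op.eval : Op → ℕ → ℕ → ℕ
  | .add, a, b => a + b
  | .sub, a, b => a - b
  | .mul, a, b => a * b
  | .div, a, b => a / b

/-- Programs. Every program is a finite text that mentions finitely many registers; the memory
is accessed by indirect addressing. -/
inductive Prog
  /-- do nothing -/
  | skip
  /-- `r_x := k` -/
  | lit (x k : ℕ)
  /-- `r_x := r_y ∘ r_z` -/
  | arith (o : Op) (x y z : ℕ)
  /-- `r_x := mem[r_y]` -/
  | load (x y : ℕ)
  /-- `mem[r_x] := r_y` -/
  | store (x y : ℕ)
  /-- sequential composition -/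
  | seq (p q : Prog)
  /-- `if r_x ≠ 0 then p else q` -/
  | ite (x : ℕ) (p q : Prog)
  /-- `while r_x ≠ 0 do p` -/
  | while (x : ℕ) (p : Prog)

/-- Contents of the registers and of the memory cells. -/
structure State where
  reg : ℕ → ℕ
  mem : ℕ → ℕ

def State.setReg (s : State) (x a : ℕ) : State := ⟨Function.update s.reg x a, s.mem⟩

def State.setMem (s : State) (i a : ℕ) : State := ⟨s.reg, Function.update s.mem i a⟩

/-- `Exec W p s s' t`: on a machine whose words hold the numbers `0, …, W`, the program `p`,
started in the state `s`, halts in the state `s'` after exactly `t` steps. Every instruction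
and every test costs one step. A number larger than `W` is never produced in a register: an
execution that would do so gets stuck and does not halt. -/
inductive Exec (W : ℕ) : Prog → State → State → ℕ → Prop
  | skip (s : State) : Exec W .skip s s 1
  | lit (s : State) (x k : ℕ) (h : k ≤ W) : Exec W (.lit x k) s (s.setReg x k) 1
  | arith (s : State) (o : Op) (x y z : ℕ) (h : o.eval (s.reg y) (s.reg z) ≤ W) :
      Exec W (.arith o x y z) s (s.setReg x (o.eval (s.reg y) (s.reg z))) 1
  | load (s : State) (x y : ℕ) (h : s.mem (s.reg y) ≤ W) :
      Exec W (.load x y) s (s.setReg x (s.mem (s.reg y))) 1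
  | store (s : State) (x y : ℕ) : Exec W (.store x y) s (s.setMem (s.reg x) (s.reg y)) 1
  | seq {p q : Prog} {s s' s'' : State} {t t' : ℕ} :
      Exec W p s s' t → Exec W q s' s'' t' → Exec W (.seq p q) s s'' (t + t')
  | iteTrue {x : ℕ} {p q : Prog} {s s' : State} {t : ℕ} :
      s.reg x ≠ 0 → Exec W p s s' t → Exec W (.ite x p q) s s' (t + 1)
  | iteFalse {x : ℕ} {p q : Prog} {s s' : State} {t : ℕ} :
      s.reg x = 0 → Exec W q s s' t → Exec W (.ite x p q) s s' (t + 1)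
  | whileTrue {x : ℕ} {p : Prog} {s s' s'' : State} {t t' : ℕ} :
      s.reg x ≠ 0 → Exec W p s s' t → Exec W (.while x p) s' s'' t' →
        Exec W (.while x p) s s'' (t + t' + 1)
  | whileFalse {x : ℕ} {p : Prog} {s : State} : s.reg x = 0 → Exec W (.while x p) s s 1

/-- Programs are deterministic: the final state and the number of steps are determined by the
initial state. -/
theorem Exec.deterministic {W : ℕ} {p : Prog} {s s₁ s₂ : State} {t₁ t₂ : ℕ}
    (h₁ : Exec W p s s₁ t₁) (h₂ : Exec W p s s₂ t₂) : s₁ = s₂ ∧ t₁ = t₂ := by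
  induction h₁ generalizing s₂ t₂ with
  | skip | lit | arith | load | store => cases h₂; exact ⟨rfl, rfl⟩
  | seq _ _ ih ih' =>
    cases h₂ with
    | seq a b =>
      obtain ⟨rfl, rfl⟩ := ih a
      obtain ⟨rfl, rfl⟩ := ih' b
      exact ⟨rfl, rfl⟩
  | iteTrue h _ ih =>
    cases h₂ with
    | iteTrue _ a => obtain ⟨rfl, rfl⟩ := ih a; exact ⟨rfl, rfl⟩
    | iteFalse h' _ => exact absurd h' h
  | iteFalse h _ ih =>
    cases h₂ with
    | iteTrue h' _ => exact absurd h h'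
    | iteFalse _ a => obtain ⟨rfl, rfl⟩ := ih a; exact ⟨rfl, rfl⟩
  | whileTrue h _ _ ih ih' =>
    cases h₂ with
    | whileTrue _ a b =>
      obtain ⟨rfl, rfl⟩ := ih a
      obtain ⟨rfl, rfl⟩ := ih' b
      exact ⟨rfl, rfl⟩
    | whileFalse h' => exact absurd h' h
  | whileFalse h =>
    cases h₂ with
    | whileTrue h' _ _ => exact absurd h h'
    | whileFalse _ => exact ⟨rfl, rfl⟩

/-- The initial state for an input given as a list of words: the input is written into the
memory cells `0, 1, 2, …`; all other cells and all registers are `0`. -/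
def initState (input : List ℕ) : State := ⟨fun _ => 0, fun i => input.getD i 0⟩

/-- A weighted graph as an output: register `0` holds the address of the first edge, register
`1` the number of edges, and every edge occupies three consecutive memory cells (two endpoints
and the weight). -/
def State.Outputs {n : ℕ} (s : State) (H : List (Fin n × Fin n × ℕ)) : Prop :=
  s.reg 1 = H.length ∧
    ∀ (j : ℕ) (hj : j < H.length),
      s.mem (s.reg 0 + 3 * j) = (H[j].1 : ℕ) ∧
      s.mem (s.reg 0 + 3 * j + 1) = (H[j].2.1 : ℕ) ∧
      s.mem (s.reg 0 + 3 * j + 2) = H[j].2.2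

end RAM

/-! ## The input: a graph given by a list of its edges, and the parameters -/

/-- The list `es` contains every edge of `G` exactly once, in an arbitrary order and with an
arbitrary order of its two endpoints. -/
def IsEdgeList {n : ℕ} (G : SimpleGraph (Fin n)) (es : List (Fin n × Fin n)) : Prop :=
  (es.map (fun e => s(e.1, e.2))).Nodup ∧
    ∀ u v : Fin n, s(u, v) ∈ es.map (fun e => s(e.1, e.2)) ↔ G.Adj u v

/-- The input words: the number of vertices, the number of edges, the parameters, and the
endpoints of the edges. A machine with finite words cannot read arbitrary real parameters, so
it is given only the integers `⌈1/ε⌉`, `⌈κ⌉`, `⌈1/ρ⌉`; the requirements on its output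
nevertheless refer to the real numbers `ε`, `κ`, `ρ` themselves. -/
noncomputable def emulatorInput {n : ℕ} (es : List (Fin n × Fin n)) (ε κ ρ : ℝ) : List ℕ :=
  [n, es.length, ⌈1 / ε⌉₊, ⌈κ⌉₊, ⌈1 / ρ⌉₊] ++
    es.flatMap (fun e => [(e.1 : ℕ), (e.2 : ℕ)])

/-- The additive stretch
`β = (c * (log κρ + ρ⁻¹) / (ερ)) ^ (log κρ + ρ⁻¹ + c)`, with binary logarithms. -/
noncomputable def betaBound (c ε κ ρ : ℝ) : ℝ :=
  (c * ((Real.logb 2 (κ * ρ) + ρ⁻¹) / (ε * ρ))) ^ (Real.logb 2 (κ * ρ) + ρ⁻¹ + c)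

/-! The emulator is built by superclustering and interconnection. Phase `i` works with a set `P i`
of cluster centers, a distance threshold `B ^ i` (capped at `n`) and a degree threshold `Y i`, the
integer `p`-th root of `n` for the current exponent `p`. A bounded exploration tells every vertex up
to `Y + 2` centers within the threshold. A center that knows `Y + 2` centers is popular. Greedily,
popular centers that know no claimed center claim everything they know and become the centers of the
next phase; these stars are disjoint. A remaining unclaimed popular center knows a claimed one and
gets one edge to that star; an unclaimed unpopular center gets edges to all the centers it knows.
`PhaseSpec` records the outcome.

Edges: with `c` the real `p`-th root of `n` and `c'` the root for the next exponent, which is at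
least `p / 2`, the new edges plus `c'` per new center cost at most `c` per old center
(`PhaseSpec.potential`). The sum telescopes to `n * n ^ (1 / K)` with `K = ⌈κ⌉`
(`Phases.length_le`).

Number of phases: the exponent starts at `K` and is halved, rounding up, but never drops below `R =
⌈1/ρ⌉`. Reaching `R` takes about `log (κρ)` phases (`two_pow_mul_le`), and then `R` more phases,
each dividing the number of centers by more than the `R`-th root of `n`, leave none
(`Phases.last_eq_empty`). So `L` phases suffice, `L ≤ log (κρ) + 1/ρ + 3` (`numPhases_le`).

Stretch: clusters of phase `i` have radius small against `B ^ i`. Since the last phase leaves no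
centers, every non-isolated vertex has a level, the phase in which its cluster center was joined to
all nearby centers (`Phases.exists_atLevel`). By induction on `i`, walks through levels below `i`
are well approximated: cut the walk into pieces of length just below `B ^ i`, jump directly from the
first to the last vertex of level `i` in each piece, and use the induction hypothesis on both sides
(`stretched_chunk`, `stretched`). The choice `B = 112 * L * ⌈1/ε⌉` makes the total multiplicative
error at most `ε`, and the additive error is at most `B ^ L ≤ β`.

Time: the exploration runs `B ^ i` rounds over all edges, and lists of length `Y + 2` are harmless
because a full vertex fills its neighbours (`Complete.succ`). With `Y` at most the `R`-th root of
`n`, hence at most `n ^ ρ`, and the factors `L` and `K` absorbed by `β` (`betaBound_bounds`), the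
bound follows.

To speak about machine steps, programs are written over named variables and three-index arrays,
compiled to the word RAM, and verified by total-correctness weakest preconditions `WP` that also
carry the step count. Every phase uses its own slice of the zero-initialised arrays, so memory is
never cleared. `mainProg_spec` is the resulting statement about the program; everything after it on
stretch, size and parameters is mathematics about `Phases`. -/

set_option linter.constructorNameAsVariable false
set_option linter.unusedSimpArgs false

namespace RAM

/-! ## Structured programs over named variables and arrays -/

/-- The variables of structured programs. -/
inductive Var
  | n | m2 | inv | kap | rad | p | ph | base | np | nq | i | dl | y | pw | k | t | e | u | v
  | j | c | d | a | x | f | g | l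
  deriving DecidableEq

/-- The register holding a variable; registers `0`, `1`, `2` are reserved. -/
def Var.idx (x : Var) : ℕ := 3 + x.ctorIdx

theorem Var.idx_injective : Function.Injective Var.idx := by
  intro x y h
  cases x <;> cases y <;> first | rfl | (exfalso; revert h; decide)

theorem Var.idx_lt (x : Var) : x.idx < 64 := by cases x <;> decide

theorem Var.three_le_idx (x : Var) : 3 ≤ x.idx := Nat.le_add_right _ _

/-- The arrays of structured programs, each with three indices. -/
inductive Arr
  | mark | list | cnt | claim | plist | seen
  deriving DecidableEq

/-- The leading digit of the addresses of an array. -/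
def Arr.tag (A : Arr) : ℕ := 1 + A.ctorIdx

theorem Arr.tag_injective : Function.Injective Arr.tag := by
  intro x y h
  cases x <;> cases y <;> first | rfl | (exfalso; revert h; decide)

theorem Arr.tag_lt (A : Arr) : A.tag < 8 := by cases A <;> decide

theorem Arr.one_le_tag (A : Arr) : 1 ≤ A.tag := Nat.le_add_right _ _

/-- The abstract state of a structured program. -/
structure Store where
  v : Var → ℕ
  a : Arr → ℕ → ℕ → ℕ → ℕ
  out : List (ℕ × ℕ × ℕ)

namespace Store

/-- Assign to a variable. -/
def set (s : Store) (x : Var) (b : ℕ) : Store := { s with v := Function.update s.v x b }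

/-- Assign to an array cell. -/
def put (s : Store) (A : Arr) (i j k b : ℕ) : Store :=
  { s with a := fun A' i' j' k' => if A' = A ∧ i' = i ∧ j' = j ∧ k' = k then b else s.a A' i' j' k' }

/-- Append a triple to the output. -/
def push (s : Store) (x y w : ℕ) : Store := { s with out := s.out ++ [(x, y, w)] }

@[simp] theorem set_v (s : Store) (x y : Var) (b : ℕ) :
    (s.set x b).v y = if y = x then b else s.v y := by
  simp [set, Function.update_apply]

@[simp] theorem set_a (s : Store) (x : Var) (b : ℕ) : (s.set x b).a = s.a := rfl
@[simp] theorem set_out (s : Store) (x : Var) (b : ℕ) : (s.set x b).out = s.out := rfl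
@[simp] theorem put_v (s : Store) (A : Arr) (i j k b : ℕ) : (s.put A i j k b).v = s.v := rfl
@[simp] theorem put_out (s : Store) (A : Arr) (i j k b : ℕ) : (s.put A i j k b).out = s.out := rfl

@[simp] theorem put_a (s : Store) (A : Arr) (i j k b : ℕ) (A' : Arr) (i' j' k' : ℕ) :
    (s.put A i j k b).a A' i' j' k' =
      if A' = A ∧ i' = i ∧ j' = j ∧ k' = k then b else s.a A' i' j' k' := rfl

@[simp] theorem push_v (s : Store) (x y w : ℕ) : (s.push x y w).v = s.v := rfl
@[simp] theorem push_a (s : Store) (x y w : ℕ) : (s.push x y w).a = s.a := rfl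
@[simp] theorem push_out (s : Store) (x y w : ℕ) :
    (s.push x y w).out = s.out ++ [(x, y, w)] := rfl

end Store

/-- The parameters of an execution: the word bound, the radix of the addresses and the input. -/
structure Ctx where
  W : ℕ
  Z : ℕ
  inp : ℕ → ℕ
  len : ℕ
  hZ : 8 ≤ Z
  hW : Z ^ 6 ≤ W
  hlen : len ≤ Z ^ 3

/-- Expressions. -/
inductive Expr
  | lit (k : ℕ)
  | var (x : Var)
  | op (o : Op) (e f : Expr)
  | get (A : Arr) (e f g : Expr)
  | inp (e : Expr)

namespace Expr

/-- The value of an expression. -/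
def eval (Γ : Ctx) (s : Store) : Expr → ℕ
  | lit k => k
  | var x => s.v x
  | op o e f => o.eval (e.eval Γ s) (f.eval Γ s)
  | get A e f g => s.a A (e.eval Γ s) (f.eval Γ s) (g.eval Γ s)
  | inp e => Γ.inp (e.eval Γ s)

/-- No overflow and no index out of range. -/
def ok (Γ : Ctx) (s : Store) : Expr → Prop
  | lit k => k ≤ Γ.W
  | var _ => True
  | op .add e f => e.ok Γ s ∧ f.ok Γ s ∧ e.eval Γ s + f.eval Γ s ≤ Γ.W
  | op .mul e f => e.ok Γ s ∧ f.ok Γ s ∧ e.eval Γ s * f.eval Γ s ≤ Γ.W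
  | op .sub e f => e.ok Γ s ∧ f.ok Γ s
  | op .div e f => e.ok Γ s ∧ f.ok Γ s
  | get _ e f g => e.ok Γ s ∧ f.ok Γ s ∧ g.ok Γ s ∧
      e.eval Γ s < Γ.Z ∧ f.eval Γ s < Γ.Z ∧ g.eval Γ s < Γ.Z
  | inp e => e.ok Γ s ∧ e.eval Γ s < Γ.len

/-- The number of steps of the compiled expression. -/
def cost : Expr → ℕ
  | lit _ => 1
  | var _ => 2
  | op _ e f => e.cost + f.cost + 1
  | get _ e f g => e.cost + f.cost + g.cost + 8
  | inp e => e.cost + 1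

end Expr

/-! ### Compilation of expressions and the memory layout -/

/-- From the indices in registers `d`, `d+1`, `d+2`, compute the address of an array cell in
register `d+3`. -/
def addrProg (A : Arr) (d : ℕ) : Prog :=
  .seq (.lit (d + 3) A.tag) <| .seq (.arith .mul (d + 3) (d + 3) 2) <|
  .seq (.arith .add (d + 3) (d + 3) d) <| .seq (.arith .mul (d + 3) (d + 3) 2) <|
  .seq (.arith .add (d + 3) (d + 3) (d + 1)) <| .seq (.arith .mul (d + 3) (d + 3) 2) <|
  .arith .add (d + 3) (d + 3) (d + 2)

/-- Compile an expression: the value goes to register `d`, registers `> d` are scratch. -/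
def Expr.comp : Expr → ℕ → Prog
  | .lit k, d => .lit d k
  | .var x, d => .seq (.lit d 0) (.arith .add d x.idx d)
  | .op o e f, d => .seq (e.comp d) (.seq (f.comp (d + 1)) (.arith o d d (d + 1)))
  | .get A e f g, d => .seq (e.comp d) (.seq (f.comp (d + 1)) (.seq (g.comp (d + 2))
      (.seq (addrProg A d) (.load d (d + 3)))))
  | .inp e, d => .seq (e.comp d) (.load d d)

/-- The address of an array cell. -/
def Ctx.addr (Γ : Ctx) (A : Arr) (i j k : ℕ) : ℕ := ((A.tag * Γ.Z + i) * Γ.Z + j) * Γ.Z + k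

/-- The address of the output. -/
def Ctx.outBase (Γ : Ctx) : ℕ := 8 * Γ.Z ^ 3

theorem digits_unique {Z a b k l : ℕ} (hk : k < Z) (hl : l < Z) (h : a * Z + k = b * Z + l) :
    a = b ∧ k = l := by
  have hZ : 0 < Z := by omega
  have h1 : (a * Z + k) / Z = a := by
    rw [Nat.mul_comm, Nat.mul_add_div hZ, Nat.div_eq_of_lt hk, Nat.add_zero]
  have h2 : (b * Z + l) / Z = b := by
    rw [Nat.mul_comm, Nat.mul_add_div hZ, Nat.div_eq_of_lt hl, Nat.add_zero]
  have : a = b := by rw [← h1, ← h2, h]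
  subst this
  exact ⟨rfl, by omega⟩

/-- An address is a four-digit number in base `Z` whose leading digit is the tag, so digits can be
read off. -/
theorem Ctx.addr_inj (Γ : Ctx) {A A' : Arr} {i j k i' j' k' : ℕ}
    (hi : i < Γ.Z) (hj : j < Γ.Z) (hk : k < Γ.Z) (hi' : i' < Γ.Z) (hj' : j' < Γ.Z) (hk' : k' < Γ.Z) :
    Γ.addr A i j k = Γ.addr A' i' j' k' ↔ A = A' ∧ i = i' ∧ j = j' ∧ k = k' := by
  constructor
  · intro h
    unfold Ctx.addr at h
    obtain ⟨h1, e1⟩ := digits_unique hk hk' h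
    obtain ⟨h2, e2⟩ := digits_unique hj hj' h1
    obtain ⟨h3, e3⟩ := digits_unique hi hi' h2
    exact ⟨Arr.tag_injective h3, e3, e2, e1⟩
  · rintro ⟨rfl, rfl, rfl, rfl⟩; rfl

theorem Ctx.addr_lt (Γ : Ctx) (A : Arr) {i j k : ℕ} (hi : i < Γ.Z) (hj : j < Γ.Z) (hk : k < Γ.Z) :
    Γ.addr A i j k < Γ.outBase := by
  have h1 : A.tag * Γ.Z + i + 1 ≤ 8 * Γ.Z := by
    have := Nat.mul_le_mul_right Γ.Z (Nat.succ_le_of_lt A.tag_lt)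
    have := Nat.succ_mul A.tag Γ.Z
    simp only [Nat.succ_eq_add_one] at *; omega
  have h2 : (A.tag * Γ.Z + i) * Γ.Z + j + 1 ≤ 8 * Γ.Z * Γ.Z := by
    have := Nat.mul_le_mul_right Γ.Z h1
    have := Nat.succ_mul (A.tag * Γ.Z + i) Γ.Z
    simp only [Nat.succ_eq_add_one] at *; omega
  have h3 : ((A.tag * Γ.Z + i) * Γ.Z + j) * Γ.Z + k + 1 ≤ 8 * Γ.Z * Γ.Z * Γ.Z := by
    have := Nat.mul_le_mul_right Γ.Z h2
    have := Nat.succ_mul ((A.tag * Γ.Z + i) * Γ.Z + j) Γ.Z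
    simp only [Nat.succ_eq_add_one] at *; omega
  have h4 : Γ.outBase = 8 * Γ.Z * Γ.Z * Γ.Z := by unfold Ctx.outBase; ring
  rw [h4]; exact h3

/-- The leading digit is nonzero, so array cells start at `Z ^ 3`, beyond the input. Tags are below
8, so they end before `8 * Z ^ 3`, where the output starts: the three regions are disjoint. -/
theorem Ctx.len_le_addr (Γ : Ctx) (A : Arr) (i j k : ℕ) : Γ.len ≤ Γ.addr A i j k := by
  refine Γ.hlen.trans ?_
  have h1 : Γ.Z ≤ A.tag * Γ.Z + i :=
    (Nat.le_mul_of_pos_left _ A.one_le_tag).trans (Nat.le_add_right _ _)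
  have h2 := (Nat.mul_le_mul_right Γ.Z h1).trans (Nat.le_add_right _ j)
  have h3 := (Nat.mul_le_mul_right Γ.Z h2).trans (Nat.le_add_right _ k)
  calc Γ.Z ^ 3 = Γ.Z * Γ.Z * Γ.Z := by ring
    _ ≤ _ := h3

theorem Ctx.outBase_le (Γ : Ctx) : 8 * Γ.outBase ≤ Γ.W := by
  refine le_trans ?_ Γ.hW
  have := Γ.hZ
  have h2 : 64 ≤ Γ.Z ^ 3 := le_trans (by norm_num) (Nat.pow_le_pow_left this 3)
  calc 8 * Γ.outBase = 64 * Γ.Z ^ 3 := by unfold Ctx.outBase; ring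
    _ ≤ Γ.Z ^ 3 * Γ.Z ^ 3 := Nat.mul_le_mul_right _ h2
    _ = Γ.Z ^ 6 := by ring

/-! ### Machine states representing abstract stores -/

/-- The machine state `S` represents the store `s`. -/
structure Rel (Γ : Ctx) (S : State) (s : Store) : Prop where
  reg_le : ∀ r, S.reg r ≤ Γ.W
  mem_le : ∀ r, S.mem r ≤ Γ.W
  base : S.reg 0 = Γ.outBase
  count : S.reg 1 = s.out.length
  radix : S.reg 2 = Γ.Z
  var : ∀ x : Var, S.reg x.idx = s.v x
  arr : ∀ A i j k, i < Γ.Z → j < Γ.Z → k < Γ.Z → S.mem (Γ.addr A i j k) = s.a A i j k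
  inp : ∀ r < Γ.len, S.mem r = Γ.inp r
  out : ∀ (j : ℕ) (hj : j < s.out.length), S.mem (Γ.outBase + 3 * j) = s.out[j].1 ∧
    S.mem (Γ.outBase + 3 * j + 1) = s.out[j].2.1 ∧ S.mem (Γ.outBase + 3 * j + 2) = s.out[j].2.2

/-- Reserved registers and variables all lie below 64; everything from 64 on is scratch space that
the representation ignores. -/
theorem Rel.congr {Γ : Ctx} {S S' : State} {s : Store} (h : Rel Γ S s)
    (hr : ∀ r < 64, S'.reg r = S.reg r) (hm : S'.mem = S.mem) (hb : ∀ r, S'.reg r ≤ Γ.W) :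
    Rel Γ S' s where
  reg_le := hb
  mem_le := by rw [hm]; exact h.mem_le
  base := by rw [hr 0 (by norm_num)]; exact h.base
  count := by rw [hr 1 (by norm_num)]; exact h.count
  radix := by rw [hr 2 (by norm_num)]; exact h.radix
  var x := by rw [hr _ x.idx_lt]; exact h.var x
  arr := by rw [hm]; exact h.arr
  inp := by rw [hm]; exact h.inp
  out := by rw [hm]; exact h.out

/-- `S'` arises from `S` by changing registers from `d` on, to values within the word bound. -/
structure Scratch (Γ : Ctx) (d : ℕ) (S S' : State) : Prop where
  low : ∀ r < d, S'.reg r = S.reg r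
  mem : S'.mem = S.mem
  le : ∀ r, S'.reg r ≤ Γ.W

theorem Scratch.rel {Γ : Ctx} {d : ℕ} {S S' : State} {s : Store} (h : Scratch Γ d S S')
    (hd : 64 ≤ d) (hS : Rel Γ S s) : Rel Γ S' s :=
  hS.congr (fun r hr => h.low r (by omega)) h.mem h.le

theorem Scratch.trans {Γ : Ctx} {d d' : ℕ} {S S' S'' : State} (h : Scratch Γ d S S')
    (h' : Scratch Γ d' S' S'') (hd : d ≤ d') : Scratch Γ d S S'' :=
  ⟨fun r hr => (h'.low r (by omega)).trans (h.low r hr), h'.mem.trans h.mem, h'.le⟩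

theorem Scratch.setReg {Γ : Ctx} {d r b : ℕ} {S S' : State} (h : Scratch Γ d S S')
    (hr : d ≤ r) (hb : b ≤ Γ.W) : Scratch Γ d S (S'.setReg r b) := by
  refine ⟨fun q hq => ?_, h.mem, fun q => ?_⟩
  · have : q ≠ r := by omega
    simp only [State.setReg, Function.update_apply, this, if_false]
    exact h.low q hq
  · simp only [State.setReg, Function.update_apply]
    split_ifs
    · exact hb
    · exact h.le q

@[simp] theorem setReg_reg (S : State) (r b q : ℕ) :
    (S.setReg r b).reg q = if q = r then b else S.reg q := by
  simp [State.setReg, Function.update_apply]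

@[simp] theorem setReg_mem (S : State) (r b : ℕ) : (S.setReg r b).mem = S.mem := rfl

@[simp] theorem setMem_reg (S : State) (r b : ℕ) : (S.setMem r b).reg = S.reg := rfl

@[simp] theorem setMem_mem (S : State) (r b q : ℕ) :
    (S.setMem r b).mem q = if q = r then b else S.mem q := by
  simp [State.setMem, Function.update_apply]

theorem Exec.arith_of_eq {W : ℕ} {s : State} (o : Op) (x y z b : ℕ)
    (h : o.eval (s.reg y) (s.reg z) = b) (hb : b ≤ W) :
    Exec W (.arith o x y z) s (s.setReg x b) 1 := by
  subst h; exact .arith s o x y z hb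

theorem addrProg_exec {Γ : Ctx} {S : State} {s : Store} (hS : Rel Γ S s) (A : Arr) {d i j k : ℕ}
    (h0 : S.reg d = i) (h1 : S.reg (d + 1) = j) (h2 : S.reg (d + 2) = k)
    (hi : i < Γ.Z) (hj : j < Γ.Z) (hk : k < Γ.Z) :
    ∃ S', Exec Γ.W (addrProg A d) S S' 7 ∧ S'.reg (d + 3) = Γ.addr A i j k ∧
      Scratch Γ (d + 3) S S' := by
  have hlt := Γ.addr_lt A hi hj hk
  have hle := Γ.outBase_le
  have hZ1 : 1 ≤ Γ.Z := by omega
  unfold Ctx.addr at hlt ⊢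
  set a1 := A.tag * Γ.Z with ha1
  set a2 := (a1 + i) * Γ.Z with ha2
  set a3 := (a2 + j) * Γ.Z with ha3
  -- The values of the Horner scheme only increase, so the bound on the final address excludes
  -- overflow at every step.
  have g3 : a2 + j ≤ a3 := Nat.le_mul_of_pos_right _ hZ1
  have g2 : a1 + i ≤ a2 := Nat.le_mul_of_pos_right _ hZ1
  have g1 : A.tag ≤ a1 := Nat.le_mul_of_pos_right _ hZ1
  have e2 : S.reg 2 = Γ.Z := hS.radix
  have hbase : Scratch Γ (d + 3) S S := ⟨fun _ _ => rfl, rfl, hS.reg_le⟩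
  refine ⟨((((((S.setReg (d + 3) A.tag).setReg (d + 3) a1).setReg (d + 3) (a1 + i)).setReg
    (d + 3) a2).setReg (d + 3) (a2 + j)).setReg (d + 3) a3).setReg (d + 3) (a3 + k), ?_, by simp, ?_⟩
  · refine .seq (t := 1) (t' := 6) (.lit _ _ _ (by omega)) <|
      .seq (t := 1) (t' := 5) (.arith_of_eq _ _ _ _ a1 (by simp [Op.eval, e2, ← ha1]) (by omega)) <|
      .seq (t := 1) (t' := 4) (.arith_of_eq _ _ _ _ (a1 + i) (by simp [Op.eval, h0]) (by omega)) <|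
      .seq (t := 1) (t' := 3) (.arith_of_eq _ _ _ _ a2 (by simp [Op.eval, e2, ← ha2]) (by omega)) <|
      .seq (t := 1) (t' := 2) (.arith_of_eq _ _ _ _ (a2 + j) (by simp [Op.eval, h1]) (by omega)) <|
      .seq (t := 1) (t' := 1) (.arith_of_eq _ _ _ _ a3 (by simp [Op.eval, e2, ← ha3]) (by omega)) <|
      .arith_of_eq _ _ _ _ (a3 + k) (by simp [Op.eval, h2]) (by omega)
  · exact ((((((hbase.setReg le_rfl (by omega)).setReg le_rfl (by omega)).setReg le_rfl
      (by omega)).setReg le_rfl (by omega)).setReg le_rfl (by omega)).setReg le_rfl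
      (by omega)).setReg le_rfl (by omega)

/-- Registers from `d` on act as a stack: the value of a subexpression in register `d` survives
because later subexpressions touch only higher registers. The step count depends on the expression
alone. -/
theorem Expr.comp_exec {Γ : Ctx} {s : Store} (e : Expr) :
    ∀ {S : State} {d : ℕ}, Rel Γ S s → e.ok Γ s → 64 ≤ d →
      ∃ S', Exec Γ.W (e.comp d) S S' e.cost ∧ S'.reg d = e.eval Γ s ∧ Scratch Γ d S S' := by
  induction e with
  | lit k =>
    intro S d hS hok _
    exact ⟨_, .lit _ _ _ hok, by simp [eval],
      (Scratch.mk (fun _ _ => rfl) rfl hS.reg_le).setReg le_rfl hok⟩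
  | var x =>
    intro S d hS _ hd
    have hx := x.idx_lt
    have hne : x.idx ≠ d := by omega
    have hv : S.reg x.idx ≤ Γ.W := hS.reg_le _
    have := Exec.arith (W := Γ.W) (S.setReg d 0) .add d x.idx d (by simpa [Op.eval, hne] using hv)
    refine ⟨_, .seq (.lit _ _ _ (Nat.zero_le _)) this, ?_, ?_⟩
    · simp [Op.eval, hne, eval, hS.var]
    · refine ((Scratch.mk (fun _ _ => rfl) rfl hS.reg_le).setReg le_rfl (Nat.zero_le _)).setReg
        le_rfl ?_
      simpa [Op.eval, hne] using hv
  | op o e f he hf =>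
    intro S d hS hok hd
    have hoke : e.ok Γ s := by cases o <;> exact hok.1
    have hokf : f.ok Γ s := by cases o <;> first | exact hok.2.1 | exact hok.2
    obtain ⟨S1, x1, v1, c1⟩ := he hS hoke hd
    obtain ⟨S2, x2, v2, c2⟩ := hf (c1.rel hd hS) hokf (d := d + 1) (by omega)
    have v1' : S2.reg d = e.eval Γ s := by rw [c2.low d (by omega), v1]
    have hle : o.eval (S2.reg d) (S2.reg (d + 1)) ≤ Γ.W := by
      rw [v1', v2]
      have b1 : e.eval Γ s ≤ Γ.W := by rw [← v1]; exact c1.le _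
      cases o with
      | add => exact hok.2.2
      | mul => exact hok.2.2
      | sub => exact (Nat.sub_le _ _).trans b1
      | div => exact (Nat.div_le_self _ _).trans b1
    have hx := Exec.seq x1 (Exec.seq x2 (Exec.arith _ o d d (d + 1) hle))
    rw [← add_assoc] at hx
    refine ⟨_, hx, ?_, ?_⟩
    · simp [v1', v2, eval]
    · exact (c1.trans c2 (by omega)).setReg le_rfl hle
  | get A e f g he hf hg =>
    intro S d hS hok hd
    obtain ⟨hoke, hokf, hokg, b1, b2, b3⟩ := hok
    obtain ⟨S1, x1, v1, c1⟩ := he hS hoke hd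
    have hS1 := c1.rel hd hS
    obtain ⟨S2, x2, v2, c2⟩ := hf hS1 hokf (d := d + 1) (by omega)
    have hS2 := c2.rel (by omega) hS1
    obtain ⟨S3, x3, v3, c3⟩ := hg hS2 hokg (d := d + 2) (by omega)
    have hS3 := c3.rel (by omega) hS2
    have v1' : S3.reg d = e.eval Γ s := by rw [c3.low d (by omega), c2.low d (by omega), v1]
    have v2' : S3.reg (d + 1) = f.eval Γ s := by rw [c3.low _ (by omega), v2]
    obtain ⟨S4, x4, v4, c4⟩ := addrProg_exec hS3 A v1' v2' v3 b1 b2 b3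
    have hS4 := c4.rel (by omega) hS3
    have hm := hS4.mem_le (S4.reg (d + 3))
    have hx := Exec.seq x1 (Exec.seq x2 (Exec.seq x3 (Exec.seq x4 (Exec.load _ d (d + 3) hm))))
    rw [← add_assoc, ← add_assoc] at hx
    refine ⟨_, hx, ?_, ?_⟩
    · simp [v4, eval, hS4.arr A _ _ _ b1 b2 b3]
    · exact (c1.trans (c2.trans (c3.trans c4 (by omega)) (by omega)) (by omega)).setReg le_rfl hm
  | inp e he =>
    intro S d hS hok hd
    obtain ⟨hoke, b⟩ := hok
    obtain ⟨S1, x1, v1, c1⟩ := he hS hoke hd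
    have hS1 := c1.rel hd hS
    have hm := hS1.mem_le (S1.reg d)
    refine ⟨_, Exec.seq x1 (Exec.load _ d d hm), ?_, c1.setReg le_rfl hm⟩
    simp [v1, eval, hS1.inp _ b]

/-! ### Weakest preconditions -/

/-- Started in a state representing `s`, the program `p` halts, within the word bound, after some
number `t` of steps in a state representing some `s'` such that `Q s' t`. -/
def WP (Γ : Ctx) (p : Prog) (s : Store) (Q : Store → ℕ → Prop) : Prop :=
  ∀ S, Rel Γ S s → ∃ S' s' t, Exec Γ.W p S S' t ∧ Rel Γ S' s' ∧ Q s' t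

/-- `x := e` -/
def asg (x : Var) (e : Expr) : Prog := .seq (e.comp 64) (.seq (.lit 65 0) (.arith .add x.idx 64 65))

/-- `A[e,f,g] := h` -/
def sto (A : Arr) (e f g h : Expr) : Prog :=
  .seq (e.comp 64) <| .seq (f.comp 65) <| .seq (g.comp 66) <| .seq (addrProg A 64) <|
  .seq (h.comp 68) (.store 67 68)

/-- Output the triple `(e, f, g)`. -/
def emit (e f g : Expr) : Prog :=
  .seq (e.comp 64) <| .seq (f.comp 65) <| .seq (g.comp 66) <| .seq (.lit 68 3) <|
  .seq (.arith .mul 67 1 68) <| .seq (.arith .add 67 0 67) <| .seq (.store 67 64) <|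
  .seq (.lit 68 1) <| .seq (.arith .add 67 67 68) <| .seq (.store 67 65) <|
  .seq (.arith .add 67 67 68) <| .seq (.store 67 66) (.arith .add 1 1 68)

/-- `if e ≠ 0 then p else q` -/
def cond (e : Expr) (p q : Prog) : Prog := .seq (e.comp 64) (.ite 64 p q)

/-- `while e ≠ 0 do p` -/
def loop (e : Expr) (p : Prog) : Prog := .seq (e.comp 64) (.while 64 (.seq p (e.comp 64)))

/-- `for x = 0, …, e - 1 do p` -/
def forTo (x : Var) (e : Expr) (p : Prog) : Prog :=
  .seq (asg x (.lit 0)) (loop (.op .sub e (.var x)) (.seq p (asg x (.op .add (.var x) (.lit 1)))))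

theorem WP.mono {Γ : Ctx} {p : Prog} {s : Store} {Q Q' : Store → ℕ → Prop} (h : WP Γ p s Q)
    (hQ : ∀ s' t, Q s' t → Q' s' t) : WP Γ p s Q' := by
  intro S hS
  obtain ⟨S', s', t, x, hr, hq⟩ := h S hS
  exact ⟨S', s', t, x, hr, hQ _ _ hq⟩

theorem WP.seq {Γ : Ctx} {p q : Prog} {s : Store} {Q : Store → ℕ → Prop}
    (h : WP Γ p s fun s1 t1 => WP Γ q s1 fun s2 t2 => Q s2 (t1 + t2)) :
    WP Γ (.seq p q) s Q := by
  intro S hS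
  obtain ⟨S1, s1, t1, x1, r1, h1⟩ := h S hS
  obtain ⟨S2, s2, t2, x2, r2, h2⟩ := h1 S1 r1
  exact ⟨S2, s2, _, .seq x1 x2, r2, h2⟩

theorem WP.skip {Γ : Ctx} {s : Store} {Q : Store → ℕ → Prop} (h : Q s 1) : WP Γ .skip s Q :=
  fun S hS => ⟨S, s, 1, .skip S, hS, h⟩

theorem Rel.setVar {Γ : Ctx} {S : State} {s : Store} (h : Rel Γ S s) (x : Var) {b : ℕ}
    (hb : b ≤ Γ.W) : Rel Γ (S.setReg x.idx b) (s.set x b) := by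
  have h3 := x.three_le_idx
  refine ⟨fun r => ?_, h.mem_le, ?_, ?_, ?_, fun y => ?_, h.arr, h.inp, h.out⟩
  · simp only [setReg_reg]; split_ifs
    · exact hb
    · exact h.reg_le r
  · rw [setReg_reg, if_neg (by omega)]; exact h.base
  · rw [setReg_reg, if_neg (by omega)]; exact h.count
  · rw [setReg_reg, if_neg (by omega)]; exact h.radix
  · simp only [setReg_reg, Store.set_v, Var.idx_injective.eq_iff, h.var]

theorem WP.asg {Γ : Ctx} {x : Var} {e : Expr} {s : Store} {Q : Store → ℕ → Prop}
    (hok : e.ok Γ s) (h : Q (s.set x (e.eval Γ s)) (e.cost + 2)) : WP Γ (asg x e) s Q := by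
  intro S hS
  obtain ⟨S1, x1, v1, c1⟩ := e.comp_exec hS hok le_rfl
  have hv : e.eval Γ s ≤ Γ.W := by rw [← v1]; exact c1.le _
  have c2 : Scratch Γ 64 S (S1.setReg 65 0) := c1.setReg (by norm_num) (Nat.zero_le _)
  have x3 := Exec.arith (W := Γ.W) (S1.setReg 65 0) .add x.idx 64 65
    (by simpa [Op.eval, v1] using hv)
  refine ⟨_, _, _, .seq x1 (.seq (.lit _ _ _ (Nat.zero_le _)) x3), ?_, h⟩
  have hr := (c2.rel le_rfl hS).setVar x hv
  simpa [Op.eval, v1] using hr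

theorem Rel.setArr {Γ : Ctx} {S : State} {s : Store} (h : Rel Γ S s) (A : Arr) {i j k b : ℕ}
    (hi : i < Γ.Z) (hj : j < Γ.Z) (hk : k < Γ.Z) (hb : b ≤ Γ.W) :
    Rel Γ (S.setMem (Γ.addr A i j k) b) (s.put A i j k b) := by
  have hlt := Γ.addr_lt A hi hj hk
  refine ⟨h.reg_le, fun r => ?_, h.base, h.count, h.radix, h.var, ?_, fun r hr => ?_, ?_⟩
  · simp only [setMem_mem]; split_ifs
    · exact hb
    · exact h.mem_le r
  · intro A' i' j' k' hi' hj' hk'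
    simp only [setMem_mem, Store.put_a, Γ.addr_inj hi' hj' hk' hi hj hk, h.arr A' i' j' k' hi' hj' hk']
  · have := Γ.len_le_addr A i j k
    rw [setMem_mem, if_neg (by omega)]; exact h.inp r hr
  · intro q hq
    simp only [setMem_mem]
    rw [if_neg (by omega), if_neg (by omega), if_neg (by omega)]
    exact h.out q hq

theorem WP.sto {Γ : Ctx} {A : Arr} {e f g b : Expr} {s : Store} {Q : Store → ℕ → Prop}
    (he : e.ok Γ s) (hf : f.ok Γ s) (hg : g.ok Γ s) (hb : b.ok Γ s)
    (hi : e.eval Γ s < Γ.Z) (hj : f.eval Γ s < Γ.Z) (hk : g.eval Γ s < Γ.Z)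
    (h : Q (s.put A (e.eval Γ s) (f.eval Γ s) (g.eval Γ s) (b.eval Γ s))
      (e.cost + f.cost + g.cost + b.cost + 8)) : WP Γ (sto A e f g b) s Q := by
  intro S hS
  obtain ⟨S1, x1, v1, c1⟩ := e.comp_exec hS he le_rfl
  have hS1 := c1.rel le_rfl hS
  obtain ⟨S2, x2, v2, c2⟩ := f.comp_exec hS1 hf (d := 65) (by norm_num)
  have hS2 := c2.rel (by norm_num) hS1
  obtain ⟨S3, x3, v3, c3⟩ := g.comp_exec hS2 hg (d := 66) (by norm_num)
  have hS3 := c3.rel (by norm_num) hS2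
  obtain ⟨S4, x4, v4, c4⟩ := addrProg_exec hS3 A (d := 64)
    (by rw [c3.low _ (by norm_num), c2.low _ (by norm_num), v1])
    (by rw [c3.low _ (by norm_num), v2]) v3 hi hj hk
  have hS4 := c4.rel (by norm_num) hS3
  obtain ⟨S5, x5, v5, c5⟩ := b.comp_exec hS4 hb (d := 68) (by norm_num)
  have hS5 := c5.rel (by norm_num) hS4
  have v4' : S5.reg 67 = Γ.addr A (e.eval Γ s) (f.eval Γ s) (g.eval Γ s) := by
    rw [c5.low _ (by norm_num), v4]
  have hbv : b.eval Γ s ≤ Γ.W := by rw [← v5]; exact c5.le _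
  have hfin := hS5.setArr A hi hj hk hbv
  refine ⟨_, s.put A (e.eval Γ s) (f.eval Γ s) (g.eval Γ s) (b.eval Γ s), _,
    .seq x1 (.seq x2 (.seq x3 (.seq x4 (.seq x5 (.store _ 67 68))))), ?_, ?_⟩
  · rw [v4', v5]; exact hfin
  · convert h using 1; ring

theorem WP.cond {Γ : Ctx} {e : Expr} {p q : Prog} {s : Store} {Q : Store → ℕ → Prop}
    (hok : e.ok Γ s)
    (hp : e.eval Γ s ≠ 0 → WP Γ p s fun s' t => Q s' (e.cost + (t + 1)))
    (hq : e.eval Γ s = 0 → WP Γ q s fun s' t => Q s' (e.cost + (t + 1))) :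
    WP Γ (cond e p q) s Q := by
  intro S hS
  obtain ⟨S1, x1, v1, c1⟩ := e.comp_exec hS hok le_rfl
  have hS1 := c1.rel le_rfl hS
  by_cases h0 : e.eval Γ s = 0
  · obtain ⟨S2, s2, t2, x2, r2, h2⟩ := hq h0 S1 hS1
    exact ⟨S2, s2, _, .seq x1 (.iteFalse (by rw [v1, h0]) x2), r2, h2⟩
  · obtain ⟨S2, s2, t2, x2, r2, h2⟩ := hp h0 S1 hS1
    exact ⟨S2, s2, _, .seq x1 (.iteTrue (by rwa [v1]) x2), r2, h2⟩

/-- Loops with a variant: the invariant `I k` holds after `k` rounds, and there are at most `N`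
rounds. -/
theorem WP.loop {Γ : Ctx} {e : Expr} {p : Prog} {s : Store} {Q : Store → ℕ → Prop} (N T : ℕ)
    (I : ℕ → Store → Prop) (h0 : I 0 s) (hok : ∀ k s1, k ≤ N → I k s1 → e.ok Γ s1)
    (hN : ∀ s1, I N s1 → e.eval Γ s1 = 0)
    (hb : ∀ k s1, k < N → I k s1 → e.eval Γ s1 ≠ 0 → WP Γ p s1 fun s2 t => t ≤ T ∧ I (k + 1) s2)
    (hQ : ∀ k s1 t, k ≤ N → I k s1 → e.eval Γ s1 = 0 →
      t ≤ k * (T + e.cost + 1) + e.cost + 1 → Q s1 t) : WP Γ (loop e p) s Q := by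
  -- Induction on the number `r` of rounds still allowed; register 64 holds the value of the guard,
  -- computed before the loop or at the end of the previous round.
  have key : ∀ r k, k + r = N → ∀ s1, I k s1 → ∀ S1, Rel Γ S1 s1 → S1.reg 64 = e.eval Γ s1 →
      ∃ S' s' t k', Exec Γ.W (.while 64 (.seq p (e.comp 64))) S1 S' t ∧ Rel Γ S' s' ∧ k' ≤ N ∧
        k ≤ k' ∧ I k' s' ∧ e.eval Γ s' = 0 ∧ t ≤ (k' - k) * (T + e.cost + 1) + 1 := by
    intro r
    induction r with
    | zero =>
      intro k hk s1 hI S1 hS1 hv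
      obtain rfl : k = N := by omega
      have h0 := hN s1 hI
      exact ⟨S1, s1, 1, k, .whileFalse (by rw [hv, h0]), hS1, le_rfl, le_rfl, hI, h0, by omega⟩
    | succ r ih =>
      intro k hk s1 hI S1 hS1 hv
      by_cases h0 : e.eval Γ s1 = 0
      · exact ⟨S1, s1, 1, k, .whileFalse (by rw [hv, h0]), hS1, by omega, le_rfl, hI, h0, by omega⟩
      · obtain ⟨S2, s2, t2, x2, r2, ht2, hI2⟩ := hb k s1 (by omega) hI h0 S1 hS1
        obtain ⟨S3, x3, v3, c3⟩ := e.comp_exec r2 (hok _ _ (by omega) hI2) (d := 64) le_rfl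
        obtain ⟨S', s', t, k', x, hr, hk', hkk, hI', he', ht⟩ :=
          ih (k + 1) (by omega) s2 hI2 S3 (c3.rel le_rfl r2) v3
        refine ⟨S', s', _, k', .whileTrue (by rwa [hv]) (.seq x2 x3) x, hr, hk', by omega, hI', he', ?_⟩
        have : k' - k = (k' - (k + 1)) + 1 := by omega
        rw [this, Nat.add_mul]; omega
  intro S hS
  obtain ⟨S1, x1, v1, c1⟩ := e.comp_exec hS (hok 0 s (Nat.zero_le _) h0) (d := 64) le_rfl
  obtain ⟨S', s', t, k', x, hr, hk', -, hI', he', ht⟩ :=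
    key N 0 (by omega) s h0 S1 (c1.rel le_rfl hS) v1
  refine ⟨S', s', _, .seq x1 x, hr, hQ k' s' _ hk' hI' he' ?_⟩
  simp only [Nat.sub_zero] at ht; omega

/-- Counting loops: `I k` holds after `k` rounds. -/
theorem WP.forTo {Γ : Ctx} {x : Var} {e : Expr} {p : Prog} {s : Store} {Q : Store → ℕ → Prop}
    (N T : ℕ) (I : ℕ → Store → Prop) (h0 : I 0 (s.set x 0)) (hNW : N ≤ Γ.W) (hW : 1 ≤ Γ.W)
    (he : ∀ k s1, k ≤ N → I k s1 → s1.v x = k → e.ok Γ s1 ∧ e.eval Γ s1 = N)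
    (hb : ∀ k s1, k < N → I k s1 → s1.v x = k →
      WP Γ p s1 fun s2 t => t ≤ T ∧ s2.v x = k ∧ I (k + 1) (s2.set x (k + 1)))
    (hQ : ∀ s1 t, I N s1 → s1.v x = N →
      t ≤ N * (T + e.cost + 11) + e.cost + 7 → Q s1 t) : WP Γ (forTo x e p) s Q := by
  refine WP.seq (WP.asg (by simp [Expr.ok]) ?_)
  refine WP.loop N (T + 7) (fun k s1 => I k s1 ∧ s1.v x = k) ⟨h0, by simp [Expr.eval]⟩ ?_ ?_ ?_ ?_
  · rintro k s1 hk ⟨hI, hx⟩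
    exact ⟨(he k s1 hk hI hx).1, trivial⟩
  · rintro s1 ⟨hI, hx⟩
    simp [Expr.eval, Op.eval, (he N s1 le_rfl hI hx).2, hx]
  · rintro k s1 hk ⟨hI, hx⟩ -
    refine WP.seq ((hb k s1 hk hI hx).mono ?_)
    rintro s2 t ⟨ht, hx2, hI2⟩
    refine WP.asg ⟨trivial, hW, by simp [Expr.eval, hx2]; omega⟩ ?_
    simp only [Expr.eval, Op.eval, hx2]
    exact ⟨by simp [Expr.cost]; omega, hI2, by simp⟩
  · rintro k s1 t hk ⟨hI, hx⟩ h0 ht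
    have hN := (he k s1 hk hI hx).2
    simp only [Expr.eval, Op.eval, hN, hx] at h0
    obtain rfl : k = N := by omega
    refine hQ s1 _ hI hx ?_
    simp only [Expr.cost] at ht ⊢
    have : T + 7 + (e.cost + 2 + 1) + 1 = T + e.cost + 11 := by ring
    rw [this] at ht
    omega

theorem WP.emit {Γ : Ctx} {e f g : Expr} {s : Store} {Q : Store → ℕ → Prop}
    (he : e.ok Γ s) (hf : f.ok Γ s) (hg : g.ok Γ s) (hlen : s.out.length < Γ.Z ^ 3)
    (h : Q (s.push (e.eval Γ s) (f.eval Γ s) (g.eval Γ s)) (e.cost + f.cost + g.cost + 10)) :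
    WP Γ (emit e f g) s Q := by
  intro S hS
  obtain ⟨S1, x1, v1, c1⟩ := e.comp_exec hS he le_rfl
  have hS1 := c1.rel le_rfl hS
  obtain ⟨S2, x2, v2, c2⟩ := f.comp_exec hS1 hf (d := 65) (by norm_num)
  have hS2 := c2.rel (by norm_num) hS1
  obtain ⟨S3, x3, v3, c3⟩ := g.comp_exec hS2 hg (d := 66) (by norm_num)
  have hS3 := c3.rel (by norm_num) hS2
  have v1' : S3.reg 64 = e.eval Γ s := by rw [c3.low _ (by norm_num), c2.low _ (by norm_num), v1]
  have v2' : S3.reg 65 = f.eval Γ s := by rw [c3.low _ (by norm_num), v2]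
  have hbW := Γ.outBase_le
  have hb3 : Γ.outBase = 8 * Γ.Z ^ 3 := rfl
  have h8 : 8 ^ 3 ≤ Γ.Z ^ 3 := Nat.pow_le_pow_left Γ.hZ 3
  have r0 := hS3.base
  have r1 := hS3.count
  set l := s.out.length with hl
  have b1 := hS3.reg_le 64
  have b2 := hS3.reg_le 65
  have b3 := hS3.reg_le 66
  refine ⟨_, s.push (e.eval Γ s) (f.eval Γ s) (g.eval Γ s), _,
    .seq x1 <| .seq x2 <| .seq x3 <| .seq (.lit _ _ _ (by omega)) <|
    .seq (.arith_of_eq _ _ _ _ (3 * l) (by simp [Op.eval, r1, Nat.mul_comm]) (by omega)) <|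
    .seq (.arith_of_eq _ _ _ _ (Γ.outBase + 3 * l) (by simp [Op.eval, r0]) (by omega)) <|
    .seq (.store _ _ _) <| .seq (.lit _ _ 1 (by omega)) <|
    .seq (.arith_of_eq _ _ _ _ (Γ.outBase + 3 * l + 1) (by simp [Op.eval]) (by omega)) <|
    .seq (.store _ _ _) <|
    .seq (.arith_of_eq _ _ _ _ (Γ.outBase + 3 * l + 2) (by simp [Op.eval]) (by omega)) <|
    .seq (.store _ _ _) (.arith_of_eq _ _ _ _ (l + 1) (by simp [Op.eval, r1]) (by omega)), ?_, ?_⟩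
  · have hne : ∀ r < 64, 2 ≤ r → r ≠ 64 ∧ r ≠ 65 ∧ r ≠ 66 ∧ r ≠ 67 ∧ r ≠ 68 ∧ r ≠ 1 := by
      intro r _ _; omega
    refine ⟨fun r => ?_, fun r => ?_, ?_, ?_, ?_, fun x => ?_, ?_, ?_, ?_⟩
    · have := hS3.reg_le r
      simp only [Op.eval, setReg_reg, setMem_reg, setReg_mem, setMem_mem]
      split_ifs <;> simp_all <;> omega
    · have := hS3.mem_le r
      simp only [Op.eval, setReg_reg, setMem_reg, setReg_mem, setMem_mem]
      split_ifs <;> simp_all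
    · simp [r0]
    · simp [Op.eval, r1, hl]
    · simp [hS3.radix]
    · obtain ⟨_, _, _, n1, n2, n3⟩ := hne _ x.idx_lt (by have := x.three_le_idx; omega)
      simp [n1, n2, n3, hS3.var]
    · intro A i j k hi hj hk
      have := Γ.addr_lt A hi hj hk
      simp [Op.eval, r0, r1]
      rw [if_neg (by omega), if_neg (by omega), if_neg (by omega)]
      exact hS3.arr A i j k hi hj hk
    · intro r hr
      have := Γ.hlen
      simp [Op.eval, r0, r1]
      rw [if_neg (by omega), if_neg (by omega), if_neg (by omega)]
      exact hS3.inp r hr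
    · intro j hj
      simp only [Store.push_out, List.length_append, List.length_singleton] at hj
      simp [Op.eval, r0, r1, v1', v2', v3]
      rcases Nat.lt_or_ge j l with hjl | hjl
      · obtain ⟨o1, o2, o3⟩ := hS3.out j hjl
        rw [List.getElem_append_left hjl]
        refine ⟨?_, ?_, ?_⟩
        · rw [if_neg (by omega), if_neg (by omega), if_neg (by omega)]; exact o1
        · rw [if_neg (by omega), if_neg (by omega), if_neg (by omega)]; exact o2
        · rw [if_neg (by omega), if_neg (by omega), if_neg (by omega)]; exact o3
      · obtain rfl : j = l := by omega
        simp [hl]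
  · convert h using 1; ring

/-! ### Notation for expressions and frame conditions -/

infixr:60 " ;; " => Prog.seq

instance (k : ℕ) : OfNat Expr k := ⟨.lit k⟩
instance : Add Expr := ⟨.op .add⟩
instance : Sub Expr := ⟨.op .sub⟩
instance : Mul Expr := ⟨.op .mul⟩
instance : Div Expr := ⟨.op .div⟩

@[simp] theorem Expr.ofNat_def (k : ℕ) : (OfNat.ofNat k : Expr) = .lit k := rfl
@[simp] theorem Expr.add_def (e f : Expr) : e + f = .op .add e f := rfl
@[simp] theorem Expr.sub_def (e f : Expr) : e - f = .op .sub e f := rfl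
@[simp] theorem Expr.mul_def (e f : Expr) : e * f = .op .mul e f := rfl
@[simp] theorem Expr.div_def (e f : Expr) : e / f = .op .div e f := rfl

attribute [simp] Expr.eval Expr.ok Expr.cost Op.eval

theorem Ctx.pow_five_le (Γ : Ctx) : Γ.Z ^ 5 * 8 ≤ Γ.W :=
  le_trans (le_trans (Nat.mul_le_mul_left _ Γ.hZ) (by rw [← pow_succ])) Γ.hW

theorem Ctx.pow_four_le (Γ : Ctx) : Γ.Z ^ 4 * 64 ≤ Γ.W := by
  have := Nat.mul_le_mul_left (Γ.Z ^ 4 * 8) Γ.hZ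
  have h := Γ.pow_five_le
  have e : Γ.Z ^ 4 * 8 * Γ.Z = Γ.Z ^ 5 * 8 := by ring
  linarith

theorem Ctx.cube_le (Γ : Ctx) : Γ.Z ^ 3 * 512 ≤ Γ.W := by
  have := Nat.mul_le_mul_left (Γ.Z ^ 3 * 64) Γ.hZ
  have h := Γ.pow_four_le
  have e : Γ.Z ^ 3 * 64 * Γ.Z = Γ.Z ^ 4 * 64 := by ring
  linarith

theorem Ctx.sq_le (Γ : Ctx) : Γ.Z ^ 2 * 4096 ≤ Γ.W := by
  have := Nat.mul_le_mul_left (Γ.Z ^ 2 * 512) Γ.hZ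
  have h := Γ.cube_le
  have e : Γ.Z ^ 2 * 512 * Γ.Z = Γ.Z ^ 3 * 512 := by ring
  linarith

theorem Ctx.lin_le (Γ : Ctx) : Γ.Z * 32768 ≤ Γ.W := by
  have := Nat.mul_le_mul_left (Γ.Z * 4096) Γ.hZ
  have h := Γ.sq_le
  have e : Γ.Z * 4096 * Γ.Z = Γ.Z ^ 2 * 4096 := by ring
  linarith

/-- Only variables in `X` may differ. -/
def SameV (X : List Var) (s s' : Store) : Prop := ∀ x, x ∉ X → s'.v x = s.v x

theorem SameV.refl (X : List Var) (s : Store) : SameV X s s := fun _ _ => rfl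

theorem SameV.set {X : List Var} {s s' : Store} (h : SameV X s s') {x : Var} (hx : x ∈ X) (b : ℕ) :
    SameV X s (s'.set x b) := by
  intro z hz
  have : z ≠ x := fun e => hz (e ▸ hx)
  simp [this, h z hz]

theorem SameV.trans {X Y : List Var} {s s' s'' : Store} (h : SameV X s s') (h' : SameV Y s' s'')
    (hXY : Y ⊆ X) : SameV X s s'' :=
  fun x hx => (h' x fun hy => hx (hXY hy)).trans (h x hx)

theorem SameV.mono {X Y : List Var} {s s' : Store} (h : SameV X s s') (hXY : X ⊆ Y) :
    SameV Y s s' :=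
  fun x hx => h x fun hy => hx (hXY hy)

end RAM

namespace RAM

/-! ## Integer roots -/

/-- `pw := (y + 1) ^ p`, or some number above `n` if the power is above `n`. -/
def powProg : Prog :=
  asg .pw 1 ;; forTo .k (.var .p)
    (cond (.var .n + 1 - .var .pw) (asg .pw (.var .pw * (.var .y + 1))) .skip)

/-- `y := ⌊n ^ (1 / p)⌋` -/
def rootProg : Prog :=
  asg .y 0 ;; asg .pw 1 ;; loop (.var .n + 1 - .var .pw) (asg .y (.var .y + 1) ;; powProg)

/-- Multiplication stops once the partial product exceeds `n`. This keeps all numbers within a word,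
and the comparison with `n` stays correct because powers of `y + 1` do not decrease. -/
theorem powProg_spec {Γ : Ctx} {s : Store} (hn : s.v .n < Γ.Z) (hp : s.v .p < Γ.Z)
    (hy : s.v .y ≤ Γ.Z) :
    WP Γ powProg s fun s' t => SameV [.pw, .k] s s' ∧ s'.a = s.a ∧ s'.out = s.out ∧
      (s'.v .pw ≤ s.v .n ↔ (s.v .y + 1) ^ s.v .p ≤ s.v .n) ∧ t ≤ s.v .p * 40 + 20 := by
  have hW := Γ.lin_le
  have hZ := Γ.hZ
  refine WP.seq (WP.asg (by simp; omega) ?_)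
  refine WP.forTo (s.v .p) 26 (fun k s1 => SameV [.pw, .k] s s1 ∧ s1.a = s.a ∧ s1.out = s.out ∧
    (s1.v .pw ≤ s.v .n → s1.v .pw = (s.v .y + 1) ^ k) ∧
    (s.v .n < s1.v .pw → s.v .n < (s.v .y + 1) ^ k)) ?_ (by omega) (by omega) ?_ ?_ ?_
  · refine ⟨((SameV.refl _ s).set (by simp) _).set (by simp) _, rfl, rfl, ?_, ?_⟩ <;> simp
  · rintro k s1 - ⟨hv, -⟩ -
    simp [hv .p (by simp)]
  · rintro k s1 hk ⟨hv, ha, ho, h1, h2⟩ hk1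
    have en := hv .n (by simp)
    have ey := hv .y (by simp)
    refine WP.cond (by simp [en]; omega) (fun hc => ?_) (fun hc => ?_)
    · simp [en] at hc
      have hle : s1.v .pw ≤ s.v .n := by omega
      have hpw := h1 hle
      have hprod : s1.v .pw * (s.v .y + 1) ≤ Γ.Z * (Γ.Z + 1) :=
        Nat.mul_le_mul (by omega) (by omega)
      have hsq := Γ.sq_le
      have hZ2 : Γ.Z * (Γ.Z + 1) = Γ.Z ^ 2 + Γ.Z := by ring
      have hZ1 : Γ.Z ≤ Γ.Z ^ 2 := by rw [pow_two]; exact Nat.le_mul_of_pos_left _ (by omega)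
      refine WP.asg (by simp [ey]; omega) ⟨by simp, by simp [hk1],
        ((hv.set (by simp) _).set (by simp) _), by simpa using ha, by simpa using ho, ?_, ?_⟩
      · intro _; simp [hpw, ey, pow_succ]
      · simp [hpw, ey, pow_succ]
    · simp [en] at hc
      refine WP.skip ⟨by simp, hk1, hv.set (by simp) _, ha, ho, ?_, ?_⟩
      · simp; intro h; omega
      · simp; intro h
        exact (h2 h).trans_le (Nat.pow_le_pow_right (by omega) (by omega))
  · rintro s1 t ⟨hv, ha, ho, h1, h2⟩ - ht
    refine ⟨hv, ha, ho, ⟨fun h => h1 h ▸ h, fun h => ?_⟩, by simp at ht ⊢; omega⟩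
    by_contra hc
    exact absurd (h2 (by omega)) (by omega)

/-- Linear search: one power computation of cost proportional to `p` per candidate. The time is
proportional to `p` times the root itself, which the exploration of the phase also pays as a factor.
-/
theorem rootProg_spec {Γ : Ctx} {s : Store} (hn : s.v .n + 3 ≤ Γ.Z) (hn0 : 1 ≤ s.v .n)
    (hp : s.v .p < Γ.Z) (hp0 : 1 ≤ s.v .p) :
    WP Γ rootProg s fun s' t => SameV [.y, .pw, .k] s s' ∧ s'.a = s.a ∧ s'.out = s.out ∧
      1 ≤ s'.v .y ∧ s'.v .y ^ s.v .p ≤ s.v .n ∧ s.v .n < (s'.v .y + 1) ^ s.v .p ∧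
      t ≤ 110 * (s.v .p * s'.v .y) := by
  have hW := Γ.lin_le
  have hZ := Γ.hZ
  refine WP.seq (WP.asg (by simp) (WP.seq (WP.asg (by simp; omega) ?_)))
  have hone : 1 ≤ s.v .n := hn0
  refine WP.loop (s.v .n + 1) (s.v .p * 40 + 30) (fun k s1 => SameV [.y, .pw, .k] s s1 ∧
    s1.a = s.a ∧ s1.out = s.out ∧ s1.v .y = k ∧ k ^ s.v .p ≤ s.v .n ∧
    (s1.v .pw ≤ s.v .n ↔ (k + 1) ^ s.v .p ≤ s.v .n)) ?_ ?_ ?_ ?_ ?_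
  · refine ⟨((SameV.refl _ s).set (by simp) _).set (by simp) _, rfl, rfl, by simp, ?_, by simp⟩
    rw [zero_pow (by omega)]; omega
  · rintro k s1 - ⟨hv, -⟩
    simp [hv .n (by simp)]; omega
  -- The search never completes `n + 1` rounds, since `(n + 1) ^ p` exceeds `n`.
  · rintro s1 ⟨hv, -, -, hy, hpow, -⟩
    exfalso
    have : s.v .n + 1 ≤ (s.v .n + 1) ^ s.v .p := Nat.le_self_pow (by omega) _
    omega
  · rintro k s1 hk ⟨hv, ha, ho, hy, h1, h2⟩ hc
    have en := hv .n (by simp)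
    have ep := hv .p (by simp)
    simp [en] at hc
    refine WP.seq (WP.asg (by simp; omega) ?_)
    refine (powProg_spec (by simp [en]; omega) (by simpa [ep] using hp) (by simp; omega)).mono ?_
    rintro s2 t ⟨hv2, ha2, ho2, h2', ht⟩
    simp [en, ep, hy] at h2' ht ha2 ho2
    refine ⟨by simp; omega, (hv.set (by simp) _).trans hv2 (by simp), by simp [ha2, ha],
      by simp [ho2, ho], ?_, h2.1 (by omega), h2'⟩
    rw [hv2 .y (by simp)]; simp [hy]
  · rintro k s1 t hk ⟨hv, ha, ho, hy, h1, h2⟩ hc ht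
    have en := hv .n (by simp)
    simp [en] at hc
    have hk1 : s.v .n < (k + 1) ^ s.v .p := by
      by_contra h; have := h2.2 (by omega); omega
    have hk0 : 1 ≤ k := by
      rcases Nat.eq_zero_or_pos k with rfl | h
      · simp at hk1; omega
      · exact h
    refine ⟨hv, ha, ho, by omega, by rw [hy]; exact h1, by rw [hy]; exact hk1, ?_⟩
    rw [hy]
    simp at ht ⊢
    have hm : 1 ≤ s.v .p * k := Nat.mul_pos hp0 hk0
    have hkm : k ≤ s.v .p * k := Nat.le_mul_of_pos_left _ hp0
    have : k * (s.v .p * 40 + 30 + 7 + 1) = 40 * (s.v .p * k) + 38 * k := by ring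
    omega

end RAM

namespace RAM

/-! ## Bounded multi-source exploration -/

/-- The position of the other endpoint in a list of pairs. -/
def twin (e : ℕ) : ℕ := 4 * (e / 2) + 1 - e

/-- The tail of the `e`-th directed edge. -/
def Ctx.src (Γ : Ctx) (e : ℕ) : ℕ := Γ.inp (5 + e)

/-- The head of the `e`-th directed edge. -/
def Ctx.dst (Γ : Ctx) (e : ℕ) : ℕ := Γ.inp (5 + twin e)

/-- The input of `Γ` from cell `5` on lists `m2` directed edges on the vertices `0, …, n - 1`, and
`Near k u v` says that the distance of `u` and `v` is at most `k`. -/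
structure EdgeMetric (Γ : Ctx) (n m2 : ℕ) (Near : ℕ → ℕ → ℕ → Prop) : Prop where
  n_lt : n + 3 ≤ Γ.Z
  len_le : 5 + m2 ≤ Γ.len
  even : Even m2
  src_lt : ∀ e < m2, Γ.src e < n
  zero : ∀ u v, Near 0 u v → u = v
  refl : ∀ u < n, Near 0 u u
  symm : ∀ k u v, Near k u v → Near k v u
  trans : ∀ k l u v w, Near k u v → Near l v w → Near (k + l) u w
  edge : ∀ e < m2, Near 1 (Γ.src e) (Γ.dst e)
  step : ∀ k u v, Near (k + 1) u v → Near k u v ∨ ∃ e < m2, Near k u (Γ.src e) ∧ Γ.dst e = v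

theorem twin_lt {e m2 : ℕ} (h : Even m2) (he : e < m2) : twin e < m2 := by
  obtain ⟨m, rfl⟩ := h
  unfold twin; omega

theorem EdgeMetric.dst_lt {Γ : Ctx} {n m2 : ℕ} {Near : ℕ → ℕ → ℕ → Prop}
    (h : EdgeMetric Γ n m2 Near) {e : ℕ} (he : e < m2) : Γ.dst e < n :=
  h.src_lt _ (twin_lt h.even he)

/-- The lists built by an exploration from the centers `P`: every vertex `v` knows at most `Q`
centers `lst v 0, …, lst v (cnt v - 1)`, and `mk v c - 1` is a bound on the distance of the center
`c` known to `v`; it is at most `T`. -/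
structure Explored (n : ℕ) (Near : ℕ → ℕ → ℕ → Prop) (P : Finset ℕ) (Q T : ℕ)
    (cnt : ℕ → ℕ) (lst mk : ℕ → ℕ → ℕ) : Prop where
  sub : ∀ c ∈ P, c < n
  cnt_le : ∀ v < n, cnt v ≤ Q
  lst_mk : ∀ v < n, ∀ j < cnt v, lst v j ∈ P ∧ mk v (lst v j) ≠ 0
  inj : ∀ v < n, ∀ j j', j < cnt v → j' < cnt v → lst v j = lst v j' → j = j'
  mk_lst : ∀ v < n, ∀ c < n, mk v c ≠ 0 →
    c ∈ P ∧ mk v c ≤ T + 1 ∧ Near (mk v c - 1) c v ∧ ∃ j < cnt v, lst v j = c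
  center : ∀ c ∈ P, 0 < cnt c ∧ lst c 0 = c

theorem Explored.mono {n : ℕ} {Near : ℕ → ℕ → ℕ → Prop} {P : Finset ℕ} {Q T T' : ℕ} {cnt : ℕ → ℕ}
    {lst mk : ℕ → ℕ → ℕ} (h : Explored n Near P Q T cnt lst mk) (hT : T ≤ T') :
    Explored n Near P Q T' cnt lst mk :=
  ⟨h.sub, h.cnt_le, h.lst_mk, h.inj, fun v hv c hc hm =>
    ⟨(h.mk_lst v hv c hc hm).1, (h.mk_lst v hv c hc hm).2.1.trans (by omega),
      (h.mk_lst v hv c hc hm).2.2⟩, h.center⟩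

/-- A center with mark `0` at `v` is not in the list of `v`, so appending it keeps the list free of
repetitions. -/
theorem Explored.insert {n : ℕ} {Near : ℕ → ℕ → ℕ → Prop} {P : Finset ℕ} {Q T : ℕ} {cnt : ℕ → ℕ}
    {lst mk : ℕ → ℕ → ℕ} (h : Explored n Near P Q T cnt lst mk) {v c d : ℕ} (hc : c ∈ P)
    (hm : mk v c = 0) (hQ : cnt v < Q) (hd : d ≤ T) (hN : Near d c v)
    {cnt' : ℕ → ℕ} {lst' mk' : ℕ → ℕ → ℕ}
    (e1 : ∀ v', cnt' v' = if v' = v then cnt v + 1 else cnt v')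
    (e2 : ∀ v' j', lst' v' j' = if v' = v ∧ j' = cnt v then c else lst v' j')
    (e3 : ∀ v' c', mk' v' c' = if v' = v ∧ c' = c then d + 1 else mk v' c') :
    Explored n Near P Q T cnt' lst' mk' := by
  refine ⟨h.sub, ?_, ?_, ?_, ?_, ?_⟩
  · intro v' hv'
    rw [e1]; split_ifs with hvv
    · exact hQ
    · exact h.cnt_le v' hv'
  · intro v' hv' j hj
    rw [e1] at hj; rw [e2]
    split_ifs at hj with hvv
    · subst hvv
      by_cases hjc : j = cnt v'
      · simp [hjc, hc, e3]
      · have hj' : j < cnt v' := by omega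
        obtain ⟨h1, h2⟩ := h.lst_mk v' hv' j hj'
        refine ⟨by simpa [hjc] using h1, ?_⟩
        rw [e3]; split_ifs <;> simp_all
    · obtain ⟨h1, h2⟩ := h.lst_mk v' hv' j hj
      simp [hvv, e3, h1, h2]
  · intro v' hv' j j' hj hj' heq
    rw [e1] at hj hj'; rw [e2, e2] at heq
    split_ifs at hj hj' with hvv
    · subst hvv
      have key : ∀ i < cnt v', lst v' i ≠ c := fun i hi hic =>
        (h.lst_mk v' hv' i hi).2 (by rw [hic]; exact hm)
      by_cases h1 : j = cnt v' <;> by_cases h2 : j' = cnt v'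
      · omega
      · simp [h1, h2] at heq; exact absurd heq.symm (key _ (by omega))
      · simp [h1, h2] at heq; exact absurd heq (key _ (by omega))
      · simp [h1, h2] at heq; exact h.inj v' hv' j j' (by omega) (by omega) heq
    · simp [hvv] at heq; exact h.inj v' hv' j j' hj hj' heq
  · intro v' hv' c' hc' hmk
    rw [e3] at hmk ⊢
    split_ifs at hmk ⊢ with hvc
    · obtain ⟨rfl, rfl⟩ := hvc
      exact ⟨hc, by omega, hN, cnt v', by simp [e1], by simp [e2]⟩
    · obtain ⟨h1, h2, h3, j, hj, hj'⟩ := h.mk_lst v' hv' c' hc' hmk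
      refine ⟨h1, h2, h3, j, ?_, ?_⟩
      · rw [e1]; split_ifs with hvv
        · subst hvv; omega
        · exact hj
      · rw [e2, if_neg]
        · exact hj'
        · rintro ⟨rfl, rfl⟩; omega
  · intro c' hc'
    obtain ⟨h1, h2⟩ := h.center c' hc'
    refine ⟨by rw [e1]; split_ifs <;> omega, ?_⟩
    rw [e2, if_neg]
    · exact h2
    · rintro ⟨rfl, h0⟩; omega

/-- Every vertex knows `Q` centers or all centers at distance at most `T`. -/
def Complete (n : ℕ) (Near : ℕ → ℕ → ℕ → Prop) (P : Finset ℕ) (Q T : ℕ) (cnt : ℕ → ℕ)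
    (mk : ℕ → ℕ → ℕ) : Prop :=
  ∀ v < n, cnt v = Q ∨ ∀ c ∈ P, ∀ k ≤ T, Near k c v → mk v c ≠ 0 ∧ mk v c ≤ k + 1

/-- Truncated lists lose nothing: if `v` is not full after the round, no neighbour `u` was full
before it, since `u` would have passed on `Q` distinct centers. Hence `u` knew all centers at
distance at most `T`, and they have all reached `v`. -/
theorem Complete.succ {Γ : Ctx} {n m2 : ℕ} {Near : ℕ → ℕ → ℕ → Prop} (hE : EdgeMetric Γ n m2 Near)
    {P : Finset ℕ} {Q T : ℕ} {cnt cnt' : ℕ → ℕ} {lst lst' mk mk' : ℕ → ℕ → ℕ}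
    (hc : Complete n Near P Q T cnt mk) (h : Explored n Near P Q T cnt lst mk)
    (h' : Explored n Near P Q (T + 1) cnt' lst' mk')
    (hcnt : ∀ v < n, cnt v ≤ cnt' v) (hmk : ∀ v < n, ∀ c < n, mk v c ≠ 0 → mk' v c = mk v c)
    (hpush : ∀ e < m2, ∀ c < n, mk (Γ.src e) c ≠ 0 → cnt' (Γ.dst e) = Q ∨ mk' (Γ.dst e) c ≠ 0) :
    Complete n Near P Q (T + 1) cnt' mk' := by
  intro v hv
  by_cases hQ : cnt' v = Q
  · exact .inl hQ
  right
  have hlt : cnt v < Q := by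
    have := h'.cnt_le v hv; have := hcnt v hv; omega
  have hall := (hc v hv).resolve_left (by omega)
  intro c hcP k hk hN
  have hcn := h.sub c hcP
  rcases Nat.lt_or_ge T k with hTk | hTk
  · obtain rfl : k = T + 1 := by omega
    have hmain : mk' v c ≠ 0 := by
      rcases hE.step T c v hN with hN' | ⟨e, he, hN', rfl⟩
      · rw [hmk v hv c hcn (hall c hcP T le_rfl hN').1]
        exact (hall c hcP T le_rfl hN').1
      · have hu := hE.src_lt e he
        rcases hc _ hu with hfull | hu'
        · exfalso
          -- Pigeonhole: the `Q` distinct centers of a full tail would occupy `Q` distinct positions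
          -- in the list of the head.
          have hmap : ∀ j < Q, ∃ j' < cnt' (Γ.dst e), lst' (Γ.dst e) j' = lst (Γ.src e) j := by
            intro j hj
            obtain ⟨hp, hm⟩ := h.lst_mk _ hu j (by omega)
            have := (hpush e he _ (h.sub _ hp) hm).resolve_left hQ
            exact (h'.mk_lst _ hv _ (h.sub _ hp) this).2.2.2
          choose! g hg hg' using hmap
          have : (Finset.range Q).card ≤ (Finset.range (cnt' (Γ.dst e))).card := by
            refine Finset.card_le_card_of_injOn g (fun j hj => ?_) ?_
            · simpa using hg j (by simpa using hj)
            · intro j hj j' hj' heq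
              simp only [Finset.coe_range, Set.mem_Iio] at hj hj'
              refine h.inj _ hu j j' (by omega) (by omega) ?_
              rw [← hg' j hj, ← hg' j' hj', heq]
          have hle := h'.cnt_le _ hv
          simp at this; omega
        · exact (hpush e he c hcn (hu' c hcP T le_rfl hN').1).resolve_left hQ
    exact ⟨hmain, (h'.mk_lst v hv c hcn hmain).2.1⟩
  · obtain ⟨h1, h2⟩ := hall c hcP k hTk hN
    rw [hmk v hv c hcn h1]
    exact ⟨h1, h2⟩

/-- The view of the exploration arrays in a phase. -/
def Store.Explored (s : Store) (i n : ℕ) (Near : ℕ → ℕ → ℕ → Prop) (P : Finset ℕ) (Q T : ℕ) : Prop :=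
  RAM.Explored n Near P Q T (fun v => s.a .cnt i v 0) (s.a .list i) (s.a .mark i)

/-- `s'` arises from `s` by insertions into the lists of phase `i`. -/
structure Grown (i n : ℕ) (s s' : Store) : Prop where
  cnt : ∀ v < n, s.a .cnt i v 0 ≤ s'.a .cnt i v 0
  mark : ∀ v < n, ∀ c < n, s.a .mark i v c ≠ 0 → s'.a .mark i v c = s.a .mark i v c
  lst : ∀ v < n, ∀ j < s.a .cnt i v 0, s'.a .list i v j = s.a .list i v j
  frame : ∀ A i', (A ≠ .mark ∧ A ≠ .list ∧ A ≠ .cnt) ∨ i' ≠ i → s'.a A i' = s.a A i'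
  out : s'.out = s.out

theorem Grown.refl (i n : ℕ) (s : Store) : Grown i n s s :=
  ⟨fun _ _ => le_rfl, fun _ _ _ _ _ => rfl, fun _ _ _ _ => rfl, fun _ _ _ => rfl, rfl⟩

theorem Grown.trans {i n : ℕ} {s s' s'' : Store} (h : Grown i n s s') (h' : Grown i n s' s'') :
    Grown i n s s'' where
  cnt v hv := (h.cnt v hv).trans (h'.cnt v hv)
  mark v hv c hc hm := by
    have e := h.mark v hv c hc hm
    rw [h'.mark v hv c hc (by rwa [e]), e]
  lst v hv j hj := by rw [h'.lst v hv j (hj.trans_le (h.cnt v hv)), h.lst v hv j hj]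
  frame A i' hA := (h'.frame A i' hA).trans (h.frame A i' hA)
  out := h'.out.trans h.out

theorem Grown.set {i n : ℕ} {s s' : Store} (h : Grown i n s s') (x : Var) (b : ℕ) :
    Grown i n s (s'.set x b) := ⟨h.cnt, h.mark, h.lst, h.frame, h.out⟩

/-- Offer the `j`-th center known to `u` to `v`. -/
def offerProg : Prog :=
  asg .c (.get .list (.var .i) (.var .u) (.var .j)) ;;
  asg .d (.get .mark (.var .i) (.var .u) (.var .c)) ;;
  cond (.var .t + 2 - .var .d)
    (cond (.get .mark (.var .i) (.var .v) (.var .c)) .skip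
      (cond (.var .y + 2 - .get .cnt (.var .i) (.var .v) 0)
        (sto .mark (.var .i) (.var .v) (.var .c) (.var .d + 1) ;;
          sto .list (.var .i) (.var .v) (.get .cnt (.var .i) (.var .v) 0) (.var .c) ;;
          sto .cnt (.var .i) (.var .v) 0 (.get .cnt (.var .i) (.var .v) 0 + 1)) .skip)) .skip

/-- Marks are distance bounds plus one. The guard `t + 2 - d` is nonzero exactly for marks `d ≤ T +
1`, so the new mark `d + 1` is at most `T + 2`, as round `T` permits. -/
theorem offerProg_spec {Γ : Ctx} {n m2 : ℕ} {Near : ℕ → ℕ → ℕ → Prop} (hE : EdgeMetric Γ n m2 Near)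
    {s : Store} {P : Finset ℕ} {i Y T e j : ℕ} (he : e < m2) (hi : s.v .i = i) (hiZ : i < Γ.Z)
    (hT : s.v .t = T) (hTn : T < n) (hu : s.v .u = Γ.src e) (hv : s.v .v = Γ.dst e)
    (hy : s.v .y = Y) (hYn : Y ≤ n) (hj : s.v .j = j) (hju : j < s.a .cnt i (Γ.src e) 0)
    (hs : s.Explored i n Near P (Y + 2) (T + 1)) :
    WP Γ offerProg s fun s' t => t ≤ 200 ∧ SameV [.c, .d] s s' ∧ Grown i n s s' ∧
      s'.Explored i n Near P (Y + 2) (T + 1) ∧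
      (s.a .mark i (Γ.src e) (s.a .list i (Γ.src e) j) ≤ T + 1 →
        s'.a .cnt i (Γ.dst e) 0 = Y + 2 ∨ s'.a .mark i (Γ.dst e) (s.a .list i (Γ.src e) j) ≠ 0) := by
  have hun := hE.src_lt e he
  have hvn := hE.dst_lt he
  have hnZ := hE.n_lt
  have hW := Γ.lin_le
  have hZ := Γ.hZ
  set u := Γ.src e with hu'
  set v := Γ.dst e with hv'
  set c := s.a .list i u j with hc
  obtain ⟨hcP, hmc⟩ := hs.lst_mk u hun j hju
  have hcn : c < n := hs.sub c hcP
  change c ∈ P at hcP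
  change s.a .mark i u c ≠ 0 at hmc
  obtain ⟨-, hmT, hN, -⟩ := hs.mk_lst u hun c hcn hmc
  have hjle : j < Y + 2 := hju.trans_le (hs.cnt_le u hun)
  have hcv := hs.cnt_le v hvn
  have hmv := fun h => (hs.mk_lst v hvn c hcn h)
  set d := s.a .mark i u c with hd
  refine WP.seq (WP.asg (by simp [hi, hu, hj]; omega) ?_)
  refine WP.seq (WP.asg (by simp [hi, hu, hj, ← hc]; omega) ?_)
  have hsv0 : SameV [.c, .d] s ((s.set .c c).set .d d) :=
    ((SameV.refl _ s).set (by simp) _).set (by simp) _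
  simp only [Expr.eval, Store.set_v, Store.set_a, hi, hu, hj, reduceCtorEq, if_false, if_true,
    ← hc, ← hd]
  have hskip : ∀ t, t ≤ 200 → (d ≤ T + 1 → s.a .cnt i v 0 = Y + 2 ∨ s.a .mark i v c ≠ 0) →
      t ≤ 200 ∧ SameV [.c, .d] s ((s.set .c c).set .d d) ∧ Grown i n s ((s.set .c c).set .d d) ∧
      ((s.set .c c).set .d d).Explored i n Near P (Y + 2) (T + 1) ∧
      (d ≤ T + 1 → ((s.set .c c).set .d d).a .cnt i v 0 = Y + 2 ∨
        ((s.set .c c).set .d d).a .mark i v c ≠ 0) :=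
    fun t ht h => ⟨ht, hsv0, ((Grown.refl i n s).set _ _).set _ _, hs, h⟩
  refine WP.cond (by simp [hT]; omega) (fun h1 => ?_) (fun h1 => ?_)
  rotate_left
  · simp [hT] at h1
    exact WP.skip (hskip _ (by simp) (by omega))
  simp [hT] at h1
  refine WP.cond (by simp [hi, hv]; omega) (fun h2 => ?_) (fun h2 => ?_)
  · simp [hi, hv] at h2
    exact WP.skip (hskip _ (by simp) (fun _ => .inr h2))
  simp [hi, hv] at h2
  refine WP.cond (by simp [hi, hv, hy]; omega) (fun h3 => ?_) (fun h3 => ?_)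
  rotate_left
  · simp [hi, hv, hy] at h3
    exact WP.skip (hskip _ (by simp) (fun _ => .inl (by omega)))
  simp [hi, hv, hy] at h3
  refine WP.seq (WP.sto (by simp) (by simp) (by simp) (by simp; omega) (by simp [hi]; omega)
    (by simp [hv]; omega) (by simp; omega) ?_)
  refine WP.seq (WP.sto (by simp) (by simp) (by simp [hi, hv]; omega) (by simp)
    (by simp [hi]; omega) (by simp [hv]; omega) (by simp [hi, hv]; omega) ?_)
  refine WP.sto (by simp) (by simp) (by simp) (by simp [hi, hv]; omega)
    (by simp [hi]; omega) (by simp [hv]; omega) (by simp; omega) ?_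
  simp only [Expr.eval, Store.set_v, Store.set_a, hi, hv, reduceCtorEq, if_false, if_true,
    Store.put_v, Store.put_a, false_and, Expr.ofNat_def, Expr.add_def, Op.eval]
  refine ⟨by simp, hsv0, ?_, ?_, ?_⟩
  · constructor
    · intro v' _; simp; split_ifs with h
      · rw [h]; omega
      · exact le_rfl
    · intro v' _ c' _ hm; simp; rintro rfl rfl; exact absurd h2 hm
    · intro v' _ j' hj'; simp; rintro rfl rfl; omega
    · intro A i' hA; funext a b
      rcases hA with ⟨hA1, hA2, hA3⟩ | hA
      · simp [hA1, hA2, hA3]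
      · simp [hA]
    · rfl
  · have hNv : Near d c v := by
      have h4 := hE.trans _ _ _ _ _ hN (hE.edge e he)
      rwa [show d - 1 + 1 = d by omega] at h4
    refine RAM.Explored.insert hs hcP h2 (by omega) (d := d) (by omega) hNv ?_ ?_ ?_
    · intro v'; simp
    · intro v' j'; simp
    · intro v' c'; simp
  · intro _; right; simp

/-- Offer all centers known to the tail of the `e`-th edge to its head. -/
def relaxProg : Prog :=
  asg .u (.inp (5 + .var .e)) ;; asg .v (.inp (5 + (4 * (.var .e / 2) + 1 - .var .e))) ;;
  asg .l (.get .cnt (.var .i) (.var .u) 0) ;; forTo .j (.var .l) offerProg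

/-- The length of the tail's list is read once, before the loop. Lists only grow and marks never
change, so the entries up to that length stay valid while the head is being filled. -/
theorem relaxProg_spec {Γ : Ctx} {n m2 : ℕ} {Near : ℕ → ℕ → ℕ → Prop} (hE : EdgeMetric Γ n m2 Near)
    {s : Store} {P : Finset ℕ} {i Y T e : ℕ} (he : s.v .e = e) (hem : e < m2) (hi : s.v .i = i)
    (hiZ : i < Γ.Z) (hT : s.v .t = T) (hTn : T < n) (hy : s.v .y = Y) (hYn : Y ≤ n)
    (hs : s.Explored i n Near P (Y + 2) (T + 1)) :
    WP Γ relaxProg s fun s' t => t ≤ 213 * (Y + 2) + 60 ∧ SameV [.c, .d, .u, .v, .l, .j] s s' ∧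
      Grown i n s s' ∧ s'.Explored i n Near P (Y + 2) (T + 1) ∧
      (∀ c < n, s.a .mark i (Γ.src e) c ≠ 0 → s.a .mark i (Γ.src e) c ≤ T + 1 →
        s'.a .cnt i (Γ.dst e) 0 = Y + 2 ∨ s'.a .mark i (Γ.dst e) c ≠ 0) := by
  have hun := hE.src_lt e hem
  have hvn := hE.dst_lt hem
  have hnZ := hE.n_lt
  have hW := Γ.lin_le
  have hcub := Γ.cube_le
  have hlen := Γ.hlen
  have hml := hE.len_le
  have hZ := Γ.hZ
  have htw := twin_lt hE.even hem
  refine WP.seq (WP.asg (by simp [he]; omega) ?_)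
  refine WP.seq (WP.asg (by simp [he]; unfold twin at htw; omega) ?_)
  refine WP.seq (WP.asg (by simp [he, hi]; exact ⟨hiZ, by change Γ.src e < _; omega, by omega⟩) ?_)
  have hcu := hs.cnt_le _ hun
  set s0 := ((s.set .u (Γ.src e)).set .v (Γ.dst e)).set .l (s.a .cnt i (Γ.src e) 0) with hs0
  have hs0' : SameV [.c, .d, .u, .v, .l, .j] s s0 :=
    (((SameV.refl _ s).set (by simp) _).set (by simp) _).set (by simp) _
  have hstart : (((s.set .u (Expr.eval Γ s (.inp (5 + .var .e)))).set .v
      (Expr.eval Γ (s.set .u (Expr.eval Γ s (.inp (5 + .var .e))))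
        (.inp (5 + (4 * (.var .e / 2) + 1 - .var .e))))).set .l
      (Expr.eval Γ ((s.set .u (Expr.eval Γ s (.inp (5 + .var .e)))).set .v
      (Expr.eval Γ (s.set .u (Expr.eval Γ s (.inp (5 + .var .e))))
        (.inp (5 + (4 * (.var .e / 2) + 1 - .var .e))))) (.get .cnt (.var .i) (.var .u) 0))) = s0 := by
    simp [hs0, he, hi, Ctx.src, Ctx.dst, twin]
  rw [hstart]
  refine WP.forTo (s.a .cnt i (Γ.src e) 0) 200 (fun j s1 => SameV [.c, .d, .j] s0 s1 ∧
    Grown i n s s1 ∧ s1.Explored i n Near P (Y + 2) (T + 1) ∧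
    ∀ j' < j, s.a .mark i (Γ.src e) (s.a .list i (Γ.src e) j') ≤ T + 1 →
      s1.a .cnt i (Γ.dst e) 0 = Y + 2 ∨
        s1.a .mark i (Γ.dst e) (s.a .list i (Γ.src e) j') ≠ 0) ?_ (by omega) (by omega) ?_ ?_ ?_
  · refine ⟨(SameV.refl _ _).set (by simp) _, ?_, hs, by simp⟩
    exact ((((Grown.refl i n s).set _ _).set _ _).set _ _).set _ _
  · rintro k s1 - ⟨hv, -⟩ -
    simp [hv .l (by simp), hs0]
  · rintro j s1 hj ⟨hv, hg, hx, hoff⟩ hj1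
    have hlst := hg.lst _ hun j hj
    have hm := hs.lst_mk _ hun j hj
    have hcn := hs.sub _ hm.1
    have hmk := hg.mark _ hun _ hcn hm.2
    refine (offerProg_spec hE (P := P) (i := i) (Y := Y) (T := T) (j := j) hem ?_ hiZ ?_ hTn ?_ ?_ ?_
      hYn hj1 (hj.trans_le (hg.cnt _ hun)) hx).mono ?_
    · rw [hv .i (by simp)]; simp [hs0, hi]
    · rw [hv .t (by simp)]; simp [hs0, hT]
    · rw [hv .u (by simp)]; simp [hs0]
    · rw [hv .v (by simp)]; simp [hs0]
    · rw [hv .y (by simp)]; simp [hs0, hy]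
    rintro s2 t ⟨ht, hv2, hg2, hx2, hoff2⟩
    refine ⟨ht, by rw [hv2 .j (by simp), hj1], (hv.trans hv2 (by simp)).set (by simp) _,
      (hg.trans hg2).set _ _, hx2, ?_⟩
    intro j' hj' hle
    rcases Nat.lt_succ_iff_lt_or_eq.1 hj' with hlt | rfl
    · have hmem := hs.lst_mk _ hun j' (hlt.trans hj)
      rcases hoff j' hlt hle with h | h
      · left
        have h1 := hg2.cnt _ hvn
        have h2 := hx2.cnt_le _ hvn
        simp only [Store.set_a] at h2 ⊢; omega
      · right
        have := hg2.mark _ hvn _ (hs.sub _ hmem.1) h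
        simp only [Store.set_a]; rwa [this]
    · rw [hlst, hmk] at hoff2
      exact hoff2 hle
  · rintro s1 t ⟨hv, hg, hx, hoff⟩ - ht
    refine ⟨?_, hs0'.trans hv (by simp), hg, hx, ?_⟩
    · simp at ht ⊢
      have : s.a .cnt i (Γ.src e) 0 * 213 ≤ 213 * (Y + 2) := by rw [Nat.mul_comm]; omega
      omega
    · intro c hc hm hle
      obtain ⟨-, -, -, j, hj, rfl⟩ := hs.mk_lst _ hun c hc hm
      exact hoff j hj hle

/-- The exploration. -/
def exploreProg : Prog := forTo .t (.var .dl) (forTo .e (.var .m2) relaxProg)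

theorem exploreProg_spec {Γ : Ctx} {n m2 : ℕ} {Near : ℕ → ℕ → ℕ → Prop} (hE : EdgeMetric Γ n m2 Near)
    {s : Store} {P : Finset ℕ} {i Y D : ℕ} (hi : s.v .i = i) (hiZ : i < Γ.Z) (hm : s.v .m2 = m2)
    (hD : s.v .dl = D) (hDn : D ≤ n) (hy : s.v .y = Y) (hYn : Y ≤ n)
    (hs : s.Explored i n Near P (Y + 2) 0)
    (hc : Complete n Near P (Y + 2) 0 (fun v => s.a .cnt i v 0) (s.a .mark i)) :
    WP Γ exploreProg s fun s' t => t ≤ D * (m2 * (213 * (Y + 2) + 73) + 22) + 9 ∧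
      SameV [.t, .e, .c, .d, .u, .v, .l, .j] s s' ∧ Grown i n s s' ∧
      s'.Explored i n Near P (Y + 2) D ∧
      Complete n Near P (Y + 2) D (fun v => s'.a .cnt i v 0) (s'.a .mark i) := by
  have hnZ := hE.n_lt
  have hW := Γ.lin_le
  have hcub := Γ.cube_le
  have hlen := Γ.hlen
  have hml := hE.len_le
  have hZ := Γ.hZ
  refine WP.forTo D (m2 * (213 * (Y + 2) + 73) + 9) (fun T s1 =>
    SameV [.t, .e, .c, .d, .u, .v, .l, .j] s s1 ∧ Grown i n s s1 ∧
    s1.Explored i n Near P (Y + 2) T ∧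
    Complete n Near P (Y + 2) T (fun v => s1.a .cnt i v 0) (s1.a .mark i)) ?_ (by omega) (by omega)
    ?_ ?_ ?_
  · exact ⟨(SameV.refl _ s).set (by simp) _, (Grown.refl i n s).set _ _, hs, hc⟩
  · rintro k s1 - ⟨hv, -⟩ -
    simp [hv .dl (by simp), hD]
  · rintro T s1 hT ⟨hv, hg, hx, hcomp⟩ hT1
    refine WP.forTo m2 (213 * (Y + 2) + 60) (fun e s2 =>
      SameV [.e, .c, .d, .u, .v, .l, .j] s1 s2 ∧ Grown i n s1 s2 ∧
      s2.Explored i n Near P (Y + 2) (T + 1) ∧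
      ∀ e' < e, ∀ c < n, s1.a .mark i (Γ.src e') c ≠ 0 →
        s2.a .cnt i (Γ.dst e') 0 = Y + 2 ∨ s2.a .mark i (Γ.dst e') c ≠ 0) ?_ (by omega) (by omega)
      ?_ ?_ ?_
    · exact ⟨(SameV.refl _ _).set (by simp) _, (Grown.refl i n s1).set _ _,
        RAM.Explored.mono hx (by omega), by simp⟩
    · rintro k s2 - ⟨hv2, -⟩ -
      simp [hv2 .m2 (by simp), hv .m2 (by simp), hm]
    · rintro e s2 he ⟨hv2, hg2, hx2, hpush⟩ he2
      refine (relaxProg_spec hE (P := P) (i := i) (Y := Y) (T := T) he2 he ?_ hiZ ?_ (by omega) ?_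
        hYn hx2).mono ?_
      · rw [hv2 .i (by simp), hv .i (by simp), hi]
      · rw [hv2 .t (by simp), hT1]
      · rw [hv2 .y (by simp), hv .y (by simp), hy]
      rintro s3 t ⟨ht, hv3, hg3, hx3, hpush3⟩
      refine ⟨ht, by rw [hv3 .e (by simp), he2], (hv2.trans hv3 (by simp)).set (by simp) _,
        (hg2.trans hg3).set _ _, hx3, ?_⟩
      intro e' he' c hc' hm'
      rcases Nat.lt_succ_iff_lt_or_eq.1 he' with hlt | rfl
      · have hvn := hE.dst_lt (hlt.trans he)
        rcases hpush e' hlt c hc' hm' with h | h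
        · left
          have h1 := hg3.cnt _ hvn
          have h2 := hx3.cnt_le _ hvn
          simp only [Store.set_a] at h2 ⊢; omega
        · right
          have := hg3.mark _ hvn _ hc' h
          simp only [Store.set_a]; rwa [this]
      · have hun := hE.src_lt e' he
        -- A mark present at the start of the round is at most `T + 1` and does not change, so the
        -- guard on offers lets it through.
        have e1 := hg2.mark _ hun c hc' hm'
        have := (hx.mk_lst _ hun c hc' hm').2.1
        exact hpush3 c hc' (by rwa [e1]) (by rw [e1]; omega)
    · rintro s2 t ⟨hv2, hg2, hx2, hpush⟩ - ht
      refine ⟨?_, ?_, (hv.trans hv2 (by simp)).set (by simp) _, (hg.trans hg2).set _ _, hx2, ?_⟩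
      · simp at ht ⊢
        have : m2 * (213 * (Y + 2) + 60 + 2 + 11) = m2 * (213 * (Y + 2) + 73) := by ring
        omega
      · rw [hv2 .t (by simp), hT1]
      · exact hcomp.succ hE hx hx2 hg2.cnt hg2.mark hpush
  · rintro s1 t ⟨hv, hg, hx, hcomp⟩ - ht
    refine ⟨?_, hv, hg, hx, hcomp⟩
    simp at ht ⊢
    have : D * (m2 * (213 * (Y + 2) + 73) + 9 + 2 + 11) = D * (m2 * (213 * (Y + 2) + 73) + 22) := by
      ring
    omega

end RAM

namespace RAM

/-! ## One phase of the construction -/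

theorem exists_lt_succ_eq_iff (h : ℕ → ℕ) (k v : ℕ) :
    (∃ a < k + 1, h a = v) ↔ (∃ a < k, h a = v) ∨ h k = v := by
  constructor
  · rintro ⟨a, ha, rfl⟩
    rcases Nat.lt_succ_iff_lt_or_eq.1 ha with hlt | rfl
    · exact .inl ⟨a, hlt, rfl⟩
    · exact .inr rfl
  · rintro (⟨a, ha, rfl⟩ | rfl)
    · exact ⟨a, by omega, rfl⟩
    · exact ⟨k, by omega, rfl⟩

/-- Only the slices in `X` of the arrays may differ. -/
def SameA (X : List (Arr × ℕ)) (s s' : Store) : Prop :=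
  ∀ A i, (A, i) ∉ X → s'.a A i = s.a A i

theorem SameA.refl (X : List (Arr × ℕ)) (s : Store) : SameA X s s := fun _ _ _ => rfl

theorem SameA.of_eq (X : List (Arr × ℕ)) {s s' : Store} (h : s'.a = s.a) : SameA X s s' :=
  fun _ _ _ => by rw [h]

theorem SameA.trans {X Y : List (Arr × ℕ)} {s s' s'' : Store} (h : SameA X s s') (h' : SameA Y s' s'')
    (hXY : Y ⊆ X) : SameA X s s'' :=
  fun A i hx => (h' A i fun hy => hx (hXY hy)).trans (h A i hx)

theorem SameA.mono {X Y : List (Arr × ℕ)} {s s' : Store} (h : SameA X s s') (hXY : X ⊆ Y) :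
    SameA Y s s' :=
  fun A i hx => h A i fun hy => hx (hXY hy)

theorem SameA.set {X : List (Arr × ℕ)} {s s' : Store} (h : SameA X s s') (x : Var) (b : ℕ) :
    SameA X s (s'.set x b) := h

theorem SameA.put {X : List (Arr × ℕ)} {s s' : Store} (h : SameA X s s') {A : Arr} {i : ℕ}
    (hA : (A, i) ∈ X) (j k b : ℕ) : SameA X s (s'.put A i j k b) := by
  intro A' i' hx
  rw [← h A' i' hx]
  funext j' k'
  simp only [Store.put_a]
  rw [if_neg]
  rintro ⟨rfl, rfl, -⟩
  exact hx hA

/-- The slice `i` of `plist` enumerates `P`. -/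
structure Store.Enum (s : Store) (i : ℕ) (P : Finset ℕ) : Prop where
  mem : ∀ a < P.card, s.a .plist i a 0 ∈ P
  surj : ∀ c ∈ P, ∃ a < P.card, s.a .plist i a 0 = c
  inj : ∀ a < P.card, ∀ b < P.card, s.a .plist i a 0 = s.a .plist i b 0 → a = b

theorem Store.Enum.congr {s s' : Store} {i : ℕ} {P : Finset ℕ} (h : s.Enum i P)
    (e : s'.a .plist i = s.a .plist i) : s'.Enum i P := by
  refine ⟨?_, ?_, ?_⟩
  · rw [e]; exact h.mem
  · rw [e]; exact h.surj
  · rw [e]; exact h.inj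

theorem Store.Enum.insert {s s' : Store} {i : ℕ} {P : Finset ℕ} (h : s.Enum i P) {c : ℕ} (hc : c ∉ P)
    (e : ∀ a, s'.a .plist i a 0 = if a = P.card then c else s.a .plist i a 0) :
    s'.Enum i (Insert.insert c P) := by
  have hcard : (Insert.insert c P).card = P.card + 1 := Finset.card_insert_of_notMem hc
  refine ⟨?_, ?_, ?_⟩
  · intro a ha
    rw [hcard] at ha
    rw [e]; split_ifs with h1
    · simp
    · exact Finset.mem_insert_of_mem (h.mem a (by omega))
  · intro x hx
    rw [hcard]
    rcases Finset.mem_insert.1 hx with rfl | hx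
    · exact ⟨P.card, by omega, by simp [e]⟩
    · obtain ⟨a, ha, rfl⟩ := h.surj x hx
      exact ⟨a, by omega, by rw [e, if_neg (by omega)]⟩
  · intro a ha b hb hab
    rw [hcard] at ha hb
    rw [e, e] at hab
    split_ifs at hab with h1 h2 h2
    · omega
    · exact absurd (h.mem b (by omega)) (by rwa [← hab])
    · exact absurd (h.mem a (by omega)) (by rwa [hab])
    · exact h.inj a (by omega) b (by omega) hab

/-- Every center knows itself. -/
def initProg : Prog :=
  forTo .a (.var .np) (asg .c (.get .plist (.var .i) (.var .a) 0) ;;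
    sto .list (.var .i) (.var .c) 0 (.var .c) ;; sto .cnt (.var .i) (.var .c) 0 1 ;;
    sto .mark (.var .i) (.var .c) (.var .c) 1)

/-- Base case of the exploration. A center occupies position `0` of its own list, with mark `1` for
distance `0`; at radius `0` there is nothing else to know. -/
theorem initProg_spec {Γ : Ctx} {n m2 : ℕ} {Near : ℕ → ℕ → ℕ → Prop} (hE : EdgeMetric Γ n m2 Near)
    {s : Store} {P : Finset ℕ} {i Q : ℕ} (hi : s.v .i = i) (hiZ : i < Γ.Z) (hnp : s.v .np = P.card)
    (hP : s.Enum i P) (hPn : ∀ c ∈ P, c < n) (hPc : P.card ≤ n) (hQ : 1 ≤ Q)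
    (h0 : ∀ v, s.a .cnt i v 0 = 0) (h1 : ∀ v c, s.a .mark i v c = 0) :
    WP Γ initProg s fun s' t => t ≤ 113 * P.card + 9 ∧ SameV [.a, .c] s s' ∧
      SameA [(.list, i), (.cnt, i), (.mark, i)] s s' ∧ s'.out = s.out ∧
      s'.Explored i n Near P Q 0 ∧
      Complete n Near P Q 0 (fun v => s'.a .cnt i v 0) (s'.a .mark i) := by
  have hnZ := hE.n_lt
  have hW := Γ.lin_le
  have hZ := Γ.hZ
  refine WP.forTo P.card 100 (fun k s1 => SameV [.a, .c] s s1 ∧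
    SameA [(.list, i), (.cnt, i), (.mark, i)] s s1 ∧ s1.out = s.out ∧
    (∀ v, s1.a .cnt i v 0 = if ∃ a < k, s.a .plist i a 0 = v then 1 else 0) ∧
    (∀ v c, s1.a .mark i v c = if c = v ∧ ∃ a < k, s.a .plist i a 0 = v then 1 else 0) ∧
    ∀ a < k, s1.a .list i (s.a .plist i a 0) 0 = s.a .plist i a 0) ?_ (by omega) (by omega) ?_ ?_ ?_
  · exact ⟨(SameV.refl _ s).set (by simp) _, SameA.refl _ s, rfl, by simp [h0], by simp [h1], by simp⟩
  · rintro k s1 - ⟨hv, -⟩ -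
    simp [hv .np (by simp), hnp]
  · rintro k s1 hk ⟨hv, ha, ho, hcnt, hmark, hlist⟩ hk1
    have ei : s1.v .i = i := by rw [hv .i (by simp), hi]
    have ep : s1.a .plist i = s.a .plist i := ha _ _ (by simp)
    have hcn := hPn _ (hP.mem k hk)
    set c := s.a .plist i k 0 with hc
    refine WP.seq (WP.asg (by simp [ei, hk1]; omega) ?_)
    refine WP.seq (WP.sto (by simp) (by simp) (by simp) (by simp) (by simp [ei]; omega)
      (by simp [ei, hk1, ep, ← hc]; omega) (by simp; omega) ?_)
    refine WP.seq (WP.sto (by simp) (by simp) (by simp) (by simp; omega) (by simp [ei]; omega)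
      (by simp [ei, hk1, ep, ← hc]; omega) (by simp; omega) ?_)
    refine WP.sto (by simp) (by simp) (by simp) (by simp; omega) (by simp [ei]; omega)
      (by simp [ei, hk1, ep, ← hc]; omega) (by simp [ei, hk1, ep, ← hc]; omega) ?_
    simp only [Expr.eval, Store.set_v, Store.set_a, ei, hk1, ep, reduceCtorEq, if_false, if_true,
      Store.put_v, Store.put_a, false_and, Expr.ofNat_def, ← hc]
    refine ⟨by simp, by simp [hk1], ?_, ?_, by simpa using ho, ?_, ?_, ?_⟩
    · exact (hv.set (by simp) _).set (by simp) _
    · exact (((ha.set _ _).put (by simp) _ _ _).put (by simp) _ _ _).put (by simp) _ _ _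
    · intro v
      simp only [exists_lt_succ_eq_iff (fun a => s.a .plist i a 0), ← hc]
      simp [hcnt]
      by_cases hvc : v = c
      · simp [hvc]
      · simp [hvc, Ne.symm hvc]
    · intro v d
      simp only [exists_lt_succ_eq_iff (fun a => s.a .plist i a 0), ← hc]
      simp [hmark]
      by_cases hvc : v = c
      · by_cases hdc : d = c <;> simp [hvc, hdc]
      · simp [hvc, Ne.symm hvc]
    · intro a ha'
      simp
      rcases Nat.lt_succ_iff_lt_or_eq.1 ha' with hlt | rfl
      · split_ifs with h
        · exact h.symm
        · exact hlist a hlt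
      · simp [← hc]
  · rintro s1 t ⟨hv, ha, ho, hcnt, hmark, hlist⟩ - ht
    have hmem : ∀ v, (∃ a < P.card, s.a .plist i a 0 = v) ↔ v ∈ P := fun v =>
      ⟨fun ⟨a, h, e⟩ => e ▸ hP.mem a h, hP.surj v⟩
    simp only [hmem] at hcnt hmark
    have hl : ∀ c ∈ P, s1.a .list i c 0 = c := by
      intro c hc
      obtain ⟨a, h, rfl⟩ := hP.surj c hc
      exact hlist a h
    refine ⟨by simp at ht ⊢; omega, hv, ha, ho, ⟨hPn, ?_, ?_, ?_, ?_, ?_⟩, ?_⟩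
    · intro v _
      simp only [hcnt]; split_ifs <;> omega
    · intro v _ j hj
      simp only [hcnt] at hj
      split_ifs at hj with h
      · obtain rfl : j = 0 := by omega
        simp [hl v h, hmark, h]
      · omega
    · intro v _ j j' hj hj' _
      simp only [hcnt] at hj hj'
      split_ifs at hj hj' <;> omega
    · intro v hvn c _ hm
      simp only [hmark] at hm ⊢
      split_ifs at hm with h
      · obtain ⟨rfl, h⟩ := h
        refine ⟨h, by simp [h], by simpa [h] using hE.refl c hvn, 0, by simp [hcnt, h], hl c h⟩
      · exact absurd rfl hm
    · intro c hc
      simp [hcnt, hc, hl c hc]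
    · intro v _
      right
      intro c hc k hk hN
      obtain rfl : k = 0 := by omega
      obtain rfl := hE.zero _ _ hN
      simp [hmark, hc]

/-- Look for a claimed center `g` in the list of `c`; `f` becomes its claim. -/
def scanProg : Prog :=
  asg .f 0 ;; forTo .j (.var .l) (asg .x (.get .list (.var .i) (.var .c) (.var .j)) ;;
    cond (.get .claim (.var .i) (.var .x) 0)
      (asg .f (.get .claim (.var .i) (.var .x) 0) ;; asg .g (.var .x)) .skip)

/-- A claim by center `r` is stored as `r + 1`, so `f = 0` can signal that no listed center is
claimed. Among several claimed centers the last one wins, which is immaterial. -/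
theorem scanProg_spec {Γ : Ctx} {s : Store} {n i c l : ℕ} (hn : n + 3 ≤ Γ.Z) (hi : s.v .i = i)
    (hiZ : i < Γ.Z) (hc : s.v .c = c) (hcn : c < n) (hl : s.v .l = l) (hln : l ≤ n + 2)
    (hlst : ∀ j < l, s.a .list i c j < n) :
    WP Γ scanProg s fun s' t => t ≤ 113 * l + 20 ∧ SameV [.f, .g, .x, .j] s s' ∧ s'.a = s.a ∧
      s'.out = s.out ∧ ((s'.v .f = 0 ∧ ∀ j < l, s.a .claim i (s.a .list i c j) 0 = 0) ∨
        (s'.v .f ≠ 0 ∧ ∃ j < l, s'.v .g = s.a .list i c j ∧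
          s.a .claim i (s.a .list i c j) 0 = s'.v .f)) := by
  have hW := Γ.lin_le
  have hZ := Γ.hZ
  refine WP.seq (WP.asg (by simp) ?_)
  refine WP.forTo l 100 (fun k s1 => SameV [.f, .g, .x, .j] s s1 ∧ s1.a = s.a ∧ s1.out = s.out ∧
    ((s1.v .f = 0 ∧ ∀ j < k, s.a .claim i (s.a .list i c j) 0 = 0) ∨
        (s1.v .f ≠ 0 ∧ ∃ j < k, s1.v .g = s.a .list i c j ∧
          s.a .claim i (s.a .list i c j) 0 = s1.v .f))) ?_ (by omega) (by omega) ?_ ?_ ?_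
  · exact ⟨((SameV.refl _ s).set (by simp) _).set (by simp) _, rfl, rfl, by simp⟩
  · rintro k s1 - ⟨hv, -⟩ -
    simp [hv .l (by simp), hl]
  · rintro k s1 hk ⟨hv, ha, ho, hor⟩ hk1
    have ei : s1.v .i = i := by rw [hv .i (by simp), hi]
    have ec : s1.v .c = c := by rw [hv .c (by simp), hc]
    have hxn := hlst k hk
    set x := s.a .list i c k with hx
    refine WP.seq (WP.asg (by simp [ei, hk1, ec]; omega) ?_)
    simp only [Expr.eval, ei, ec, hk1, ha, ← hx]
    refine WP.cond (by simp [ei]; omega) (fun h => ?_) (fun h => ?_)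
    · simp [ei, ha] at h
      refine WP.seq (WP.asg (by simp [ei]; omega) (WP.asg (by simp) ?_))
      simp only [Expr.eval, Store.set_v, Store.set_a, ei, reduceCtorEq, if_false, if_true,
        Expr.ofNat_def]
      refine ⟨by simp, by simp [hk1], ?_, ha, ho, ?_⟩
      · exact (((hv.set (by simp) _).set (by simp) _).set (by simp) _).set (by simp) _
      · right
        exact ⟨by simpa [ha] using h, k, by omega, by simp [hx], by simp [hx, ha]⟩
    · simp [ei, ha] at h
      refine WP.skip ⟨by simp, by simp [hk1], (hv.set (by simp) _).set (by simp) _, ha, ho, ?_⟩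
      rcases hor with ⟨h1, h2⟩ | ⟨h1, j, hj, h2, h3⟩
      · left
        refine ⟨by simpa using h1, fun j hj => ?_⟩
        rcases Nat.lt_succ_iff_lt_or_eq.1 hj with hlt | rfl
        · exact h2 j hlt
        · exact h
      · right
        exact ⟨by simpa using h1, j, by omega, by simpa using h2, by simpa using h3⟩
  · rintro s1 t ⟨hv, ha, ho, hor⟩ - ht
    exact ⟨by simp at ht ⊢; omega, hv, ha, ho, hor⟩

/-- Output the edges from `c` to the other centers in its list. -/
def spokesProg : Prog :=
  forTo .j (.var .l - 1) (asg .x (.get .list (.var .i) (.var .c) (.var .j + 1)) ;;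
    emit (.var .c) (.var .x) (.get .mark (.var .i) (.var .c) (.var .x) - 1))

/-- The edges output by `spokesProg`. -/
def spokes (s : Store) (i c l : ℕ) : List (ℕ × ℕ × ℕ) :=
  (List.range (l - 1)).map fun j =>
    (c, s.a .list i c (j + 1), s.a .mark i c (s.a .list i c (j + 1)) - 1)

theorem spokesProg_spec {Γ : Ctx} {s : Store} {n i c l : ℕ} (hn : n + 3 ≤ Γ.Z) (hi : s.v .i = i)
    (hiZ : i < Γ.Z) (hc : s.v .c = c) (hcn : c < n) (hl : s.v .l = l) (hln : l ≤ n + 2)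
    (hlst : ∀ j < l, s.a .list i c j < n) (hout : s.out.length + l ≤ Γ.Z ^ 3) :
    WP Γ spokesProg s fun s' t => t ≤ 113 * l + 20 ∧ SameV [.x, .j] s s' ∧ s'.a = s.a ∧
      s'.out = s.out ++ spokes s i c l := by
  have hW := Γ.lin_le
  have hZ := Γ.hZ
  refine WP.forTo (l - 1) 98 (fun k s1 => SameV [.x, .j] s s1 ∧ s1.a = s.a ∧
    s1.out = s.out ++ (List.range k).map fun j =>
      (c, s.a .list i c (j + 1), s.a .mark i c (s.a .list i c (j + 1)) - 1)) ?_ (by omega) (by omega)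
    ?_ ?_ ?_
  · exact ⟨(SameV.refl _ s).set (by simp) _, rfl, by simp⟩
  · rintro k s1 - ⟨hv, -⟩ -
    simp [hv .l (by simp), hl]; omega
  · rintro k s1 hk ⟨hv, ha, ho⟩ hk1
    have ei : s1.v .i = i := by rw [hv .i (by simp), hi]
    have ec : s1.v .c = c := by rw [hv .c (by simp), hc]
    have hxn := hlst (k + 1) (by omega)
    set x := s.a .list i c (k + 1) with hx
    refine WP.seq (WP.asg (by simp [ei, hk1, ec]; omega) ?_)
    simp only [Expr.eval, Expr.add_def, Expr.ofNat_def, Op.eval, ei, ec, hk1, ha, ← hx]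
    refine WP.emit (by simp) (by simp) (by simp [ei, ec]; omega) (by simp [ho]; omega) ?_
    refine ⟨by simp, by simp [hk1], ?_, by simpa using ha, ?_⟩
    · exact (hv.set (x := .x) (by simp) x).set (by simp) _
    · simp [ho, ei, ec, ha, ← hx, List.range_succ]
  · rintro s1 t ⟨hv, ha, ho⟩ - ht
    refine ⟨?_, hv, ha, ho⟩
    simp at ht ⊢
    have : (l - 1) * (98 + 4 + 11) ≤ l * 113 := Nat.mul_le_mul (by omega) (by omega)
    omega

/-- Claim the centers in the list of `c` for `c`. -/
def claimProg : Prog :=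
  forTo .j (.var .l) (asg .x (.get .list (.var .i) (.var .c) (.var .j)) ;;
    sto .claim (.var .i) (.var .x) 0 (.var .c + 1))

theorem claimProg_spec {Γ : Ctx} {s : Store} {n i c l : ℕ} (hn : n + 3 ≤ Γ.Z) (hi : s.v .i = i)
    (hiZ : i < Γ.Z) (hc : s.v .c = c) (hcn : c < n) (hl : s.v .l = l) (hln : l ≤ n + 2)
    (hlst : ∀ j < l, s.a .list i c j < n) :
    WP Γ claimProg s fun s' t => t ≤ 113 * l + 20 ∧ SameV [.x, .j] s s' ∧ SameA [(.claim, i)] s s' ∧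
      s'.out = s.out ∧ ∀ x, s'.a .claim i x 0 =
        if ∃ j < l, s.a .list i c j = x then c + 1 else s.a .claim i x 0 := by
  have hW := Γ.lin_le
  have hZ := Γ.hZ
  refine WP.forTo l 100 (fun k s1 => SameV [.x, .j] s s1 ∧ SameA [(.claim, i)] s s1 ∧
    s1.out = s.out ∧ ∀ x, s1.a .claim i x 0 =
      if ∃ j < k, s.a .list i c j = x then c + 1 else s.a .claim i x 0) ?_ (by omega) (by omega)
    ?_ ?_ ?_
  · exact ⟨(SameV.refl _ s).set (by simp) _, SameA.refl _ s, rfl, by simp⟩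
  · rintro k s1 - ⟨hv, -⟩ -
    simp [hv .l (by simp), hl]
  · rintro k s1 hk ⟨hv, ha, ho, hcl⟩ hk1
    have ei : s1.v .i = i := by rw [hv .i (by simp), hi]
    have ec : s1.v .c = c := by rw [hv .c (by simp), hc]
    have el : s1.a .list i = s.a .list i := ha _ _ (by simp)
    have hxn := hlst k hk
    set x := s.a .list i c k with hx
    refine WP.seq (WP.asg (by simp [ei, hk1, ec]; omega) ?_)
    simp only [Expr.eval, ei, ec, hk1, el, ← hx]
    refine WP.sto (by simp) (by simp) (by simp) (by simp [ec]; omega) (by simp [ei]; omega)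
      (by simp; omega) (by simp; omega) ?_
    simp only [Expr.eval, Store.set_v, Store.set_a, ei, ec, reduceCtorEq, if_false, if_true,
      Expr.ofNat_def, Expr.add_def, Op.eval]
    refine ⟨by simp, by simp [hk1], ?_, (ha.set .x x).put (by simp) _ _ _, ho, ?_⟩
    · exact (hv.set (x := .x) (by simp) x).set (by simp) _
    · intro z
      simp only [exists_lt_succ_eq_iff (fun j => s.a .list i c j), ← hx]
      simp [hcl]
      by_cases hz : z = x
      · simp [hz]
      · simp [hz, Ne.symm hz]
  · rintro s1 t ⟨hv, ha, ho, hcl⟩ - ht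
    exact ⟨by simp at ht ⊢; omega, hv, ha, ho, hcl⟩

end RAM

/-! ### The first pass of a phase: greedy disjoint stars -/

namespace RAM

theorem Store.Explored.spokes_length (s : Store) (i c l : ℕ) : (spokes s i c l).length = l - 1 := by
  simp [spokes]

theorem Store.Explored.spokes_sound {s : Store} {i n : ℕ} {Near : ℕ → ℕ → ℕ → Prop} {P : Finset ℕ}
    {Q T : ℕ} (h : s.Explored i n Near P Q T) (hsymm : ∀ k u v, Near k u v → Near k v u) {c : ℕ}
    (hc : c < n) : ∀ e ∈ spokes s i c (s.a .cnt i c 0), e.1 < n ∧ e.2.1 < n ∧ Near e.2.2 e.1 e.2.1 := by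
  intro e he
  simp only [spokes, List.mem_map, List.mem_range] at he
  obtain ⟨j, hj, rfl⟩ := he
  obtain ⟨hP, hm⟩ := h.lst_mk c hc (j + 1) (by omega)
  have hx := h.sub _ hP
  exact ⟨hc, hx, hsymm _ _ _ (h.mk_lst c hc _ hx hm).2.2.1⟩

/-- Position `0` holds the center itself and gets no edge; every other known center sits at a later
position. -/
theorem Store.Explored.mem_spokes {s : Store} {i n : ℕ} {Near : ℕ → ℕ → ℕ → Prop} {P : Finset ℕ}
    {Q T : ℕ} (h : s.Explored i n Near P Q T) {c x : ℕ} (hc : c ∈ P) (hx : x < n)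
    (hm : s.a .mark i c x ≠ 0) :
    c = x ∨ (c, x, s.a .mark i c x - 1) ∈ spokes s i c (s.a .cnt i c 0) := by
  obtain ⟨-, -, -, j, hj, rfl⟩ := h.mk_lst c (h.sub c hc) x hx hm
  rcases Nat.eq_zero_or_pos j with rfl | hj0
  · exact .inl (h.center c hc).2.symm
  · right
    simp only [spokes, List.mem_map, List.mem_range]
    exact ⟨j - 1, by omega, by rw [Nat.sub_add_cancel hj0]⟩

/-- The result of the first pass of phase `i`: `P'` are the centers of the stars formed so far, `H`
are the edges of the stars. -/
structure Starred (s s1 : Store) (i n : ℕ) (Near : ℕ → ℕ → ℕ → Prop) (P : Finset ℕ) (Y : ℕ)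
    (P' : Finset ℕ) (H : List (ℕ × ℕ × ℕ)) : Prop where
  sub : P' ⊆ P
  enum : s1.Enum (i + 1) P'
  center : ∀ r ∈ P', s1.a .claim i r 0 ≠ 0
  claim : ∀ x, s1.a .claim i x 0 ≠ 0 → x ∈ P ∧ ∃ r ∈ P', s1.a .claim i x 0 = r + 1 ∧
    s.a .mark i r x ≠ 0 ∧ (r = x ∨ (r, x, s.a .mark i r x - 1) ∈ H)
  count : (P.filter fun x => s1.a .claim i x 0 ≠ 0).card = (Y + 2) * P'.card
  len : H.length = (Y + 1) * P'.card
  sound : ∀ e ∈ H, e.1 < n ∧ e.2.1 < n ∧ Near e.2.2 e.1 e.2.1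
  out : s1.out = s.out ++ H

theorem Starred.congr {s s1 s2 : Store} {i n : ℕ} {Near : ℕ → ℕ → ℕ → Prop} {P : Finset ℕ} {Y : ℕ}
    {P' : Finset ℕ} {H : List (ℕ × ℕ × ℕ)} (h : Starred s s1 i n Near P Y P' H)
    (ha : s2.a = s1.a) (ho : s2.out = s1.out) : Starred s s2 i n Near P Y P' H := by
  refine ⟨h.sub, h.enum.congr (by rw [ha]), ?_, ?_, ?_, h.len, h.sound, by rw [ho, h.out]⟩
  · rw [ha]; exact h.center
  · rw [ha]; exact h.claim
  · rw [ha]; exact h.count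

/-- All `Y + 2` centers listed by `c` are unclaimed, `c` itself among them, so the new star is
disjoint from the old ones. It adds `Y + 2` claims, `Y + 1` edges and one center. -/
theorem Starred.insert {s s1 s2 : Store} {i n : ℕ} {Near : ℕ → ℕ → ℕ → Prop} {P : Finset ℕ} {Y D : ℕ}
    {P' : Finset ℕ} {H : List (ℕ × ℕ × ℕ)} (h : Starred s s1 i n Near P Y P' H)
    (hx : s.Explored i n Near P (Y + 2) D) (hsymm : ∀ k u v, Near k u v → Near k v u) {c : ℕ}
    (hc : c ∈ P) (hcnt : s.a .cnt i c 0 = Y + 2)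
    (hfree : ∀ j < Y + 2, s1.a .claim i (s.a .list i c j) 0 = 0)
    (e1 : ∀ x, s2.a .claim i x 0 =
      if ∃ j < Y + 2, s.a .list i c j = x then c + 1 else s1.a .claim i x 0)
    (e2 : ∀ a, s2.a .plist (i + 1) a 0 = if a = P'.card then c else s1.a .plist (i + 1) a 0)
    (e3 : s2.out = s1.out ++ spokes s i c (Y + 2)) :
    c ∉ P' ∧ Starred s s2 i n Near P Y (Insert.insert c P') (H ++ spokes s i c (Y + 2)) := by
  have hcn := hx.sub c hc
  have hc0 := (hx.center c hc).2
  have hcP' : c ∉ P' := by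
    intro hmem
    refine h.center c hmem ?_
    have := hfree 0 (by omega)
    rwa [hc0] at this
  have hcard : (Insert.insert c P').card = P'.card + 1 := Finset.card_insert_of_notMem hcP'
  refine ⟨hcP', ?_, h.enum.insert hcP' e2, ?_, ?_, ?_, ?_, ?_, by rw [e3, h.out, List.append_assoc]⟩
  · exact Finset.insert_subset hc h.sub
  · intro r hr
    rw [e1]
    split_ifs with hex
    · omega
    · rcases Finset.mem_insert.1 hr with rfl | hr
      · exact absurd ⟨0, by omega, hc0⟩ hex
      · exact h.center r hr
  · intro x hcl
    rw [e1] at hcl ⊢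
    split_ifs at hcl ⊢ with hex
    · obtain ⟨j, hj, rfl⟩ := hex
      obtain ⟨hP, hm⟩ := hx.lst_mk c hcn j (by rw [hcnt]; exact hj)
      refine ⟨hP, c, Finset.mem_insert_self _ _, rfl, hm, ?_⟩
      have := hx.mem_spokes hc (hx.sub _ hP) hm
      rw [hcnt] at this
      exact this.imp_right fun h => List.mem_append_right _ h
    · obtain ⟨h1, r, hr, h2, h3, h4⟩ := h.claim x hcl
      exact ⟨h1, r, Finset.mem_insert_of_mem hr, h2, h3, h4.imp_right fun h => List.mem_append_left _ h⟩
  · have hset : (P.filter fun x => s2.a .claim i x 0 ≠ 0) =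
        (P.filter fun x => s1.a .claim i x 0 ≠ 0) ∪
          (Finset.range (Y + 2)).image fun j => s.a .list i c j := by
      ext x
      simp only [Finset.mem_filter, Finset.mem_union, Finset.mem_image, Finset.mem_range, e1]
      constructor
      · rintro ⟨hxP, hne⟩
        split_ifs at hne with hex
        · exact .inr hex
        · exact .inl ⟨hxP, hne⟩
      · rintro (⟨hxP, hne⟩ | ⟨j, hj, rfl⟩)
        · refine ⟨hxP, ?_⟩
          split_ifs
          · omega
          · exact hne
        · refine ⟨(hx.lst_mk c hcn j (by rw [hcnt]; exact hj)).1, ?_⟩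
          rw [if_pos ⟨j, hj, rfl⟩]; omega
    rw [hset, Finset.card_union_of_disjoint, h.count, hcard, Finset.card_image_of_injOn]
    · simp; ring
    · intro j hj j' hj' heq
      simp only [Finset.coe_range, Set.mem_Iio] at hj hj'
      exact hx.inj c hcn j j' (by rw [hcnt]; exact hj) (by rw [hcnt]; exact hj') heq
    · rw [Finset.disjoint_left]
      intro x h1 h2
      simp only [Finset.mem_filter, Finset.mem_image, Finset.mem_range] at h1 h2
      obtain ⟨j, hj, rfl⟩ := h2
      exact h1.2 (hfree j hj)
  · rw [List.length_append, h.len, Store.Explored.spokes_length, hcard]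
    simp; ring
  · intro e he
    rcases List.mem_append.1 he with he | he
    · exact h.sound e he
    · rw [← hcnt] at he
      exact hx.spokes_sound hsymm hcn e he

/-- Form the star of the center `c` if `c` knows many centers and none is claimed. -/
def starProg : Prog :=
  asg .c (.get .plist (.var .i) (.var .a) 0) ;; asg .l (.get .cnt (.var .i) (.var .c) 0) ;;
  cond (.var .l - (.var .y + 1))
    (scanProg ;; cond (.var .f) .skip
      (claimProg ;; spokesProg ;; sto .plist (.var .i + 1) (.var .nq) 0 (.var .c) ;;
        asg .nq (.var .nq + 1))) .skip

/-- The stars are disjoint sets of `Y + 2` centers each. -/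
theorem Starred.card_le {s s1 : Store} {i n : ℕ} {Near : ℕ → ℕ → ℕ → Prop} {P : Finset ℕ} {Y : ℕ}
    {P' : Finset ℕ} {H : List (ℕ × ℕ × ℕ)} (h : Starred s s1 i n Near P Y P' H) :
    (Y + 2) * P'.card ≤ P.card := by
  rw [← h.count]; exact Finset.card_filter_le _ _

/-- Greedy maximality: a popular center is blocked by a claimed center in its list or claims its
list now. Since claims are never cleared, it sees a claimed center from then on. -/
theorem starProg_spec {Γ : Ctx} {n m2 : ℕ} {Near : ℕ → ℕ → ℕ → Prop} (hE : EdgeMetric Γ n m2 Near)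
    {s s1 : Store} {P P' : Finset ℕ} {H : List (ℕ × ℕ × ℕ)} {i Y D k : ℕ} (hi : s1.v .i = i)
    (hiZ : i + 1 < Γ.Z) (hk : s1.v .a = k) (hkP : k < P.card) (hPn : P.card ≤ n) (hy : s1.v .y = Y)
    (hYn : Y ≤ n) (hP : s.Enum i P) (hx : s.Explored i n Near P (Y + 2) D)
    (ha : SameA [(.claim, i), (.plist, i + 1)] s s1)
    (hout : s.out.length + 2 * n + 2 ≤ Γ.Z ^ 3) (hs : Starred s s1 i n Near P Y P' H)
    (hq : s1.v .nq = P'.card) :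
    WP Γ starProg s1 fun s2 t => t ≤ 339 * (Y + 2) + 200 ∧ SameV [.c, .l, .f, .g, .x, .j, .nq] s1 s2 ∧
      SameA [(.claim, i), (.plist, i + 1)] s s2 ∧
      (∀ x, s1.a .claim i x 0 ≠ 0 → s2.a .claim i x 0 ≠ 0) ∧
      (s.a .cnt i (s.a .plist i k 0) 0 = Y + 2 → ∃ j < Y + 2,
        s2.a .claim i (s.a .list i (s.a .plist i k 0) j) 0 ≠ 0) ∧
      ∃ P'' H', Starred s s2 i n Near P Y P'' H' ∧ s2.v .nq = P''.card := by
  have hnZ := hE.n_lt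
  have hW := Γ.lin_le
  have hZ := Γ.hZ
  have hc := hP.mem k hkP
  set c := s.a .plist i k 0 with hcdef
  have hcn := hx.sub c hc
  have ep : s1.a .plist i = s.a .plist i := ha _ _ (by simp)
  have el : s1.a .list i = s.a .list i := ha _ _ (by simp)
  have em : s1.a .mark i = s.a .mark i := ha _ _ (by simp)
  have ec : s1.a .cnt i = s.a .cnt i := ha _ _ (by simp)
  have hle := hx.cnt_le c hcn
  set l := s.a .cnt i c 0 with hl
  have hlst : ∀ j < l, s.a .list i c j < n := fun j hj => hx.sub _ (hx.lst_mk c hcn j hj).1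
  refine WP.seq (WP.asg (by simp [hi, hk]; omega) (WP.seq (WP.asg (by simp [hi, hk, ep, ← hcdef]; omega) ?_)))
  simp only [Expr.eval, Expr.ofNat_def, hi, hk, ep, ec, ← hcdef, Store.set_v, Store.set_a, reduceCtorEq,
    if_true, if_false, ← hl]
  set s1' := (s1.set .c c).set .l l with hs1'
  have hv1 : SameV [.c, .l, .f, .g, .x, .j, .nq] s1 s1' :=
    ((SameV.refl _ _).set (by simp) _).set (by simp) _
  have hst1 : Starred s s1' i n Near P Y P' H := hs.congr rfl rfl
  refine WP.cond (by simp [hs1', hy]; omega) (fun hpop => ?_) (fun hpop => ?_)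
  rotate_left
  · simp [hs1', hy] at hpop
    exact WP.skip ⟨by simp, hv1, ha, fun x h => h, fun h => by omega, P', H, hst1,
      by simp [hs1', hq]⟩
  simp [hs1', hy] at hpop
  have hlY : l = Y + 2 := by omega
  refine WP.seq ((scanProg_spec (n := n) (i := i) (c := c) (l := l) hnZ (by simp [hs1', hi]) (by omega)
    (by simp [hs1']) hcn (by simp [hs1']) (by omega)
    (by intro j hj; rw [hs1', Store.set_a, Store.set_a, el]; exact hlst j hj)).mono ?_)
  rintro s2 t2 ⟨ht2, hv2, ha2, ho2, hor⟩
  have ha2' : s2.a = s1.a := ha2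
  have ho2' : s2.out = s1.out := ho2
  have hsa2 : SameA [(.claim, i), (.plist, i + 1)] s s2 :=
    ha.trans (SameA.of_eq [(.claim, i), (.plist, i + 1)] ha2') (by simp)
  have hst2 : Starred s s2 i n Near P Y P' H := hs.congr ha2' ho2'
  have hv2' : SameV [.c, .l, .f, .g, .x, .j, .nq] s1 s2 := hv1.trans hv2 (by simp)
  have hnq2 : s2.v .nq = P'.card := by rw [hv2 .nq (by simp)]; simp [hs1', hq]
  have hs1a : s1'.a = s1.a := rfl
  rw [hs1a, el] at hor
  refine WP.cond (by simp) (fun hf => ?_) (fun hf => ?_)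
  · simp at hf
    obtain ⟨-, j, hj, -, hcl⟩ := hor.resolve_left (fun h => hf h.1)
    refine WP.skip ⟨by simp; omega, hv2', hsa2, fun x h => by rwa [ha2'], fun _ => ?_, P', H, hst2, hnq2⟩
    exact ⟨j, by omega, by rw [ha2', hcl]; exact hf⟩
  simp at hf
  have hfree := (hor.resolve_right (fun h => h.1 hf)).2
  have ei2 : s2.v .i = i := by rw [hv2 .i (by simp)]; simp [hs1', hi]
  have ec2 : s2.v .c = c := by rw [hv2 .c (by simp)]; simp [hs1']
  have el2 : s2.v .l = l := by rw [hv2 .l (by simp)]; simp [hs1']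
  refine WP.seq ((claimProg_spec (n := n) hnZ ei2 (by omega) ec2 hcn el2 (by omega)
    (by rw [ha2', el]; exact hlst)).mono ?_)
  rintro s3 t3 ⟨ht3, hv3, ha3, ho3, hcl3⟩
  have hla3 : s3.a .list i = s.a .list i := by rw [ha3 _ _ (by simp), ha2', el]
  have hma3 : s3.a .mark i = s.a .mark i := by rw [ha3 _ _ (by simp), ha2', em]
  -- Each star has fewer edges than centers, and the stars are disjoint, which leaves room in the
  -- output area.
  have hlenH : H.length ≤ n := by
    have h1 := hs.card_le
    have h2 : (Y + 1) * P'.card ≤ (Y + 2) * P'.card := Nat.mul_le_mul_right _ (by omega)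
    rw [hs.len]; omega
  have ei3 : s3.v .i = i := by rw [hv3 .i (by simp), ei2]
  have ec3 : s3.v .c = c := by rw [hv3 .c (by simp), ec2]
  have el3 : s3.v .l = l := by rw [hv3 .l (by simp), el2]
  refine WP.seq ((spokesProg_spec (n := n) hnZ ei3 (by omega) ec3 hcn el3 (by omega)
    (by rw [hla3]; exact hlst)
    (by rw [ho3, ho2', hs.out, List.length_append]; omega)).mono ?_)
  rintro s4 t4 ⟨ht4, hv4, ha4, ho4⟩
  have hsp : spokes s3 i c l = spokes s i c l := by simp only [spokes, hla3, hma3]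
  have ei4 : s4.v .i = i := by rw [hv4 .i (by simp), ei3]
  have ec4 : s4.v .c = c := by rw [hv4 .c (by simp), ec3]
  have enq4 : s4.v .nq = P'.card := by rw [hv4 .nq (by simp), hv3 .nq (by simp), hnq2]
  have hP'n : P'.card ≤ n := (Finset.card_le_card hs.sub).trans hPn
  refine WP.seq (WP.sto (by simp [ei4]; omega) (by simp) (by simp) (by simp) (by simp [ei4]; omega)
    (by simp [enq4]; omega) (by simp; omega) (WP.asg (by simp [enq4]; omega) ?_))
  simp only [Expr.eval, Expr.ofNat_def, Expr.add_def, Op.eval, ei4, ec4, enq4, Store.put_v]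
  have hcl4 : ∀ x, s4.a .claim i x 0 =
      if ∃ j < Y + 2, s.a .list i c j = x then c + 1 else s1.a .claim i x 0 := by
    intro x
    rw [ha4, hcl3, ha2', el, hlY]
  have hpl4 : s4.a .plist (i + 1) = s1.a .plist (i + 1) := by rw [ha4, ha3 _ _ (by simp), ha2']
  have hins := hs.insert (s2 := (s4.put .plist (i + 1) P'.card 0 c).set .nq (P'.card + 1)) hx hE.symm
    hc hlY (by rw [← hlY]; exact fun j hj => hfree j hj)
    (by intro x; simp [hcl4])
    (by intro a; simp [hpl4]) (by rw [← hlY, ← hsp]; simp [ho4, ho3, ho2'])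
  obtain ⟨hcP', hst⟩ := hins
  refine ⟨?_, ?_, ?_, ?_, ?_, _, _, hst, by simp [Finset.card_insert_of_notMem hcP']⟩
  · simp [hlY] at *; omega
  · refine SameV.set ?_ (by simp) _
    exact ((hv2'.trans hv3 (by simp)).trans hv4 (by simp))
  · refine SameA.set (SameA.put ?_ (by simp) _ _ _) _ _
    refine (hsa2.trans ha3 (by simp)).trans (SameA.of_eq [(.claim, i)] ha4) (by simp)
  · intro x hxc
    simp only [Store.set_a, Store.put_a, reduceCtorEq, false_and, if_false, hcl4]
    split_ifs
    · omega
    · exact hxc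
  · intro _
    refine ⟨0, by omega, ?_⟩
    simp [hcl4]
    rw [if_pos ⟨0, by omega, rfl⟩]; omega

end RAM

namespace RAM

/-- Form stars greedily. -/
def starsProg : Prog := asg .nq 0 ;; forTo .a (.var .np) starProg

theorem starsProg_spec {Γ : Ctx} {n m2 : ℕ} {Near : ℕ → ℕ → ℕ → Prop} (hE : EdgeMetric Γ n m2 Near)
    {s : Store} {P : Finset ℕ} {i Y D : ℕ} (hi : s.v .i = i)
    (hiZ : i + 1 < Γ.Z) (hnp : s.v .np = P.card) (hPn : P.card ≤ n) (hy : s.v .y = Y)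
    (hYn : Y ≤ n) (hP : s.Enum i P) (hx : s.Explored i n Near P (Y + 2) D)
    (hcl : ∀ x, s.a .claim i x 0 = 0)
    (hout : s.out.length + 2 * n + 2 ≤ Γ.Z ^ 3) :
    WP Γ starsProg s fun s2 t => t ≤ P.card * (339 * (Y + 2) + 213) + 20 ∧
      SameV [.c, .l, .f, .g, .x, .j, .nq, .a] s s2 ∧
      SameA [(.claim, i), (.plist, i + 1)] s s2 ∧
      (∀ c ∈ P, s.a .cnt i c 0 = Y + 2 → ∃ j < Y + 2, s2.a .claim i (s.a .list i c j) 0 ≠ 0) ∧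
      ∃ P' H, Starred s s2 i n Near P Y P' H ∧ s2.v .nq = P'.card := by
  have hnZ := hE.n_lt
  have hW := Γ.lin_le
  have hZ := Γ.hZ
  refine WP.seq (WP.asg (by simp) ?_)
  refine WP.forTo P.card (339 * (Y + 2) + 200) (fun k s1 =>
    SameV [.c, .l, .f, .g, .x, .j, .nq, .a] s s1 ∧ SameA [(.claim, i), (.plist, i + 1)] s s1 ∧
    (∀ a < k, s.a .cnt i (s.a .plist i a 0) 0 = Y + 2 → ∃ j < Y + 2,
      s1.a .claim i (s.a .list i (s.a .plist i a 0) j) 0 ≠ 0) ∧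
    ∃ P' H, Starred s s1 i n Near P Y P' H ∧ s1.v .nq = P'.card) ?_ (by omega) (by omega) ?_ ?_ ?_
  · refine ⟨((SameV.refl _ s).set (by simp) _).set (by simp) _, SameA.refl _ s, by simp, ∅, [], ?_,
      by simp⟩
    refine ⟨by simp, ⟨by simp, by simp, by simp⟩, by simp, ?_, ?_, by simp, by simp, by simp⟩
    · intro x h; exact absurd (hcl x) h
    · simp [hcl]
  · rintro k s1 - ⟨hv, -⟩ -
    simp [hv .np (by simp), hnp]
  · rintro k s1 hk ⟨hv, ha, hpop, P', H, hst, hq⟩ hk1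
    refine (starProg_spec hE (s := s) (P := P) (i := i) (Y := Y) (D := D) (k := k)
      (by rw [hv .i (by simp), hi]) hiZ hk1 hk hPn (by rw [hv .y (by simp), hy]) hYn hP hx ha hout
      hst hq).mono ?_
    rintro s2 t ⟨ht, hv2, ha2, hmono, hpop2, P'', H', hst2, hq2⟩
    refine ⟨ht, by rw [hv2 .a (by simp), hk1], (hv.trans hv2 (by simp)).set (by simp) _,
      ha2.set _ _, ?_, P'', H', hst2.congr rfl rfl, by simp [hq2]⟩
    intro a ha' hcnt
    rcases Nat.lt_succ_iff_lt_or_eq.1 ha' with hlt | rfl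
    · obtain ⟨j, hj, h⟩ := hpop a hlt hcnt
      exact ⟨j, hj, hmono _ h⟩
    · exact hpop2 hcnt
  · rintro s1 t ⟨hv, ha, hpop, P', H, hst, hq⟩ - ht
    refine ⟨?_, hv, ha, ?_, P', H, hst, hq⟩
    · simp at ht ⊢
      have : P.card * (339 * (Y + 2) + 200 + 2 + 11) = P.card * (339 * (Y + 2) + 213) := by ring
      omega
    · intro c hc h
      obtain ⟨a, haP, rfl⟩ := hP.surj c hc
      exact hpop a haP h

/-! ### The second pass of a phase: joining the unclaimed centers -/

/-- Connect the unclaimed center `c` to a star or to all centers it knows. -/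
def joinProg : Prog :=
  asg .c (.get .plist (.var .i) (.var .a) 0) ;; asg .l (.get .cnt (.var .i) (.var .c) 0) ;;
  cond (.get .claim (.var .i) (.var .c) 0) .skip
    (cond (.var .l - (.var .y + 1))
      (scanProg ;; emit (.var .f - 1) (.var .c)
        (.get .mark (.var .i) (.var .c) (.var .g) - 1 +
          (.get .mark (.var .i) (.var .f - 1) (.var .g) - 1)))
      spokesProg)

/-- How the second pass treats the center `c`. -/
def Joined (s s1 : Store) (i Y D : ℕ) (P' : Finset ℕ) (H : List (ℕ × ℕ × ℕ)) (c : ℕ) : Prop :=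
  s1.a .claim i c 0 ≠ 0 ∨ (∃ r ∈ P', ∃ w ≤ 2 * D, (r, c, w) ∈ H) ∨
    (s.a .cnt i c 0 ≠ Y + 2 ∧ ∀ e ∈ spokes s i c (s.a .cnt i c 0), e ∈ H)

theorem Joined.append {s s1 : Store} {i Y D : ℕ} {P' : Finset ℕ} {H : List (ℕ × ℕ × ℕ)} {c : ℕ}
    (h : Joined s s1 i Y D P' H c) (H' : List (ℕ × ℕ × ℕ)) : Joined s s1 i Y D P' (H ++ H') c := by
  rcases h with h | ⟨r, hr, w, hw, h⟩ | ⟨h, h'⟩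
  · exact .inl h
  · exact .inr (.inl ⟨r, hr, w, hw, List.mem_append_left _ h⟩)
  · exact .inr (.inr ⟨h, fun e he => List.mem_append_left _ (h' e he)⟩)

/-- An unclaimed popular center `c` reaches a star center `r` through a common claimed center `g`,
which gives weight at most `2 * D`. An unpopular one lists at most `Y + 1` centers including itself,
hence needs at most `Y` edges. Since `1 ≤ Y`, both cases cost at most `Y`; claimed centers cost
nothing. -/
theorem joinProg_spec {Γ : Ctx} {n m2 : ℕ} {Near : ℕ → ℕ → ℕ → Prop} (hE : EdgeMetric Γ n m2 Near)
    {s s1 s2 : Store} {P P' : Finset ℕ} {H : List (ℕ × ℕ × ℕ)} {i Y D k : ℕ} (hi : s2.v .i = i)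
    (hiZ : i + 1 < Γ.Z) (hk : s2.v .a = k) (hkP : k < P.card) (hPn : P.card ≤ n) (hy : s2.v .y = Y)
    (hY1 : 1 ≤ Y) (hYn : Y ≤ n) (hDn : D ≤ n) (hP : s.Enum i P) (hx : s.Explored i n Near P (Y + 2) D)
    (ha : SameA [(.claim, i), (.plist, i + 1)] s s1) (ha2 : s2.a = s1.a)
    (hpop : ∀ c ∈ P, s.a .cnt i c 0 = Y + 2 → ∃ j < Y + 2, s1.a .claim i (s.a .list i c j) 0 ≠ 0)
    (hst : Starred s s1 i n Near P Y P' H)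
    (hout : s2.out.length + n + 3 ≤ Γ.Z ^ 3) :
    WP Γ joinProg s2 fun s3 t => t ≤ 339 * (Y + 2) + 200 ∧ SameV [.c, .l, .f, .g, .x, .j] s2 s3 ∧
      s3.a = s1.a ∧ ∃ H', s3.out = s2.out ++ H' ∧
        (∀ e ∈ H', e.1 < n ∧ e.2.1 < n ∧ Near e.2.2 e.1 e.2.1) ∧
        H'.length ≤ (if s1.a .claim i (s.a .plist i k 0) 0 = 0 then Y else 0) ∧
        Joined s s1 i Y D P' H' (s.a .plist i k 0) := by
  have hnZ := hE.n_lt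
  have hW := Γ.lin_le
  have hZ := Γ.hZ
  have hc := hP.mem k hkP
  set c := s.a .plist i k 0 with hcdef
  have hcn := hx.sub c hc
  have ep : s2.a .plist i = s.a .plist i := by rw [ha2]; exact ha _ _ (by simp)
  have el : s2.a .list i = s.a .list i := by rw [ha2]; exact ha _ _ (by simp)
  have em : s2.a .mark i = s.a .mark i := by rw [ha2]; exact ha _ _ (by simp)
  have ec : s2.a .cnt i = s.a .cnt i := by rw [ha2]; exact ha _ _ (by simp)
  have hle := hx.cnt_le c hcn
  set l := s.a .cnt i c 0 with hl
  have hlst : ∀ j < l, s.a .list i c j < n := fun j hj => hx.sub _ (hx.lst_mk c hcn j hj).1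
  refine WP.seq (WP.asg (by simp [hi, hk]; omega) (WP.seq (WP.asg (by simp [hi, hk, ep, ← hcdef]; omega) ?_)))
  simp only [Expr.eval, Expr.ofNat_def, hi, hk, ep, ec, ← hcdef, Store.set_v, Store.set_a, reduceCtorEq,
    if_true, if_false, ← hl]
  set s2' := (s2.set .c c).set .l l with hs2'
  have hv1 : SameV [.c, .l, .f, .g, .x, .j] s2 s2' :=
    ((SameV.refl _ _).set (by simp) _).set (by simp) _
  have hs2a : s2'.a = s1.a := ha2
  have hs2o : s2'.out = s2.out := rfl
  have ei : s2'.v .i = i := by simp [hs2', hi]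
  have ecc : s2'.v .c = c := by simp [hs2']
  have ell : s2'.v .l = l := by simp [hs2']
  refine WP.cond (by simp [ei, ecc]; omega) (fun hclm => ?_) (fun hclm => ?_)
  · simp [ei, ecc, hs2a] at hclm
    exact WP.skip ⟨by simp, hv1, hs2a, [], by simp [hs2o], by simp, by simp, .inl hclm⟩
  simp [ei, ecc, hs2a] at hclm
  refine WP.cond (by simp [hs2', hy]; omega) (fun hbig => ?_) (fun hbig => ?_)
  · simp [hs2', hy] at hbig
    have hlY : l = Y + 2 := by omega
    refine WP.seq ((scanProg_spec (n := n) (i := i) (c := c) (l := l) hnZ ei (by omega) ecc hcn ell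
      (by omega) (by intro j hj; rw [hs2', Store.set_a, Store.set_a, el]; exact hlst j hj)).mono ?_)
    rintro s3 t3 ⟨ht3, hv3, ha3, ho3, hor⟩
    have ha3' : s3.a = s1.a := ha3.trans hs2a
    have hl1 : s1.a .list i = s.a .list i := by rw [← ha2]; exact el
    have hm1 : s1.a .mark i = s.a .mark i := by rw [← ha2]; exact em
    rw [hs2a, hl1] at hor
    have hor' : s3.v .f ≠ 0 ∧ ∃ j < l, s3.v .g = s.a .list i c j ∧
        s1.a .claim i (s.a .list i c j) 0 = s3.v .f := by
      -- The scan cannot fail: by maximality of the stars, a popular center lists a claimed one.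
      refine hor.resolve_left fun ⟨_, h⟩ => ?_
      obtain ⟨j, hj, hne⟩ := hpop c hc hlY
      exact hne (h j (by omega))
    obtain ⟨hf0, j, hj, hg, hclf⟩ := hor'
    set g := s.a .list i c j with hgdef
    obtain ⟨hgP, hmg⟩ := hx.lst_mk c hcn j hj
    change g ∈ P at hgP
    change s.a .mark i c g ≠ 0 at hmg
    have hgn := hx.sub g hgP
    obtain ⟨-, r, hr, hrf, hmr, -⟩ := hst.claim g (by rw [hclf]; exact hf0)
    have hrn := hx.sub r (hst.sub hr)
    have hfr : s3.v .f = r + 1 := by rw [← hclf, hrf]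
    obtain ⟨-, hd1, hN1, -⟩ := hx.mk_lst c hcn g hgn hmg
    obtain ⟨-, hd2, hN2, -⟩ := hx.mk_lst r hrn g hgn hmr
    have ei3 : s3.v .i = i := by rw [hv3 .i (by simp), ei]
    have ec3 : s3.v .c = c := by rw [hv3 .c (by simp), ecc]
    refine WP.emit (by simp [hfr]; omega) (by simp)
      (by simp [ei3, ec3, hg, hfr, ha3', hm1]; omega) (by rw [ho3, hs2o]; omega) ?_
    simp only [Expr.eval, Expr.ofNat_def, Expr.add_def, Expr.sub_def, Op.eval, ei3, ec3, hg, hfr, ha3',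
      hm1, Nat.add_sub_cancel]
    refine ⟨by simp; omega, hv1.trans hv3 (by simp), ha3',
      [(r, c, s.a .mark i c g - 1 + (s.a .mark i r g - 1))], by simp [ho3, hs2o], ?_, ?_, ?_⟩
    · simp only [List.mem_singleton]
      rintro e rfl
      refine ⟨hrn, hcn, ?_⟩
      rw [Nat.add_comm]
      exact hE.trans _ _ _ _ _ (hE.symm _ _ _ hN2) hN1
    · simp [hclm, hY1]
    · exact .inr (.inl ⟨r, hr, s.a .mark i c g - 1 + (s.a .mark i r g - 1), by omega,
        by simp⟩)
  · simp [hs2', hy] at hbig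
    have hl2 : ∀ j < l, s2'.a .list i c j < n := by
      intro j hj; rw [hs2', Store.set_a, Store.set_a, el]; exact hlst j hj
    refine (spokesProg_spec (n := n) hnZ ei (by omega) ecc hcn ell (by omega) hl2
      (by rw [hs2o]; omega)).mono ?_
    rintro s3 t3 ⟨ht3, hv3, ha3, ho3⟩
    have hsp : spokes s2' i c l = spokes s i c l := by
      simp only [spokes, hs2', Store.set_a, el, em]
    refine ⟨by simp; omega, hv1.trans hv3 (by simp), ha3.trans hs2a, spokes s i c l,
      by rw [ho3, hs2o, hsp], hx.spokes_sound hE.symm hcn, ?_, ?_⟩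
    · rw [if_pos hclm, Store.Explored.spokes_length]; omega
    · exact .inr (.inr ⟨by omega, fun e he => he⟩)

/-- Connect all unclaimed centers. -/
def joinsProg : Prog := forTo .a (.var .np) joinProg

theorem Store.Enum.sum_eq {s : Store} {i : ℕ} {P : Finset ℕ} (h : s.Enum i P) (F : ℕ → ℕ) :
    ∑ a ∈ Finset.range P.card, F (s.a .plist i a 0) = ∑ c ∈ P, F c := by
  refine Finset.sum_bij (fun a _ => s.a .plist i a 0) ?_ ?_ ?_ ?_
  · intro a ha; exact h.mem a (by simpa using ha)
  · intro a ha b hb hab; exact h.inj a (by simpa using ha) b (by simpa using hb) hab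
  · intro c hc
    obtain ⟨a, ha, rfl⟩ := h.surj c hc
    exact ⟨a, by simpa using ha, rfl⟩
  · intro a _; rfl

theorem joinsProg_spec {Γ : Ctx} {n m2 : ℕ} {Near : ℕ → ℕ → ℕ → Prop} (hE : EdgeMetric Γ n m2 Near)
    {s s1 : Store} {P P' : Finset ℕ} {H : List (ℕ × ℕ × ℕ)} {i Y D : ℕ} (hi : s1.v .i = i)
    (hiZ : i + 1 < Γ.Z) (hnp : s1.v .np = P.card) (hPn : P.card ≤ n) (hy : s1.v .y = Y)
    (hY1 : 1 ≤ Y) (hYn : Y ≤ n) (hDn : D ≤ n) (hP : s.Enum i P) (hx : s.Explored i n Near P (Y + 2) D)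
    (ha : SameA [(.claim, i), (.plist, i + 1)] s s1)
    (hpop : ∀ c ∈ P, s.a .cnt i c 0 = Y + 2 → ∃ j < Y + 2, s1.a .claim i (s.a .list i c j) 0 ≠ 0)
    (hst : Starred s s1 i n Near P Y P' H)
    (hout : s1.out.length + n * n + n + 3 ≤ Γ.Z ^ 3) :
    WP Γ joinsProg s1 fun s3 t => t ≤ P.card * (339 * (Y + 2) + 213) + 20 ∧
      SameV [.c, .l, .f, .g, .x, .j, .a] s1 s3 ∧
      s3.a = s1.a ∧ ∃ H', s3.out = s1.out ++ H' ∧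
        (∀ e ∈ H', e.1 < n ∧ e.2.1 < n ∧ Near e.2.2 e.1 e.2.1) ∧
        H'.length ≤ (P.filter fun c => s1.a .claim i c 0 = 0).card * Y ∧
        ∀ c ∈ P, Joined s s1 i Y D P' H' c := by
  have hnZ := hE.n_lt
  have hW := Γ.lin_le
  have hZ := Γ.hZ
  refine WP.forTo P.card (339 * (Y + 2) + 200) (fun k s2 =>
    SameV [.c, .l, .f, .g, .x, .j, .a] s1 s2 ∧ s2.a = s1.a ∧ ∃ H', s2.out = s1.out ++ H' ∧
        (∀ e ∈ H', e.1 < n ∧ e.2.1 < n ∧ Near e.2.2 e.1 e.2.1) ∧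
        H'.length ≤ (∑ a ∈ Finset.range k, if s1.a .claim i (s.a .plist i a 0) 0 = 0 then Y else 0) ∧
        ∀ a < k, Joined s s1 i Y D P' H' (s.a .plist i a 0)) ?_ (by omega) (by omega) ?_ ?_ ?_
  · exact ⟨(SameV.refl _ s1).set (by simp) _, rfl, [], by simp, by simp, by simp, by simp⟩
  · rintro k s2 - ⟨hv, -⟩ -
    simp [hv .np (by simp), hnp]
  · rintro k s2 hk ⟨hv, ha2, H', ho, hsound, hlen, hj⟩ hk1
    have hlen' : H'.length ≤ n * n := by
      refine hlen.trans ((Finset.sum_le_card_nsmul _ _ n fun a _ => ?_).trans ?_)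
      · split_ifs <;> omega
      · simp only [Finset.card_range, smul_eq_mul]
        exact Nat.mul_le_mul_right _ (by omega)
    refine (joinProg_spec hE (by rw [hv .i (by simp), hi]) hiZ hk1 hk hPn (by rw [hv .y (by simp), hy])
      hY1 hYn hDn hP hx ha ha2 hpop hst (by rw [ho, List.length_append]; omega)).mono ?_
    rintro s3 t ⟨ht, hv3, ha3, H'', ho3, hsound3, hlen3, hj3⟩
    refine ⟨ht, by rw [hv3 .a (by simp), hk1], (hv.trans hv3 (by simp)).set (by simp) _, ha3,
      H' ++ H'', by simp [ho3, ho], ?_, ?_, ?_⟩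
    · intro e he
      rcases List.mem_append.1 he with he | he
      · exact hsound e he
      · exact hsound3 e he
    · rw [Finset.sum_range_succ, List.length_append]; omega
    · intro a ha'
      rcases Nat.lt_succ_iff_lt_or_eq.1 ha' with hlt | rfl
      · exact (hj a hlt).append _
      · rcases hj3 with h | ⟨r, hr, w, hw, h⟩ | ⟨h, h'⟩
        · exact .inl h
        · exact .inr (.inl ⟨r, hr, w, hw, List.mem_append_right _ h⟩)
        · exact .inr (.inr ⟨h, fun e he => List.mem_append_right _ (h' e he)⟩)
  · rintro s2 t ⟨hv, ha2, H', ho, hsound, hlen, hj⟩ - ht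
    refine ⟨?_, hv, ha2, H', ho, hsound, ?_, ?_⟩
    · simp at ht ⊢
      have : P.card * (339 * (Y + 2) + 200 + 2 + 11) = P.card * (339 * (Y + 2) + 213) := by ring
      linarith
    · rw [hP.sum_eq fun c => if s1.a .claim i c 0 = 0 then Y else 0] at hlen
      rwa [← Finset.sum_filter, Finset.sum_const, smul_eq_mul] at hlen
    · intro c hc
      obtain ⟨a, haP, rfl⟩ := hP.surj c hc
      exact hj a haP

end RAM

/-- One phase of the construction turns the centers `P` into `P'`, with the new edges `H`: `δ` is the
distance threshold and `Y` the degree threshold. -/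
structure PhaseSpec (n : ℕ) (Near : ℕ → ℕ → ℕ → Prop) (δ Y : ℕ) (P P' : Finset ℕ)
    (H : List (ℕ × ℕ × ℕ)) : Prop where
  sound : ∀ e ∈ H, e.1 < n ∧ e.2.1 < n ∧ Near e.2.2 e.1 e.2.1
  cover : ∀ c ∈ P, (∃ r ∈ P', r = c ∨ ∃ w ≤ 2 * δ, (r, c, w) ∈ H) ∨
    ∀ x ∈ P, ∀ k ≤ δ, Near k x c → c = x ∨ ∃ w ≤ k, (c, x, w) ∈ H
  sub : P' ⊆ P
  card : (Y + 2) * P'.card ≤ P.card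
  len : H.length + (Y + 2) * P'.card * Y ≤ (Y + 1) * P'.card + P.card * Y

namespace RAM

/-- Claimed centers are covered by a star edge and popular ones by a join edge. An unpopular center
has a list that is not full, so completeness of the exploration puts every nearby center into it
with a mark giving at most the true distance. -/
theorem phaseSpec_of_joined {n : ℕ} {Near : ℕ → ℕ → ℕ → Prop} {s s1 : Store} {P P' : Finset ℕ}
    {H H' : List (ℕ × ℕ × ℕ)} {i Y D : ℕ} (hx : s.Explored i n Near P (Y + 2) D)
    (hc : Complete n Near P (Y + 2) D (fun v => s.a .cnt i v 0) (s.a .mark i))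
    (hst : Starred s s1 i n Near P Y P' H)
    (hsound : ∀ e ∈ H', e.1 < n ∧ e.2.1 < n ∧ Near e.2.2 e.1 e.2.1)
    (hlen : H'.length ≤ (P.filter fun c => s1.a .claim i c 0 = 0).card * Y)
    (hj : ∀ c ∈ P, Joined s s1 i Y D P' H' c) : PhaseSpec n Near D Y P P' (H ++ H') := by
  refine ⟨?_, ?_, hst.sub, hst.card_le, ?_⟩
  · intro e he
    rcases List.mem_append.1 he with he | he
    · exact hst.sound e he
    · exact hsound e he
  · intro c hcP
    have hcn := hx.sub c hcP
    rcases hj c hcP with h | ⟨r, hr, w, hw, h⟩ | ⟨h, h'⟩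
    · left
      obtain ⟨-, r, hr, -, hm, hor⟩ := hst.claim c h
      have := (hx.mk_lst r (hx.sub r (hst.sub hr)) c hcn hm).2.1
      refine ⟨r, hr, hor.imp_right fun h => ⟨_, ?_, List.mem_append_left _ h⟩⟩
      omega
    · exact .inl ⟨r, hr, .inr ⟨w, hw, List.mem_append_right _ h⟩⟩
    · right
      intro x hxP k hk hN
      obtain ⟨hm, hle⟩ := (hc c hcn).resolve_left h x hxP k hk hN
      refine (hx.mem_spokes hcP (hx.sub x hxP) hm).imp_right fun he => ?_
      exact ⟨_, by omega, List.mem_append_right _ (h' _ he)⟩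
  -- The claimed centers number exactly `(Y + 2) * P'.card`; only the others pay `Y` edges.
  · have hsplit := Finset.card_filter_add_card_filter_not (s := P) (fun c => s1.a .claim i c 0 = 0)
    have hcount := hst.count
    simp only [ne_eq] at hcount
    rw [hcount] at hsplit
    rw [List.length_append, hst.len, ← hsplit]
    nlinarith [hlen]

end RAM

/-! ### The program of a phase and its running time -/

/-- The root exponent of the next phase. -/
def nextExp (R p : ℕ) : ℕ := R + ((p + 1) / 2 - R)

/-- The root exponents of the phases. -/
def expSeq (R K : ℕ) : ℕ → ℕ
  | 0 => K
  | i + 1 => nextExp R (expSeq R K i)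

namespace RAM

/-- One phase. -/
def phaseProg : Prog :=
  rootProg ;; initProg ;; exploreProg ;; starsProg ;; joinsProg ;; asg .np (.var .nq) ;;
  asg .p (.var .rad + ((.var .p + 1) / 2 - .var .rad)) ;;
  asg .dl (.var .dl * .var .base - (.var .dl * .var .base - .var .n))

/-- The state before phase `i`, except for the counter of the phases. -/
structure PhaseState (s : Store) (i n m2 : ℕ) (P : Finset ℕ) (p D B R : ℕ) : Prop where
  v_n : s.v .n = n
  v_m2 : s.v .m2 = m2
  v_np : s.v .np = P.card
  v_p : s.v .p = p
  v_dl : s.v .dl = D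
  v_base : s.v .base = B
  v_rad : s.v .rad = R
  enum : s.Enum i P
  lt : ∀ c ∈ P, c < n
  card_le : P.card ≤ m2
  cnt : ∀ i' ≥ i, ∀ j k, s.a .cnt i' j k = 0
  mark : ∀ i' ≥ i, ∀ j k, s.a .mark i' j k = 0
  claim : ∀ i' ≥ i, ∀ j k, s.a .claim i' j k = 0

theorem PhaseState.set_i {s : Store} {i n m2 : ℕ} {P : Finset ℕ} {p D B R : ℕ}
    (h : PhaseState s i n m2 P p D B R) (b : ℕ) : PhaseState (s.set .i b) i n m2 P p D B R :=
  ⟨by simp [h.v_n], by simp [h.v_m2], by simp [h.v_np], by simp [h.v_p], by simp [h.v_dl],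
    by simp [h.v_base], by simp [h.v_rad], h.enum.congr rfl, h.lt, h.card_le, h.cnt, h.mark, h.claim⟩

/-- The exploration dominates; the factor `p` is needed only for the root computation and is simply
multiplied in. The long sum is the cost of the final three assignments. -/
theorem phase_time {p D m2 Y c t1 t2 t3 t4 t5 : ℕ} (hp : 1 ≤ p) (hD : 1 ≤ D) (hY1 : 1 ≤ Y)
    (hc : c ≤ m2) (ht1 : t1 ≤ 110 * (p * Y)) (ht2 : t2 ≤ 113 * c + 9)
    (ht3 : t3 ≤ D * (m2 * (213 * (Y + 2) + 73) + 22) + 9)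
    (ht4 : t4 ≤ c * (339 * (Y + 2) + 213) + 20) (ht5 : t5 ≤ c * (339 * (Y + 2) + 213) + 20) :
    t1 + (t2 + (t3 + (t4 + (t5 + (2 + 2 + (2 + (2 + 1 + 1 + 1 + 1 + 2 + 1) + 1 + 2 +
      (2 + 2 + 1 + (2 + 2 + 1 + 2 + 1) + 1 + 2))))))) ≤ 4000 * (p * (D * (m2 + 1) * Y)) := by
  have hX1 : 1 ≤ D * (m2 + 1) * Y := Nat.mul_pos (Nat.mul_pos hD (by omega)) hY1
  have b1 : p * Y ≤ p * (D * (m2 + 1) * Y) :=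
    Nat.mul_le_mul_left _ (Nat.le_mul_of_pos_left _ (Nat.mul_pos hD (by omega)))
  have b2 : D * (m2 + 1) * Y ≤ p * (D * (m2 + 1) * Y) := Nat.le_mul_of_pos_left _ hp
  have b3 : D * (m2 * (213 * (Y + 2) + 73) + 22) ≤ 734 * (D * (m2 + 1) * Y) := by
    have : m2 * (213 * (Y + 2) + 73) + 22 ≤ 734 * ((m2 + 1) * Y) := by
      have := Nat.mul_le_mul_left m2 hY1
      nlinarith
    calc _ ≤ D * (734 * ((m2 + 1) * Y)) := Nat.mul_le_mul_left _ this
      _ = _ := by ring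
  have b4 : c * (339 * (Y + 2) + 213) ≤ 1230 * (D * (m2 + 1) * Y) := by
    have h1 : c * (339 * (Y + 2) + 213) ≤ (m2 + 1) * (1230 * Y) :=
      Nat.mul_le_mul (by omega) (by omega)
    have h2 : (m2 + 1) * (1230 * Y) ≤ D * ((m2 + 1) * (1230 * Y)) := Nat.le_mul_of_pos_left _ hD
    calc _ ≤ _ := h1.trans h2
      _ = _ := by ring
  have b5 : c ≤ D * (m2 + 1) * Y := by
    have h1 : m2 + 1 ≤ D * (m2 + 1) := Nat.le_mul_of_pos_left _ hD
    have h2 : D * (m2 + 1) ≤ D * (m2 + 1) * Y := Nat.le_mul_of_pos_right _ hY1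
    omega
  linarith

-- Phase `i` writes only slice `i` of the exploration and claim arrays and slice `i + 1` of `plist`.
-- Later slices of the exploration and claim arrays stay zero, so the next phase starts fresh at no
-- cost.
set_option maxHeartbeats 800000 in
theorem phaseProg_spec {Γ : Ctx} {n m2 : ℕ} {Near : ℕ → ℕ → ℕ → Prop} (hE : EdgeMetric Γ n m2 Near)
    {s : Store} {P : Finset ℕ} {i p D B R : ℕ} (hs : PhaseState s i n m2 P p D B R) (hi : s.v .i = i)
    (hiZ : i + 1 < Γ.Z) (hn : 1 ≤ n) (hp : 1 ≤ p) (hpZ : p < Γ.Z) (hR : R < Γ.Z) (hD : 1 ≤ D)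
    (hDn : D ≤ n) (hB : B ≤ 112 * Γ.Z ^ 2)
    (hout : s.out.length + n * n + 2 * n + 3 ≤ Γ.Z ^ 3) :
    WP Γ phaseProg s fun s' t => s'.v .i = i ∧ s'.v .ph = s.v .ph ∧ ∃ P' H Y, 1 ≤ Y ∧ Y ^ p ≤ n ∧
      n < (Y + 1) ^ p ∧ t ≤ 4000 * (p * (D * (m2 + 1) * Y)) ∧ s'.out = s.out ++ H ∧
      PhaseSpec n Near D Y P P' H ∧
      PhaseState s' (i + 1) n m2 P' (nextExp R p) (min (D * B) n) B R := by
  have hnZ := hE.n_lt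
  have hW := Γ.lin_le
  have hW4 := Γ.pow_four_le
  have hZ := Γ.hZ
  have hPn : P.card ≤ n := by
    have : P ⊆ Finset.range n := fun c hc => by simpa using hs.lt c hc
    simpa using Finset.card_le_card this
  refine WP.seq ((rootProg_spec (by rw [hs.v_n]; exact hnZ) (by rw [hs.v_n]; exact hn)
    (by rw [hs.v_p]; exact hpZ) (by rw [hs.v_p]; exact hp)).mono ?_)
  rintro s1 t1 ⟨hv1, ha1, ho1, hY1, hYp, hYp', ht1⟩
  rw [hs.v_n, hs.v_p] at *
  set Y := s1.v .y with hY
  have hYn : Y ≤ n := (Nat.le_self_pow (by omega) Y).trans hYp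
  refine WP.seq ((initProg_spec (i := i) (Q := Y + 2) hE (by rw [hv1 .i (by simp), hi]) (by omega)
    (by rw [hv1 .np (by simp), hs.v_np]) (hs.enum.congr (by rw [ha1])) hs.lt hPn (by omega)
    (by intro v; rw [ha1]; exact hs.cnt i le_rfl v 0)
    (by intro v c; rw [ha1]; exact hs.mark i le_rfl v c)).mono ?_)
  rintro s2 t2 ⟨ht2, hv2, ha2, ho2, hx2, hc2⟩
  have hv02 : SameV [.y, .pw, .k, .a, .c] s s2 :=
    (hv1.mono (by simp)).trans hv2 (by simp)
  have hy2 : s2.v .y = Y := by rw [hv2 .y (by simp)]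
  refine WP.seq ((exploreProg_spec (i := i) (Y := Y) (D := D) hE (by rw [hv02 .i (by simp), hi])
    (by omega) (by rw [hv02 .m2 (by simp), hs.v_m2]) (by rw [hv02 .dl (by simp), hs.v_dl]) hDn hy2
    hYn hx2 hc2).mono ?_)
  rintro s3 t3 ⟨ht3, hv3, hg3, hx3, hc3⟩
  have hv03 : SameV [.y, .pw, .k, .a, .c, .t, .e, .d, .u, .v, .l, .j] s s3 :=
    (hv02.mono (by simp)).trans hv3 (by simp)
  have ha03 : SameA [(.list, i), (.cnt, i), (.mark, i)] s s3 := by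
    refine ((SameA.of_eq _ ha1).trans ha2 (by simp)).trans (Y := [(.list, i), (.cnt, i), (.mark, i)])
      ?_ (by simp)
    intro A i' hA
    refine hg3.frame A i' ?_
    simp only [List.mem_cons, Prod.mk.injEq, List.not_mem_nil, or_false, not_or, not_and] at hA
    by_cases hii : i' = i
    · left
      exact ⟨fun h => hA.2.2 h hii, fun h => hA.1 h hii, fun h => hA.2.1 h hii⟩
    · exact .inr hii
  have hen3 : s3.Enum i P := hs.enum.congr (ha03 _ _ (by simp))
  have hnp3 : s3.v .np = P.card := by rw [hv03 .np (by simp), hs.v_np]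
  have ho3 : s3.out = s.out := by rw [hg3.out, ho2, ho1]
  have hi3 : s3.v .i = i := by rw [hv03 .i (by simp), hi]
  have hy3 : s3.v .y = Y := by rw [hv3 .y (by simp), hy2]
  refine WP.seq ((starsProg_spec (i := i) (Y := Y) (D := D) hE hi3 hiZ hnp3 hPn hy3 hYn hen3 hx3
    (by intro x; rw [ha03 _ _ (by simp)]; exact hs.claim i le_rfl x 0)
    (by rw [ho3]; linarith [Nat.zero_le (n * n)])).mono ?_)
  rintro s4 t4 ⟨ht4, hv4, ha4, hpop4, P', H1, hst4, hq4⟩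
  have hH1 : H1.length ≤ n := by
    have h1 := hst4.card_le
    have h2 : (Y + 1) * P'.card ≤ (Y + 2) * P'.card := Nat.mul_le_mul_right _ (by omega)
    rw [hst4.len]; omega
  refine WP.seq ((joinsProg_spec (i := i) (Y := Y) (D := D) hE (by rw [hv4 .i (by simp), hi3]) hiZ
    (by rw [hv4 .np (by simp), hnp3]) hPn (by rw [hv4 .y (by simp), hy3]) hY1 hYn hDn hen3 hx3 ha4
    hpop4 hst4 (by rw [hst4.out, ho3, List.length_append]; linarith)).mono ?_)
  rintro s5 t5 ⟨ht5, hv5, ha5, H2, ho5, hsound5, hlen5, hj5⟩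
  have hspec := phaseSpec_of_joined hx3 hc3 hst4 hsound5 hlen5 hj5
  have hv05 : SameV [.y, .pw, .k, .a, .c, .t, .e, .d, .u, .v, .l, .j, .f, .g, .x, .nq] s s5 :=
    ((hv03.mono (by simp)).trans hv4 (by simp)).trans hv5 (by simp)
  have ha05 : SameA [(.list, i), (.cnt, i), (.mark, i), (.claim, i), (.plist, i + 1)] s s5 :=
    ((ha03.mono (by simp)).trans ha4 (by simp)).trans (SameA.of_eq [] ha5) (by simp)
  have eq5 : s5.v .nq = P'.card := by rw [hv5 .nq (by simp), hq4]
  have ep5 : s5.v .p = p := by rw [hv05 .p (by simp), hs.v_p]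
  have er5 : s5.v .rad = R := by rw [hv05 .rad (by simp), hs.v_rad]
  have ed5 : s5.v .dl = D := by rw [hv05 .dl (by simp), hs.v_dl]
  have eb5 : s5.v .base = B := by rw [hv05 .base (by simp), hs.v_base]
  have en5 : s5.v .n = n := by rw [hv05 .n (by simp), hs.v_n]
  -- The threshold is capped at `n` so that this product fits into a word; the truncated
  -- subtractions in `phaseProg` compute the minimum with `n` and the maximum with `R`.
  have hDB : D * B ≤ Γ.W := by
    have h1 : D * B ≤ Γ.Z * (112 * Γ.Z ^ 2) := Nat.mul_le_mul (by omega) hB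
    have h2 : Γ.Z * (112 * Γ.Z ^ 2) = 112 * Γ.Z ^ 3 := by ring
    linarith [Γ.cube_le]
  refine WP.seq (WP.asg (by simp) (WP.seq (WP.asg (by simp [ep5, er5]; omega)
    (WP.asg (by simp [ed5, eb5, en5]; omega) ?_))))
  simp only [Expr.eval, Expr.ofNat_def, Expr.add_def, Expr.sub_def, Expr.mul_def, Expr.div_def, Op.eval,
    Store.set_v, reduceCtorEq, if_false, eq5, ep5, er5, ed5, eb5, en5]
  refine ⟨by simp [hv05 .i (by simp), hi], by simp [hv05 .ph (by simp)], P', H1 ++ H2, Y, hY1, hYp,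
    hYp', ?_, ?_, hspec, ?_⟩
  · simp only [Expr.cost]
    exact phase_time hp hD hY1 hs.card_le ht1 ht2 ht3 ht4 ht5
  · simp [ho5, hst4.out, ho3]
  · refine ⟨by simp [en5], by simp [hv05 .m2 (by simp), hs.v_m2], by simp, by simp [nextExp],
      by simp; omega, by simp [eb5], by simp [er5], ?_, ?_, ?_, ?_, ?_, ?_⟩
    · exact hst4.enum.congr (by simp [ha5])
    · exact fun c hc => hs.lt c (hst4.sub hc)
    · exact (Finset.card_le_card hst4.sub).trans hs.card_le
    · intro i' hi' j k
      simp only [Store.set_a]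
      rw [ha05 _ _ (by simp; omega)]; exact hs.cnt i' (by omega) j k
    · intro i' hi' j k
      simp only [Store.set_a]
      rw [ha05 _ _ (by simp; omega)]; exact hs.mark i' (by omega) j k
    · intro i' hi' j k
      simp only [Store.set_a]
      rw [ha05 _ _ (by simp; omega)]; exact hs.claim i' (by omega) j k

end RAM

/-! ### The exponents and the sequence of phases -/

theorem le_expSeq {R K : ℕ} (h : R ≤ K) (i : ℕ) : R ≤ expSeq R K i := by
  cases i with
  | zero => exact h
  | succ i => exact Nat.le_add_right _ _

theorem expSeq_le {R K : ℕ} (hR : 1 ≤ R) (h : R ≤ K) (i : ℕ) : expSeq R K i ≤ K := by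
  induction i with
  | zero => exact le_rfl
  | succ i ih =>
    have := le_expSeq h i
    simp only [expSeq, nextExp]; omega

/-- The phases `0, …, L - 1` of the construction. -/
structure Phases (n : ℕ) (Near : ℕ → ℕ → ℕ → Prop) (R K B L : ℕ) (P : ℕ → Finset ℕ)
    (H : ℕ → List (ℕ × ℕ × ℕ)) (Y : ℕ → ℕ) : Prop where
  spec : ∀ i < L, PhaseSpec n Near (min (B ^ i) n) (Y i) (P i) (P (i + 1)) (H i)
  one_le : ∀ i < L, 1 ≤ Y i
  pow_le : ∀ i < L, Y i ^ expSeq R K i ≤ n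
  lt_pow : ∀ i < L, n < (Y i + 1) ^ expSeq R K i

/-- A crude bound, needed only to see that the output fits into its memory region. -/
theorem PhaseSpec.length_le {n : ℕ} {Near : ℕ → ℕ → ℕ → Prop} {δ Y : ℕ} {P P' : Finset ℕ}
    {H : List (ℕ × ℕ × ℕ)} (h : PhaseSpec n Near δ Y P P' H) (hY : 1 ≤ Y) :
    H.length ≤ P.card * Y := by
  have h1 := h.len
  have h2 : (Y + 1) * P'.card ≤ (Y + 2) * P'.card * Y := by
    calc (Y + 1) * P'.card ≤ (Y + 2) * P'.card := Nat.mul_le_mul_right _ (by omega)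
      _ ≤ _ := Nat.le_mul_of_pos_right _ hY
  omega

theorem min_pow_succ {B n k : ℕ} (hB : 1 ≤ B) : min (min (B ^ k) n * B) n = min (B ^ (k + 1)) n := by
  rcases le_total (B ^ k) n with h | h
  · rw [min_eq_left h, pow_succ]
  · have h1 : n ≤ n * B := Nat.le_mul_of_pos_right _ hB
    have h2 : B ^ k ≤ B ^ (k + 1) := Nat.pow_le_pow_right hB (by omega)
    rw [min_eq_right h, min_eq_right h1, min_eq_right (h.trans h2)]

namespace RAM

/-- Count the phases. -/
def countProg : Prog :=
  asg .p (.var .kap) ;; asg .ph (.var .rad) ;;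
  loop (.var .p - .var .rad)
    (asg .p (.var .rad + ((.var .p + 1) / 2 - .var .rad)) ;; asg .ph (.var .ph + 1))

/-- Above `R ≥ 3` the exponent drops by at least one in each round, so exponent plus number of
rounds never exceeds `K`. The total number of phases is needed beforehand because `B` depends on it.
-/
theorem countProg_spec {Γ : Ctx} {s : Store} {R K : ℕ} (hr : s.v .rad = R) (hk : s.v .kap = K)
    (hR : 3 ≤ R) (hRK : R ≤ K) (hKR : K + R < Γ.Z) :
    WP Γ countProg s fun s' t => t ≤ 40 * K ∧ SameV [.p, .ph] s s' ∧ s'.a = s.a ∧ s'.out = s.out ∧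
      ∃ l, s'.v .ph = R + l ∧ l ≤ K ∧ expSeq R K l = R ∧ ∀ j < l, R < expSeq R K j := by
  have hW := Γ.lin_le
  refine WP.seq (WP.asg (by simp) (WP.seq (WP.asg (by simp) ?_)))
  refine WP.loop K 20 (fun k s1 => SameV [.p, .ph] s s1 ∧ s1.a = s.a ∧ s1.out = s.out ∧
    s1.v .p = expSeq R K k ∧ s1.v .ph = R + k ∧ expSeq R K k + k ≤ K ∧ ∀ j < k, R < expSeq R K j)
    ?_ ?_ ?_ ?_ ?_
  · refine ⟨((SameV.refl _ s).set (by simp) _).set (by simp) _, rfl, rfl, ?_, ?_, ?_, ?_⟩ <;>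
      simp [expSeq, hr, hk]
  · rintro k s1 - -; simp
  · rintro s1 ⟨-, -, -, -, -, hle, -⟩
    have := le_expSeq hRK K
    omega
  · rintro k s1 hkK ⟨hv, ha, ho, hp, hph, hle, hall⟩ hc
    have er := hv .rad (by simp)
    simp [er, hr, hp] at hc
    refine WP.seq (WP.asg (by simp [er, hr, hp]; omega) (WP.asg (by simp [hph]; omega) ?_))
    refine ⟨by simp, (hv.set (by simp) _).set (by simp) _, ha, ho, by simp [er, hr, hp, expSeq, nextExp],
      by simp [hph]; omega, by simp only [expSeq, nextExp]; omega, ?_⟩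
    intro j hj
    rcases Nat.lt_succ_iff_lt_or_eq.1 hj with hlt | rfl
    · exact hall j hlt
    · omega
  · rintro k s1 t hkK ⟨hv, ha, ho, hp, hph, hle, hall⟩ hc ht
    have er := hv .rad (by simp)
    simp [er, hr, hp] at hc
    have := le_expSeq hRK k
    refine ⟨by simp at ht ⊢; omega, hv, ha, ho, k, hph, hkK, by omega, hall⟩

/-- List the vertices that are not isolated. -/
def listProg : Prog :=
  asg .np 0 ;; forTo .e (.var .m2) (asg .u (.inp (5 + .var .e)) ;;
    cond (.get .seen 0 (.var .u) 0) .skip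
      (sto .seen 0 (.var .u) 0 1 ;; sto .plist 0 (.var .np) 0 (.var .u) ;;
        asg .np (.var .np + 1)))

/-- Only endpoints of edges become initial centers. Isolated vertices need no treatment, and the
work stays proportional to the number of edges, without an extra term `n`. -/
theorem listProg_spec {Γ : Ctx} {n m2 : ℕ} {Near : ℕ → ℕ → ℕ → Prop} (hE : EdgeMetric Γ n m2 Near)
    {s : Store} (hm : s.v .m2 = m2) (hseen : ∀ u, s.a .seen 0 u 0 = 0) :
    WP Γ listProg s fun s' t => t ≤ 113 * m2 + 20 ∧ SameV [.np, .e, .u] s s' ∧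
      SameA [(.seen, 0), (.plist, 0)] s s' ∧ s'.out = s.out ∧
      s'.v .np = ((Finset.range m2).image Γ.src).card ∧ s'.Enum 0 ((Finset.range m2).image Γ.src) := by
  have hnZ := hE.n_lt
  have hW := Γ.lin_le
  have hcub := Γ.cube_le
  have hlen := Γ.hlen
  have hml := hE.len_le
  have hZ := Γ.hZ
  refine WP.seq (WP.asg (by simp) ?_)
  refine WP.forTo m2 100 (fun k s1 => SameV [.np, .e, .u] s s1 ∧ SameA [(.seen, 0), (.plist, 0)] s s1 ∧
    s1.out = s.out ∧ s1.v .np = ((Finset.range k).image Γ.src).card ∧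
    s1.Enum 0 ((Finset.range k).image Γ.src) ∧
    ∀ u, s1.a .seen 0 u 0 = if u ∈ (Finset.range k).image Γ.src then 1 else 0)
    ?_ (by omega) (by omega) ?_ ?_ ?_
  · refine ⟨((SameV.refl _ s).set (by simp) _).set (by simp) _, SameA.refl _ s, rfl, by simp,
      ⟨by simp, by simp, by simp⟩, by simp [hseen]⟩
  · rintro k s1 - ⟨hv, -⟩ -
    simp [hv .m2 (by simp), hm]
  · rintro k s1 hk ⟨hv, ha, ho, hnp, hen, hsn⟩ hk1
    have hun := hE.src_lt k hk
    have himg : (Finset.range (k + 1)).image Γ.src =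
        Insert.insert (Γ.src k) ((Finset.range k).image Γ.src) := by
      rw [Finset.range_add_one, Finset.image_insert]
    set I := (Finset.range k).image Γ.src with hI
    have hIn : I.card ≤ n := by
      refine (Finset.card_le_card (t := Finset.range n) ?_).trans (by simp)
      intro x hx
      obtain ⟨e, he, rfl⟩ := Finset.mem_image.1 hx
      exact Finset.mem_range.2 (hE.src_lt e ((Finset.mem_range.1 he).trans hk))
    refine WP.seq (WP.asg (by simp [hk1]; omega) ?_)
    simp only [Expr.eval, Expr.add_def, Expr.ofNat_def, Op.eval, hk1]
    change WP Γ _ (s1.set .u (Γ.src k)) _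
    refine WP.cond (by simp; omega) (fun h => ?_) (fun h => ?_)
    · simp [hsn] at h
      rw [himg, Finset.insert_eq_self.2 h]
      exact WP.skip ⟨by simp, by simp [hk1], (hv.set (by simp) _).set (by simp) _, ha, ho,
        by simp [hnp], hen.congr rfl, by simpa using hsn⟩
    · simp [hsn] at h
      refine WP.seq (WP.sto (by simp) (by simp) (by simp) (by simp; omega) (by simp; omega)
        (by simp; omega) (by simp; omega) ?_)
      refine WP.seq (WP.sto (by simp) (by simp) (by simp) (by simp) (by simp; omega)
        (by simp [hnp]; omega) (by simp; omega) ?_)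
      refine WP.asg (by simp [hnp]; omega) ?_
      simp only [Expr.eval, Expr.ofNat_def, Expr.add_def, Op.eval, Store.set_v, Store.put_v,
        reduceCtorEq, if_false, if_true, hnp]
      rw [himg]
      refine ⟨by simp, by simp [hk1], ?_, ?_, by simpa using ho, ?_, ?_, ?_⟩
      · exact (SameV.set (s' := ((s1.set .u (Γ.src k)).put _ _ _ _ _).put _ _ _ _ _)
          (hv.set (x := .u) (by simp) _) (by simp) _).set (by simp) _
      · exact ((ha.set .u (Γ.src k)).put (by simp) _ _ _).put (by simp) _ _ _
      · simp [Finset.card_insert_of_notMem h]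
      · exact hen.insert h (by intro a; simp)
      · intro u
        simp [hsn]
        by_cases hu : u = Γ.src k <;> simp [hu]
  · rintro s1 t ⟨hv, ha, ho, hnp, hen, -⟩ - ht
    exact ⟨by simp at ht ⊢; omega, hv, ha, ho, hnp, hen⟩

end RAM

theorem Phases.succ {n : ℕ} {Near : ℕ → ℕ → ℕ → Prop} {R K B L : ℕ} {P : ℕ → Finset ℕ}
    {H : ℕ → List (ℕ × ℕ × ℕ)} {Y : ℕ → ℕ} (h : Phases n Near R K B L P H Y) {P' : Finset ℕ}
    {H' : List (ℕ × ℕ × ℕ)} {Y' : ℕ} (h1 : 1 ≤ Y') (h2 : Y' ^ expSeq R K L ≤ n)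
    (h3 : n < (Y' + 1) ^ expSeq R K L) (h4 : PhaseSpec n Near (min (B ^ L) n) Y' (P L) P' H') :
    Phases n Near R K B (L + 1) (Function.update P (L + 1) P') (Function.update H L H')
      (Function.update Y L Y') := by
  constructor
  · intro i hi
    rcases Nat.lt_succ_iff_lt_or_eq.1 hi with hlt | rfl
    · have e1 : i ≠ L + 1 := by omega
      have e2 : i + 1 ≠ L + 1 := by omega
      have e3 : i ≠ L := by omega
      simpa [Function.update_apply, e1, e2, e3] using h.spec i hlt
    · simpa [Function.update_apply] using h4
  all_goals
    intro i hi
    rcases Nat.lt_succ_iff_lt_or_eq.1 hi with hlt | rfl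
    · have e3 : i ≠ L := by omega
      simp only [Function.update_apply, e3, if_false]
      first | exact h.one_le i hlt | exact h.pow_le i hlt | exact h.lt_pow i hlt
    · simpa using by assumption

/-! ### The main program -/

namespace RAM

/-- The construction of the emulator. -/
def mainProg : Prog :=
  asg .n (.inp 0) ;; asg .m2 (2 * .inp 1) ;; asg .inv (.inp 2) ;; asg .kap (.inp 3) ;;
  asg .rad (.inp 4) ;; countProg ;; asg .base (112 * (.var .ph * .var .inv)) ;; listProg ;;
  asg .p (.var .kap) ;; asg .dl 1 ;; forTo .i (.var .ph) phaseProg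

-- `M` stands for a bound on the integer `R`-th root of `n`. Exponents never fall below `R`, so it
-- bounds the degree thresholds of all phases.
set_option maxHeartbeats 1600000 in
theorem mainProg_spec {Γ : Ctx} {n m E K R M : ℕ} {Near : ℕ → ℕ → ℕ → Prop}
    (hE : EdgeMetric Γ n (2 * m) Near) {s : Store}
    (ha : ∀ A i j k, s.a A i j k = 0) (ho : s.out = []) (h0 : Γ.inp 0 = n) (h1 : Γ.inp 1 = m)
    (h2 : Γ.inp 2 = E) (h3 : Γ.inp 3 = K) (h4 : Γ.inp 4 = R) (hZ : Γ.Z = n + E + K + R)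
    (hn : 1 ≤ n) (hE2 : 2 ≤ E) (hR : 3 ≤ R) (hRK : R ≤ K) (hM : ∀ y, y ^ R ≤ n → y ≤ M) :
    WP Γ mainProg s fun s' t => ∃ l P H Y, l ≤ K ∧ expSeq R K l = R ∧ (∀ j < l, R < expSeq R K j) ∧
      P 0 = (Finset.range (2 * m)).image Γ.src ∧
      Phases n Near R K (112 * ((R + l) * E)) (R + l) P H Y ∧
      s'.out = (List.range (R + l)).flatMap H ∧
      t ≤ 10000 * ((R + l) * (K * ((112 * ((R + l) * E)) ^ (R + l) * (2 * m + 1) * M))) := by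
  have hW := Γ.lin_le
  have hW2 := Γ.sq_le
  have hcub := Γ.cube_le
  have hlen := Γ.hlen
  have hml := hE.len_le
  have hZ8 := Γ.hZ
  have hnZ := hE.n_lt
  have hM1 : 1 ≤ M := hM 1 (by simpa using hn)
  refine WP.seq (WP.asg (by simp; omega) (WP.seq (WP.asg (by simp [h1]; omega) (WP.seq
    (WP.asg (by simp; omega) (WP.seq (WP.asg (by simp; omega) (WP.seq
    (WP.asg (by simp; omega) ?_)))))))))
  simp only [Expr.eval, Expr.ofNat_def, Expr.mul_def, Op.eval, h0, h1, h2, h3, h4]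
  set s1 := ((((s.set .n n).set .m2 (2 * m)).set .inv E).set .kap K).set .rad R with hs1
  have hs1a : ∀ A i j k, s1.a A i j k = 0 := ha
  refine WP.seq ((countProg_spec (s := s1) (R := R) (K := K) (by simp [hs1]) (by simp [hs1]) hR hRK
    (by omega)).mono ?_)
  rintro s2 t2 ⟨ht2, hv2, ha2, ho2, l, hph, hlK, hlR, hlj⟩
  set L := R + l with hL
  set B := 112 * (L * E) with hB
  have hLE : L * E ≤ Γ.Z ^ 2 := by
    rw [sq]; exact Nat.mul_le_mul (by omega) (by omega)
  have hinv2 : s2.v .inv = E := by rw [hv2 .inv (by simp)]; simp [hs1]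
  refine WP.seq (WP.asg (by simp [hph, hinv2]; omega) ?_)
  simp only [Expr.eval, Expr.ofNat_def, Expr.mul_def, Op.eval, hph, hinv2, ← hB]
  set s3 := s2.set .base B with hs3
  have hs3v : ∀ x, x ≠ .base → s3.v x = s2.v x := by intro x hx; simp [hs3, hx]
  refine WP.seq ((listProg_spec hE (s := s3) (by
    rw [hs3v _ (by simp), hv2 _ (by simp)]; simp [hs1]) (by
    intro u; change s2.a _ _ _ _ = 0; rw [ha2]; exact hs1a _ _ _ _)).mono ?_)
  rintro s4 t4 ⟨ht4, hv4, ha4, ho4, hnp4, hen4⟩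
  have hk4 : s4.v .kap = K := by
    rw [hv4 _ (by simp), hs3v _ (by simp), hv2 _ (by simp)]; simp [hs1]
  have hn4 : s4.v .n = n := by
    rw [hv4 _ (by simp), hs3v _ (by simp), hv2 _ (by simp)]; simp [hs1]
  have hm4 : s4.v .m2 = 2 * m := by
    rw [hv4 _ (by simp), hs3v _ (by simp), hv2 _ (by simp)]; simp [hs1]
  have hr4 : s4.v .rad = R := by
    rw [hv4 _ (by simp), hs3v _ (by simp), hv2 _ (by simp)]; simp [hs1]
  have hb4 : s4.v .base = B := by
    rw [hv4 _ (by simp)]; simp [hs3]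
  have hph4 : s4.v .ph = L := by
    rw [hv4 _ (by simp), hs3v _ (by simp), hph]
  have hout4 : s4.out = [] := by rw [ho4]; change s2.out = []; rw [ho2]; exact ho
  have harr : ∀ A i j k, A ≠ .seen → A ≠ .plist → s4.a A i j k = 0 := by
    intro A i j k e1 e2
    rw [ha4 A i (by simp [e1, e2])]; change s2.a _ _ _ _ = 0; rw [ha2]; exact hs1a _ _ _ _
  set P0 := (Finset.range (2 * m)).image Γ.src with hP0
  have hP0n : ∀ c ∈ P0, c < n := by
    intro c hc
    obtain ⟨e, he, rfl⟩ := Finset.mem_image.1 hc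
    exact hE.src_lt e (Finset.mem_range.1 he)
  have hP0m : P0.card ≤ 2 * m := Finset.card_image_le.trans (by simp)
  refine WP.seq (WP.asg (by simp) (WP.seq (WP.asg (by simp; omega) ?_)))
  simp only [Expr.eval, Expr.ofNat_def, hk4]
  have hB1 : 1 ≤ B := by
    have : 1 ≤ L * E := Nat.mul_pos (by omega) (by omega)
    omega
  have hB112 : B ≤ 112 * Γ.Z ^ 2 := Nat.mul_le_mul_left _ hLE
  have hcard : ∀ Q : Finset ℕ, (∀ c ∈ Q, c < n) → Q.card ≤ n := by
    intro Q hQ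
    have : Q ⊆ Finset.range n := fun c hc => by simpa using hQ c hc
    simpa using Finset.card_le_card this
  set T := 4000 * (K * (B ^ L * (2 * m + 1) * M)) with hT
  refine WP.forTo L T (fun k s1 => s1.v .ph = L ∧ ∃ P H Y, P 0 = P0 ∧
    Phases n Near R K B k P H Y ∧ s1.out = (List.range k).flatMap H ∧
    s1.out.length ≤ k * (n * n) ∧
    PhaseState s1 k n (2 * m) (P k) (expSeq R K k) (min (B ^ k) n) B R)
    ?_ (by omega) (by omega) ?_ ?_ ?_
  · refine ⟨by simp [hph4], fun _ => P0, fun _ => [], fun _ => 0, rfl, ⟨by simp, by simp, by simp, by simp⟩,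
      by simp [hout4], by simp [hout4], ?_⟩
    constructor
    · simp [hn4]
    · simp [hm4]
    · simp [hnp4]
    · simp [expSeq]
    · simp; omega
    · simp [hb4]
    · simp [hr4]
    · exact hen4.congr rfl
    · exact hP0n
    · exact hP0m
    all_goals intro i' _ j k; exact harr _ _ _ _ (by simp) (by simp)
  · rintro k s5 hk ⟨hp5, -⟩ -
    simp [hp5]
  · rintro k s5 hk ⟨hp5, P, H, Y, hP, hph5, hout5, hlen5, hst5⟩ hi5
    -- There are at most `K + R` phases with at most `n * n` edges each, and `Z = n + E + K + R`, so
    -- the output never exceeds `Z ^ 3` triples.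
    have hkZ : (k + 1) * (n * n) + 2 * n + 3 ≤ Γ.Z ^ 3 := by
      have e1 : n * (n * n) + (k + 1) * (n * n) + 0 ≤ n * (n * n) + (K + R) * (n * n) := by
        have := Nat.mul_le_mul_right (n * n) (show k + 1 ≤ K + R by omega)
        omega
      have e2 : n * (n * n) + (K + R) * (n * n) ≤ Γ.Z * (n * n) := by
        rw [← Nat.add_mul]; exact Nat.mul_le_mul_right _ (by omega)
      have e3 : Γ.Z * (n * n + 2 * n + 1) ≤ Γ.Z * (Γ.Z * Γ.Z) := by
        refine Nat.mul_le_mul_left _ ?_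
        have : n + 1 ≤ Γ.Z := by omega
        calc n * n + 2 * n + 1 = (n + 1) * (n + 1) := by ring
          _ ≤ _ := Nat.mul_le_mul this this
      have e4 : Γ.Z ^ 3 = Γ.Z * (Γ.Z * Γ.Z) := by ring
      have e5 : Γ.Z * (n * n + 2 * n + 1) = Γ.Z * (n * n) + 2 * (Γ.Z * n) + Γ.Z := by ring
      have e6 : n ≤ Γ.Z * n := Nat.le_mul_of_pos_left _ (by omega)
      omega
    have hexp1 := le_expSeq hRK k
    have hexp2 := expSeq_le (by omega) hRK k
    have hBk : 1 ≤ B ^ k := Nat.one_le_pow _ _ hB1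
    refine (phaseProg_spec hE hst5 hi5 (by omega) hn (by omega) (by omega) (by omega)
      (by omega) (min_le_right _ _) hB112 (by
        have : (k + 1) * (n * n) = k * (n * n) + n * n := by ring
        omega)).mono ?_
    rintro s6 t ⟨hi6, hph6, P', H', Y', hY1, hYle, hYlt, ht, ho6, hsp, hst6⟩
    have hY'M : Y' ≤ M := hM _ ((Nat.pow_le_pow_right hY1 hexp1).trans hYle)
    refine ⟨ht.trans ?_, hi6, by simp [hph6, hp5], Function.update P (k + 1) P',
      Function.update H k H', Function.update Y k Y', by simp [hP],
      hph5.succ hY1 hYle hYlt hsp, ?_, ?_, ?_⟩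
    · refine Nat.mul_le_mul_left _ (Nat.mul_le_mul hexp2 (Nat.mul_le_mul (Nat.mul_le_mul_right _ ?_) hY'M))
      exact (min_le_left _ _).trans (Nat.pow_le_pow_right hB1 hk.le)
    · rw [Store.set_out, ho6, hout5, List.range_succ, List.flatMap_append]
      congr 1
      · simp only [List.flatMap]
        congr 1
        refine List.map_congr_left fun i hi => ?_
        have : i ≠ k := by have := List.mem_range.1 hi; omega
        simp [this]
      · simp
    · have hYn : Y' ≤ n := (Nat.le_self_pow (by omega) Y').trans hYle
      have h6 := hsp.length_le hY1
      have h7 : (P k).card * Y' ≤ n * n := Nat.mul_le_mul (hcard _ hst5.lt) hYn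
      rw [Store.set_out, ho6, List.length_append]
      have : (k + 1) * (n * n) = k * (n * n) + n * n := by ring
      omega
    · rw [min_pow_succ hB1] at hst6
      simpa [expSeq] using hst6.set_i (k + 1)
  · rintro s5 t ⟨hp5, P, H, Y, hP, hph5, hout5, hlen5, hst5⟩ - ht
    refine ⟨l, P, H, Y, hlK, hlR, hlj, hP, hph5, hout5, ?_⟩
    set X := B ^ L * (2 * m + 1) * M with hX
    have hBL : 1 ≤ B ^ L := Nat.one_le_pow _ _ hB1
    have hX1 : 2 * m + 1 ≤ X := by
      calc 2 * m + 1 ≤ B ^ L * (2 * m + 1) := Nat.le_mul_of_pos_left _ hBL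
        _ ≤ _ := Nat.le_mul_of_pos_right _ hM1
    have hKX : K ≤ K * X := Nat.le_mul_of_pos_right _ (by omega)
    have hKX2 : X ≤ K * X := Nat.le_mul_of_pos_left _ (by omega)
    have hLK : K * X ≤ L * (K * X) := Nat.le_mul_of_pos_left _ (by omega)
    have hLK2 : L * 1 ≤ L * (K * X) := Nat.mul_le_mul_left _ (by omega)
    have e : L * (T + (Expr.var Var.ph).cost + 11) = 4000 * (L * (K * X)) + 13 * L := by
      simp only [Expr.cost, hT]; ring
    rw [e] at ht
    simp only [Expr.cost] at ht ⊢
    rw [← hL]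
    clear_value X
    omega

end RAM

/-! ### Setting up the reserved registers -/

namespace RAM

/-- Compute the radix and the address of the output. -/
def prologue : Prog :=
  .lit 64 0 ;; .load 65 64 ;; .lit 64 2 ;; .load 66 64 ;; .lit 64 3 ;; .load 67 64 ;; .lit 64 4 ;;
  .load 68 64 ;; .arith .add 2 65 66 ;; .arith .add 2 2 67 ;; .arith .add 2 2 68 ;; .lit 64 8 ;;
  .arith .mul 0 2 2 ;; .arith .mul 0 0 2 ;; .arith .mul 0 0 64

/-- The initial store. -/
def Store.init : Store := ⟨fun _ => 0, fun _ _ _ _ => 0, []⟩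

/-- The layout depends on the radix, which is the sum of four input words; this part is therefore
written directly for the machine. Unwritten cells are zero and so represent zero arrays. -/
theorem prologue_exec {Γ : Ctx} {input : List ℕ} (hin : ∀ r < Γ.len, input.getD r 0 = Γ.inp r)
    (hlen : input.length = Γ.len) (hle : ∀ r, input.getD r 0 ≤ Γ.W) (h5 : 5 ≤ Γ.len)
    (hZ : Γ.Z = Γ.inp 0 + Γ.inp 2 + Γ.inp 3 + Γ.inp 4) :
    ∃ S, Exec Γ.W prologue (initState input) S 15 ∧ Rel Γ S Store.init := by
  have hW := Γ.lin_le
  have hW2 := Γ.sq_le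
  have hcub := Γ.cube_le
  have hZ8 := Γ.hZ
  have m0 : input.getD 0 0 = Γ.inp 0 := hin 0 (by omega)
  have m2 : input.getD 2 0 = Γ.inp 2 := hin 2 (by omega)
  have m3 : input.getD 3 0 = Γ.inp 3 := hin 3 (by omega)
  have m4 : input.getD 4 0 = Γ.inp 4 := hin 4 (by omega)
  have e3 : Γ.Z * Γ.Z = Γ.Z ^ 2 := by ring
  have e4 : Γ.Z ^ 2 * Γ.Z = Γ.Z ^ 3 := by ring
  have e5 : Γ.Z ^ 3 * 8 = Γ.outBase := by unfold Ctx.outBase; ring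
  have hb := Γ.outBase_le
  have hload : ∀ (S : State) (x y b : ℕ), S.mem (S.reg y) = b → b ≤ Γ.W →
      Exec Γ.W (.load x y) S (S.setReg x b) 1 := by
    rintro S x y b rfl h; exact .load S x y h
  refine ⟨_, .seq (t := 1) (t' := 14) (.lit _ _ _ (by omega)) <|
    .seq (t := 1) (t' := 13) (hload _ _ _ (Γ.inp 0) (by simpa [initState] using m0) (by omega)) <|
    .seq (t := 1) (t' := 12) (.lit _ _ _ (by omega)) <|
    .seq (t := 1) (t' := 11) (hload _ _ _ (Γ.inp 2) (by simpa [initState] using m2) (by omega)) <|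
    .seq (t := 1) (t' := 10) (.lit _ _ _ (by omega)) <|
    .seq (t := 1) (t' := 9) (hload _ _ _ (Γ.inp 3) (by simpa [initState] using m3) (by omega)) <|
    .seq (t := 1) (t' := 8) (.lit _ _ _ (by omega)) <|
    .seq (t := 1) (t' := 7) (hload _ _ _ (Γ.inp 4) (by simpa [initState] using m4) (by omega)) <|
    .seq (t := 1) (t' := 6) (.arith_of_eq _ _ _ _ (Γ.inp 0 + Γ.inp 2) (by simp) (by omega)) <|
    .seq (t := 1) (t' := 5) (.arith_of_eq _ _ _ _ (Γ.inp 0 + Γ.inp 2 + Γ.inp 3) (by simp) (by omega)) <|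
    .seq (t := 1) (t' := 4) (.arith_of_eq _ _ _ _ Γ.Z (by simp [hZ]) (by omega)) <|
    .seq (t := 1) (t' := 3) (.lit _ _ _ (by omega)) <|
    .seq (t := 1) (t' := 2) (.arith_of_eq _ _ _ _ (Γ.Z ^ 2) (by simp [e3]) (by omega)) <|
    .seq (t := 1) (t' := 1) (.arith_of_eq _ _ _ _ (Γ.Z ^ 3) (by simp [e4]) (by omega)) <|
    .arith_of_eq _ _ _ _ Γ.outBase (by simp [e5]) (by omega), ?_⟩
  refine ⟨fun r => ?_, hle, by simp, by simp [initState, Store.init], by simp, fun x => ?_, ?_, ?_, ?_⟩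
  · simp only [setReg_reg]
    split_ifs <;> first | omega | exact Nat.zero_le _
  · have := x.idx_lt
    have := x.three_le_idx
    simp only [setReg_reg]
    iterate 15 rw [if_neg (by omega)]
    rfl
  · intro A i j k _ _ _
    have := Γ.len_le_addr A i j k
    exact List.getD_eq_default _ _ (by omega)
  · exact hin
  · intro j hj
    simp [Store.init] at hj

/-- The program that constructs emulators. -/
def emulatorProg : Prog := prologue ;; mainProg

end RAM

/-! ### The input graph as seen by the program -/

theorem getD_flatMap_pair {n : ℕ} (es : List (Fin n × Fin n)) (j : ℕ) (hj : j < es.length) :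
    (es.flatMap fun e => [(e.1 : ℕ), (e.2 : ℕ)]).getD (2 * j) 0 = es[j].1 ∧
    (es.flatMap fun e => [(e.1 : ℕ), (e.2 : ℕ)]).getD (2 * j + 1) 0 = es[j].2 := by
  induction es generalizing j with
  | nil => simp at hj
  | cons e es ih =>
    cases j with
    | zero => simp
    | succ j =>
      have := ih j (by simpa using hj)
      have e1 : 2 * (j + 1) = 2 * j + 1 + 1 := by ring
      simpa [e1] using this

theorem length_flatMap_pair {n : ℕ} (es : List (Fin n × Fin n)) :
    (es.flatMap fun e => [(e.1 : ℕ), (e.2 : ℕ)]).length = 2 * es.length := by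
  induction es with
  | nil => rfl
  | cons e es ih => simp; omega

/-- Distance at most `k`, for vertices given by numbers. -/
def SimpleGraph.Near {n : ℕ} (G : SimpleGraph (Fin n)) (k u v : ℕ) : Prop :=
  ∃ (hu : u < n) (hv : v < n), G.edist ⟨u, hu⟩ ⟨v, hv⟩ ≤ k

theorem SimpleGraph.Near.of_edist_le {n : ℕ} {G : SimpleGraph (Fin n)} {k : ℕ} {u v : Fin n}
    (h : G.edist u v ≤ k) : G.Near k u v := ⟨u.2, v.2, h⟩

/-- Drop the first edge of a shortest walk from `v` to `u`. -/
theorem SimpleGraph.near_step {n : ℕ} {G : SimpleGraph (Fin n)} {k : ℕ} {u v : Fin n}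
    (h : G.edist u v ≤ (k + 1 : ℕ)) : G.edist u v ≤ k ∨ ∃ x, G.edist u x ≤ k ∧ G.Adj x v := by
  have hne : G.edist v u ≠ ⊤ := by
    rw [G.edist_comm]; exact ne_top_of_le_ne_top (ENat.natCast_ne_top _) h
  obtain ⟨p, hp⟩ := (G.reachable_of_edist_ne_top hne).exists_walk_length_eq_edist
  rw [G.edist_comm, ← hp, Nat.cast_le] at h
  cases p with
  | nil => left; simp
  | cons hadj q =>
    right
    refine ⟨_, ?_, hadj.symm⟩
    rw [G.edist_comm]
    refine (G.edist_le q).trans ?_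
    simp at h
    exact_mod_cast h

/-- Each listed edge yields two directed edges, at positions `2 * j` and `2 * j + 1`; `twin`
exchanges these positions. -/
theorem edgeMetric_near {n : ℕ} {G : SimpleGraph (Fin n)} {es : List (Fin n × Fin n)}
    (hes : IsEdgeList G es) {Γ : RAM.Ctx} (hn : n + 3 ≤ Γ.Z) (hlen : 5 + 2 * es.length ≤ Γ.len)
    (h1 : ∀ j (hj : j < es.length), Γ.inp (5 + 2 * j) = es[j].1)
    (h2 : ∀ j (hj : j < es.length), Γ.inp (5 + (2 * j + 1)) = es[j].2) :
    RAM.EdgeMetric Γ n (2 * es.length) G.Near := by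
  have cases_index : ∀ e < 2 * es.length, ∃ j, ∃ (_ : j < es.length),
      (Γ.src e = es[j].1 ∧ Γ.dst e = es[j].2) ∨ (Γ.src e = es[j].2 ∧ Γ.dst e = es[j].1) := by
    intro e he
    refine ⟨e / 2, by omega, ?_⟩
    rcases Nat.even_or_odd' e with ⟨j, rfl | rfl⟩
    · left
      have hj : 2 * j / 2 = j := by omega
      have ht : RAM.twin (2 * j) = 2 * j + 1 := by unfold RAM.twin; omega
      simp only [hj, RAM.Ctx.src, RAM.Ctx.dst, ht]
      exact ⟨h1 _ _, h2 _ _⟩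
    · right
      have hj : (2 * j + 1) / 2 = j := by omega
      have ht : RAM.twin (2 * j + 1) = 2 * j := by unfold RAM.twin; omega
      simp only [hj, RAM.Ctx.src, RAM.Ctx.dst, ht]
      exact ⟨h2 _ _, h1 _ _⟩
  have hadj : ∀ j (hj : j < es.length), G.Adj es[j].1 es[j].2 := by
    intro j hj
    exact (hes.2 _ _).1 (List.mem_map.2 ⟨es[j], List.getElem_mem hj, rfl⟩)
  refine ⟨hn, hlen, by simp, ?_, ?_, ?_, ?_, ?_, ?_, ?_⟩
  · intro e he
    obtain ⟨j, hj, ⟨h, -⟩ | ⟨h, -⟩⟩ := cases_index e he <;> rw [h] <;> exact Fin.is_lt _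
  · rintro u v ⟨hu, hv, h⟩
    have : G.edist ⟨u, hu⟩ ⟨v, hv⟩ = 0 := by simpa using h
    simpa using SimpleGraph.edist_eq_zero_iff.1 this
  · intro u hu
    exact ⟨hu, hu, by simp⟩
  · rintro k u v ⟨hu, hv, h⟩
    exact ⟨hv, hu, by rwa [G.edist_comm]⟩
  · rintro k l u v w ⟨hu, hv, h⟩ ⟨_, hw, h'⟩
    refine ⟨hu, hw, (SimpleGraph.edist_triangle (v := ⟨v, hv⟩)).trans ?_⟩
    rw [Nat.cast_add]
    exact add_le_add h h'
  · intro e he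
    obtain ⟨j, hj, ⟨h, h'⟩ | ⟨h, h'⟩⟩ := cases_index e he <;> rw [h, h'] <;>
      refine .of_edist_le (le_of_eq ?_)
    · simpa using SimpleGraph.edist_eq_one_iff_adj.2 (hadj j hj)
    · simpa using SimpleGraph.edist_eq_one_iff_adj.2 (hadj j hj).symm
  · rintro k u v ⟨hu, hv, h⟩
    rcases SimpleGraph.near_step h with h | ⟨x, hx, hxv⟩
    · exact .inl ⟨hu, hv, h⟩
    · right
      obtain ⟨e, he, heq⟩ := List.mem_map.1 ((hes.2 x ⟨v, hv⟩).2 hxv)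
      obtain ⟨j, hj, rfl⟩ := List.mem_iff_getElem.1 he
      have t1 : RAM.twin (2 * j) = 2 * j + 1 := by unfold RAM.twin; omega
      have t2 : RAM.twin (2 * j + 1) = 2 * j := by unfold RAM.twin; omega
      rcases Sym2.eq_iff.1 heq with ⟨a, b⟩ | ⟨a, b⟩
      · refine ⟨2 * j, by omega, ?_, ?_⟩
        · rw [RAM.Ctx.src, h1 j hj, a]; exact .of_edist_le hx
        · rw [RAM.Ctx.dst, t1, h2 j hj, b]
      · refine ⟨2 * j + 1, by omega, ?_, ?_⟩
        · rw [RAM.Ctx.src, h2 j hj, b]; exact .of_edist_le hx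
        · rw [RAM.Ctx.dst, t2, h1 j hj, a]

/-! ### The stretch of the construction -/

theorem WWalk.single {V : Type*} {H : List (V × V × ℕ)} {u v : V} {w : ℕ} (h : (u, v, w) ∈ H) :
    WWalk H u v w := .fwd h (.nil v)

theorem WWalk.trans {V : Type*} {H : List (V × V × ℕ)} {u v x : V} {d d' : ℕ}
    (h : WWalk H u v d) (h' : WWalk H v x d') : WWalk H u x (d + d') := by
  induction h with
  | nil => simpa using h'
  | fwd hm _ ih => rw [add_assoc]; exact .fwd hm (ih h')
  | bwd hm _ ih => rw [add_assoc]; exact .bwd hm (ih h')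

theorem WWalk.symm {V : Type*} {H : List (V × V × ℕ)} {u v : V} {d : ℕ}
    (h : WWalk H u v d) : WWalk H v u d := by
  induction h with
  | nil => exact .nil _
  | @fwd u v x w d hm _ ih =>
    rw [add_comm]; exact ih.trans (.bwd hm (.nil u))
  | @bwd u v x w d hm _ ih =>
    rw [add_comm]; exact ih.trans (.fwd hm (.nil u))

/-- There is a walk of total weight at most `r`. -/
def WNear {V : Type*} (H : List (V × V × ℕ)) (r : ℝ) (u v : V) : Prop :=
  ∃ d : ℕ, WWalk H u v d ∧ (d : ℝ) ≤ r

theorem WNear.refl {V : Type*} (H : List (V × V × ℕ)) {r : ℝ} (hr : 0 ≤ r) (u : V) :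
    WNear H r u u := ⟨0, .nil u, by simpa using hr⟩

theorem WNear.mono {V : Type*} {H : List (V × V × ℕ)} {r r' : ℝ} {u v : V} (h : WNear H r u v)
    (hr : r ≤ r') : WNear H r' u v := by
  obtain ⟨d, h1, h2⟩ := h
  exact ⟨d, h1, h2.trans hr⟩

theorem WNear.symm {V : Type*} {H : List (V × V × ℕ)} {r : ℝ} {u v : V} (h : WNear H r u v) :
    WNear H r v u := by
  obtain ⟨d, h1, h2⟩ := h
  exact ⟨d, h1.symm, h2⟩

theorem WNear.trans {V : Type*} {H : List (V × V × ℕ)} {r r' : ℝ} {u v x : V} (h : WNear H r u v)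
    (h' : WNear H r' v x) : WNear H (r + r') u x := by
  obtain ⟨d, h1, h2⟩ := h
  obtain ⟨d', h1', h2'⟩ := h'
  exact ⟨d + d', h1.trans h1', by push_cast; linarith⟩

/-! ### Clusters and levels -/

/-- The bound on the radius of the clusters of phase `i`. -/
def clusterRadius (B : ℕ) : ℕ → ℕ
  | 0 => 0
  | i + 1 => clusterRadius B i + 2 * B ^ i

theorem clusterRadius_mono (B : ℕ) : Monotone (clusterRadius B) :=
  monotone_nat_of_le_succ fun _ => Nat.le_add_right _ _

/-- The radius is a geometric sum, dominated by its last term `2 * B ^ (i - 1)`. -/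
theorem clusterRadius_mul_le {B : ℕ} (hB : 2 ≤ B) (i : ℕ) : clusterRadius B i * B ≤ 4 * B ^ i := by
  induction i with
  | zero => simp [clusterRadius]
  | succ i ih =>
    have h1 : 2 * B ^ i ≤ B * B ^ i := Nat.mul_le_mul_right _ hB
    have h2 : (clusterRadius B i + 2 * B ^ i) * B = clusterRadius B i * B + 2 * (B * B ^ i) := by ring
    rw [clusterRadius, h2, pow_succ']
    omega

/-- A graph metric: `Near k u v` says that the distance is at most `k`. -/
structure NearMetric (n : ℕ) (Near : ℕ → ℕ → ℕ → Prop) : Prop where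
  refl : ∀ u < n, Near 0 u u
  symm : ∀ k u v, Near k u v → Near k v u
  trans : ∀ k l u v w, Near k u v → Near l v w → Near (k + l) u w
  mono : ∀ k l u v, k ≤ l → Near k u v → Near l u v
  cap : ∀ k u v, Near k u v → Near n u v

/-- The vertex `v` lies in a cluster of phase `j` with centre `c`. -/
structure InCluster (Near : ℕ → ℕ → ℕ → Prop) (B : ℕ) (P : ℕ → Finset ℕ)
    (out : List (ℕ × ℕ × ℕ)) (j v c : ℕ) : Prop where
  mem : c ∈ P j
  near : Near (clusterRadius B j) v c
  walk : WNear out (clusterRadius B j) v c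

/-- The vertex `v` belongs to clusters of the phases up to `j`, and the last of these is joined
to all the clusters nearby. -/
structure AtLevel (Near : ℕ → ℕ → ℕ → Prop) (B : ℕ) (P : ℕ → Finset ℕ)
    (out : List (ℕ × ℕ × ℕ)) (j v : ℕ) : Prop where
  cluster : ∀ i ≤ j, ∃ c, InCluster Near B P out i v c
  last : ∃ c, InCluster Near B P out j v c ∧ ∀ x ∈ P j, ∀ k ≤ B ^ j, Near k x c → WNear out k c x

section

variable {n R K B L : ℕ} {Near : ℕ → ℕ → ℕ → Prop} {P : ℕ → Finset ℕ} {H : ℕ → List (ℕ × ℕ × ℕ)}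
  {Y : ℕ → ℕ} {out : List (ℕ × ℕ × ℕ)}

/-- Follow the cluster of `v`: in each phase its center is either absorbed by a center of the next
phase, at cost at most `2 * B ^ i`, or joined to all centers nearby. The former cannot go on, as no
center survives. -/
theorem Phases.exists_atLevel (hN : NearMetric n Near) (hP : Phases n Near R K B L P H Y)
    (hout : ∀ i < L, ∀ e ∈ H i, e ∈ out) (hlast : P L = ∅) {v : ℕ} (hv : v ∈ P 0) (hvn : v < n) :
    ∃ j < L, AtLevel Near B P out j v := by
  have key : ∀ i ≤ L, (∃ j < i, AtLevel Near B P out j v) ∨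
      ∀ i' ≤ i, ∃ c, InCluster Near B P out i' v c := by
    intro i
    induction i with
    | zero =>
      intro _
      right
      intro i' hi'
      obtain rfl : i' = 0 := by omega
      exact ⟨v, hv, hN.refl v hvn, WNear.refl _ (by simp) v⟩
    | succ i ih =>
      intro hi
      rcases ih (by omega) with ⟨j, hj, h⟩ | h
      · exact .inl ⟨j, by omega, h⟩
      · obtain ⟨c, hc⟩ := h i le_rfl
        have hsp := hP.spec i (by omega)
        rcases hsp.cover c hc.mem with ⟨r, hr, hrc⟩ | hloc
        · right
          intro i' hi'
          rcases Nat.lt_succ_iff_lt_or_eq.1 (Nat.lt_succ_of_le hi') with hlt | rfl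
          · exact h i' (by omega)
          · refine ⟨r, hr, ?_, ?_⟩
            · rcases hrc with rfl | ⟨w, hw, hm⟩
              · exact hN.mono _ _ _ _ (Nat.le_add_right _ _) hc.near
              · have h1 := hN.symm _ _ _ (hsp.sound _ hm).2.2
                refine hN.mono _ _ _ _ ?_ (hN.trans _ _ _ _ _ hc.near h1)
                have : min (B ^ i) n ≤ B ^ i := min_le_left _ _
                simp only [clusterRadius]; omega
            · rcases hrc with rfl | ⟨w, hw, hm⟩
              · exact hc.walk.mono (by simp [clusterRadius])
              · have h1 : WNear out w c r := ⟨w, (WWalk.single (hout i (by omega) _ hm)).symm, le_rfl⟩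
                refine (hc.walk.trans h1).mono ?_
                have : min (B ^ i) n ≤ B ^ i := min_le_left _ _
                rw [clusterRadius]
                exact_mod_cast (by omega : clusterRadius B i + w ≤ clusterRadius B i + 2 * B ^ i)
        · refine .inl ⟨i, by omega, h, c, hc, ?_⟩
          intro x hx k hk hnear
          -- The algorithm explores only to the capped threshold, which loses nothing because finite
          -- distances are at most `n`.
          have hnear' : Near (min k n) x c := by
            rcases min_choice k n with e | e <;> rw [e]
            · exact hnear
            · exact hN.cap _ _ _ hnear
          rcases hloc x hx (min k n) (min_le_min_right n hk) hnear' with rfl | ⟨w, hw, hm⟩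
          · exact WNear.refl _ (by positivity) _
          · exact ⟨w, .single (hout i (by omega) _ hm), by exact_mod_cast hw.trans (min_le_left _ _)⟩
  rcases key L le_rfl with h | h
  · exact h
  · obtain ⟨c, hc⟩ := h L le_rfl
    have := hc.mem
    simp [hlast] at this

/-- Since `j ≤ j'`, also `v` lies in a cluster of phase `j`. Its center is within `2 * clusterRadius
B j + d` of the center of `u`, hence joined to it; two more radii connect `u` and `v` to these
centers. -/
theorem AtLevel.wnear (hN : NearMetric n Near) {j j' d u v : ℕ}
    (hu : AtLevel Near B P out j u) (hv : AtLevel Near B P out j' v) (hj : j ≤ j')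
    (hd : Near d u v) (hle : 2 * clusterRadius B j + d ≤ B ^ j) :
    WNear out (4 * clusterRadius B j + d) u v := by
  obtain ⟨c, hc, hloc⟩ := hu.last
  obtain ⟨c', hc'⟩ := hv.cluster j hj
  have h1 := hN.symm _ _ _ (hN.trans _ _ _ _ _ (hN.trans _ _ _ _ _ (hN.symm _ _ _ hc.near) hd) hc'.near)
  have h2 := hloc c' hc'.mem _ (by omega) h1
  refine ((hc.walk.trans h2).trans hc'.walk.symm).mono ?_
  push_cast
  linarith

end

/-! ### Recursion for the stretch over the levels -/

/-- The bound on the additive stretch for walks of level less than `i`. -/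
def addStretch (B : ℕ) : ℕ → ℝ
  | 0 => 0
  | i + 1 => 2 * addStretch B i + 12 * clusterRadius B i

/-- The bound on the multiplicative stretch, minus one, for walks of level less than `i`. -/
noncomputable def mulStretch (B : ℕ) : ℕ → ℝ
  | 0 => 0
  | i + 1 => mulStretch B i + addStretch B (i + 1) / ((B ^ i - 2 * clusterRadius B i : ℕ) : ℝ)

theorem addStretch_nonneg (B i : ℕ) : 0 ≤ addStretch B i := by
  induction i with
  | zero => exact le_rfl
  | succ i ih => rw [addStretch]; positivity

theorem mulStretch_nonneg (B i : ℕ) : 0 ≤ mulStretch B i := by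
  induction i with
  | zero => exact le_rfl
  | succ i ih => rw [mulStretch]; have := addStretch_nonneg B (i + 1); positivity

/-- Inductively `addStretch B i * B ≤ B ^ i`, and a radius times `B` is at most `4 * B ^ i`, so the
recursion gives `2 + 12 * 4 = 50`; the induction closes because `50 ≤ B`. -/
theorem addStretch_mul_le {B : ℕ} (hB : 50 ≤ B) (i : ℕ) : addStretch B (i + 1) * B ≤ 50 * (B : ℝ) ^ i := by
  have hr : ∀ i, (clusterRadius B i : ℝ) * B ≤ 4 * (B : ℝ) ^ i := fun i => by
    exact_mod_cast clusterRadius_mul_le (by omega) i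
  have hB' : (50 : ℝ) ≤ B := by exact_mod_cast hB
  have key : ∀ i, addStretch B i * B ≤ (B : ℝ) ^ i := by
    intro i
    induction i with
    | zero => simp [addStretch]
    | succ i ih =>
      rw [addStretch, pow_succ']
      have := hr i
      have h3 : 50 * (B : ℝ) ^ i ≤ B * (B : ℝ) ^ i := mul_le_mul_of_nonneg_right hB' (by positivity)
      linarith
  rw [addStretch]
  have := hr i
  have := key i
  linarith

theorem addStretch_le {B : ℕ} (hB : 50 ≤ B) (i : ℕ) : addStretch B i ≤ (B : ℝ) ^ i := by
  cases i with
  | zero => simp [addStretch]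
  | succ i =>
    have h1 := addStretch_mul_le hB i
    have hB' : (50 : ℝ) ≤ B := by exact_mod_cast hB
    have h2 : 50 * (B : ℝ) ^ i ≤ B * (B : ℝ) ^ i := mul_le_mul_of_nonneg_right hB' (by positivity)
    have h0 := addStretch_nonneg B (i + 1)
    have h3 : addStretch B (i + 1) * 1 ≤ addStretch B (i + 1) * B :=
      mul_le_mul_of_nonneg_left (by linarith) h0
    rw [pow_succ']
    linarith

theorem pow_le_two_mul_sub {B : ℕ} (hB : 50 ≤ B) (i : ℕ) :
    B ^ i ≤ 2 * (B ^ i - 2 * clusterRadius B i) := by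
  have h1 := clusterRadius_mul_le (by omega : 2 ≤ B) i
  have h2 : clusterRadius B i * 50 ≤ clusterRadius B i * B := Nat.mul_le_mul_left _ hB
  omega

theorem two_mul_clusterRadius_lt {B : ℕ} (hB : 50 ≤ B) (i : ℕ) : 2 * clusterRadius B i + 1 ≤ B ^ i := by
  have h1 := pow_le_two_mul_sub hB i
  have h2 : 1 ≤ B ^ i := Nat.one_le_pow _ _ (by omega)
  omega

/-- Each level adds at most `(50 * B ^ i / B) / (B ^ i / 2) = 100 / B`, as pieces have length at
least `B ^ i / 2`. -/
theorem mulStretch_le {B : ℕ} (hB : 50 ≤ B) (i : ℕ) : mulStretch B i ≤ i * (100 / B) := by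
  have hB' : (50 : ℝ) ≤ B := by exact_mod_cast hB
  induction i with
  | zero => simp [mulStretch]
  | succ i ih =>
    have h1 := addStretch_mul_le hB i
    have h2 : (B : ℝ) ^ i ≤ 2 * ((B ^ i - 2 * clusterRadius B i : ℕ) : ℝ) := by
      exact_mod_cast pow_le_two_mul_sub hB i
    have h3 : 0 < (B : ℝ) ^ i := by positivity
    have h4 : addStretch B (i + 1) / ((B ^ i - 2 * clusterRadius B i : ℕ) : ℝ) ≤ 100 / B := by
      rw [div_le_div_iff₀ (by linarith) (by linarith)]
      linarith
    rw [mulStretch]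
    push_cast
    linarith

section

variable {n B : ℕ} {Near : ℕ → ℕ → ℕ → Prop} {P : ℕ → Finset ℕ} {out : List (ℕ × ℕ × ℕ)}

theorem near_of_steps (hN : NearMetric n Near) {x : ℕ → ℕ} {s d : ℕ}
    (hx : ∀ t, s ≤ t → t < s + d → Near 1 (x t) (x (t + 1))) (h0 : x s < n) :
    Near d (x s) (x (s + d)) := by
  induction d with
  | zero => exact hN.refl _ h0
  | succ d ih => exact hN.trans _ _ _ _ _ (ih fun t h h' => hx t h (by omega)) (hx _ (by omega) (by omega))

/-- Walks of low levels are stretched little. -/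
def Stretched (Near : ℕ → ℕ → ℕ → Prop) (n B : ℕ) (P : ℕ → Finset ℕ) (out : List (ℕ × ℕ × ℕ))
    (i : ℕ) (a b : ℝ) (x : ℕ → ℕ) (d : ℕ) : Prop :=
  ∀ s, (∀ t, s ≤ t → t < s + d → Near 1 (x t) (x (t + 1))) →
    (∀ t, s ≤ t → t ≤ s + d → x t < n ∧ ∃ j < i, AtLevel Near B P out j (x t)) →
    WNear out ((1 + a) * d + b) (x s) (x (s + d))

theorem adjacent_wnear (hN : NearMetric n Near) (hB : 50 ≤ B) {i j j' u v : ℕ}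
    (hu : AtLevel Near B P out j u) (hv : AtLevel Near B P out j' v) (hj : j ≤ i) (hj' : j' ≤ i)
    (h : Near 1 u v) : WNear out (4 * clusterRadius B i + 1) u v := by
  have main : ∀ {j j' u v : ℕ}, AtLevel Near B P out j u → AtLevel Near B P out j' v → j ≤ i →
      j ≤ j' → Near 1 u v → WNear out (4 * clusterRadius B i + 1) u v := by
    intro j j' u v hu hv hj hjj h
    have hm : (clusterRadius B j : ℝ) ≤ clusterRadius B i := by exact_mod_cast clusterRadius_mono B hj
    exact (hu.wnear hN hv hjj h (two_mul_clusterRadius_lt hB j)).mono (by push_cast; linarith)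
  rcases le_total j j' with hjj | hjj
  · exact main hu hv hj hjj h
  · exact (main hv hu hj' hjj (hN.symm _ _ _ h)).symm

/-- Between the first and the last vertex of level `i` the emulator goes directly, with error `4 *
r`. On either side of them only lower levels occur, with error `b` each by induction, plus `4 * r`
for the adjoining edge: in all `2 * b + 12 * r`. -/
theorem stretched_chunk (hN : NearMetric n Near) (hB : 50 ≤ B) {i : ℕ} {x : ℕ → ℕ}
    (ih : ∀ d, Stretched Near n B P out i (mulStretch B i) (addStretch B i) x d) {d : ℕ}
    (hd : 2 * clusterRadius B i + d ≤ B ^ i) :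
    Stretched Near n B P out (i + 1) (mulStretch B i) (addStretch B (i + 1)) x d := by
  intro s hstep hlev
  have ha := mulStretch_nonneg B i
  have hb := addStretch_nonneg B i
  set a := mulStretch B i
  set b := addStretch B i
  set r : ℝ := ((clusterRadius B i : ℕ) : ℝ) with hr
  have hr0 : 0 ≤ r := by positivity
  have hb' : addStretch B (i + 1) = 2 * b + 12 * r := rfl
  have low : ∀ t, s ≤ t → t ≤ s + d → ¬ AtLevel Near B P out i (x t) →
      x t < n ∧ ∃ j < i, AtLevel Near B P out j (x t) := by
    intro t h1 h2 h3
    obtain ⟨h4, j, hj, h5⟩ := hlev t h1 h2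
    refine ⟨h4, j, ?_, h5⟩
    rcases Nat.lt_succ_iff_lt_or_eq.1 hj with h | rfl
    · exact h
    · exact absurd h5 h3
  classical
  by_cases hex : ∃ t, t ≤ d ∧ AtLevel Near B P out i (x (s + t))
  · obtain ⟨hpd, hpl⟩ := Nat.find_spec hex
    have hpmin := fun t => Nat.find_min (m := t) hex
    set p := Nat.find hex
    obtain ⟨q, hqd, hql, hqmax⟩ : ∃ q ≤ d, AtLevel Near B P out i (x (s + q)) ∧
        ∀ t, q < t → t ≤ d → ¬ AtLevel Near B P out i (x (s + t)) :=
      ⟨Nat.findGreatest (fun t => AtLevel Near B P out i (x (s + t))) d, Nat.findGreatest_le d,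
        Nat.findGreatest_spec (P := fun t => AtLevel Near B P out i (x (s + t))) hpd hpl,
        fun t h1 h2 => Nat.findGreatest_is_greatest
          (P := fun t => AtLevel Near B P out i (x (s + t))) h1 h2⟩
    have hpq : p ≤ q := by
      by_contra hcon
      exact hqmax p (by omega) hpd hpl
    -- The part before the first vertex of level `i`: its vertices up to index `p - 1` have lower
    -- levels, and one edge leads to index `p`. For `p = 0` the part is empty.
    have w1 : WNear out ((1 + a) * p + b + 4 * r) (x s) (x (s + p)) := by
      rcases Nat.eq_zero_or_pos p with h0 | h0
      · rw [h0]; exact WNear.refl _ (by push_cast; nlinarith) _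
      · obtain ⟨p', hp'⟩ : ∃ p', p = p' + 1 := ⟨p - 1, by omega⟩
        have h1 := ih p' s (fun t h h' => hstep t h (by omega)) (fun t h h' => low t h (by omega) (by
          intro hcon
          refine hpmin (t - s) (by omega) ⟨by omega, ?_⟩
          rwa [Nat.add_sub_cancel' h]))
        obtain ⟨-, j, hj, h2⟩ := hlev (s + p') (by omega) (by omega)
        have h3 := adjacent_wnear hN hB h2 hpl (Nat.lt_succ_iff.1 hj) le_rfl (by
          rw [hp']; exact hstep (s + p') (by omega) (by omega))
        refine (h1.trans h3).mono ?_
        rw [hp']; push_cast; nlinarith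
    have w3 : WNear out ((1 + a) * (d - q : ℕ) + b + 4 * r) (x (s + q)) (x (s + d)) := by
      rcases Nat.eq_zero_or_pos (d - q) with h0 | h0
      · obtain rfl : q = d := by omega
        exact WNear.refl _ (by rw [h0]; push_cast; nlinarith) _
      · obtain ⟨e, he⟩ : ∃ e, d = q + 1 + e := ⟨d - q - 1, by omega⟩
        have h1 := ih e (s + q + 1) (fun t h h' => hstep t (by omega) (by omega))
          (fun t h h' => low t (by omega) (by omega) (by
            have := hqmax (t - s) (by omega) (by omega)
            rwa [Nat.add_sub_cancel' (by omega)] at this))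
        obtain ⟨-, j, hj, h2⟩ := hlev (s + q + 1) (by omega) (by omega)
        have h3 := adjacent_wnear hN hB hql h2 le_rfl (Nat.lt_succ_iff.1 hj)
          (hstep (s + q) (by omega) (by omega))
        have e1 : s + q + 1 + e = s + d := by omega
        have e2 : d - q = e + 1 := by omega
        rw [e1] at h1
        refine (h3.trans h1).mono ?_
        rw [e2]; push_cast; nlinarith
    have w2 : WNear out (4 * r + (q - p : ℕ)) (x (s + p)) (x (s + q)) := by
      have h1 := near_of_steps hN (x := x) (s := s + p) (d := q - p)
        (fun t h h' => hstep t (by omega) (by omega)) (hlev (s + p) (by omega) (by omega)).1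
      have e1 : s + p + (q - p) = s + q := by omega
      rw [e1] at h1
      exact hpl.wnear hN hql le_rfl h1 (by omega)
    refine ((w1.trans w2).trans w3).mono ?_
    have e1 : (d : ℝ) = p + (q - p : ℕ) + (d - q : ℕ) := by
      exact_mod_cast (by omega : d = p + (q - p) + (d - q))
    rw [hb', e1]
    have : 0 ≤ a * ((q - p : ℕ) : ℝ) := by positivity
    linarith
  · refine (ih d s hstep fun t h h' => low t h h' fun hcon => hex ⟨t - s, by omega, ?_⟩).mono ?_
    · rwa [Nat.add_sub_cancel' h]
    · rw [hb']; linarith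

/-- Cut the walk into pieces of length `l`. The additive error of each full piece is charged to its
`l` steps and becomes multiplicative; only the last, shorter piece leaves an additive error. -/
theorem stretched (hN : NearMetric n Near) (hB : 50 ≤ B) (i : ℕ) (x : ℕ → ℕ) (d : ℕ) :
    Stretched Near n B P out i (mulStretch B i) (addStretch B i) x d := by
  induction i generalizing d with
  | zero =>
    intro s _ h
    obtain ⟨-, j, hj, -⟩ := h s le_rfl (by omega)
    omega
  | succ i ih =>
    have hlt := two_mul_clusterRadius_lt hB i
    have hb := addStretch_nonneg B (i + 1)
    -- The largest length for which centers of level `i` at both ends of a piece are still within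
    -- the threshold.
    set l := B ^ i - 2 * clusterRadius B i with hl
    have hm : mulStretch B (i + 1) = mulStretch B i + addStretch B (i + 1) / (l : ℝ) := rfl
    have hl0 : (0 : ℝ) < l := by exact_mod_cast (by omega : 0 < l)
    induction d using Nat.strong_induction_on with
    | _ d ihd =>
      rcases Nat.lt_or_ge d l with hdl | hdl
      · intro s h h'
        refine (stretched_chunk hN hB ih (d := d) (by omega) s h h').mono ?_
        rw [hm]
        have : 0 ≤ addStretch B (i + 1) / (l : ℝ) * d := by positivity
        linarith
      · intro s h h'
        have h1 := stretched_chunk hN hB ih (d := l) (by omega) s (fun t a b => h t a (by omega))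
          (fun t a b => h' t a (by omega))
        have h2 := ihd (d - l) (by omega) (s + l) (fun t a b => h t (by omega) (by omega))
          (fun t a b => h' t (by omega) (by omega))
        have e : s + l + (d - l) = s + d := by omega
        rw [e] at h2
        refine (h1.trans h2).mono (le_of_eq ?_)
        rw [Nat.cast_sub hdl, hm]
        field_simp
        ring

end

/-! ### The number of edges -/

/-- Each old center carries `c`, each new one `c' ≤ c ^ 2`. With `f = c - Y` the gain per star is
`(1 - f) * (Y - 1 + f)`, which is nonnegative. The same calculation with stars of `Y + 1` centers
would fail, hence the threshold `Y + 2`. -/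
theorem PhaseSpec.potential {n : ℕ} {Near : ℕ → ℕ → ℕ → Prop} {δ Y : ℕ} {P P' : Finset ℕ}
    {H : List (ℕ × ℕ × ℕ)} (h : PhaseSpec n Near δ Y P P' H) {c c' : ℝ} (hY : 1 ≤ Y)
    (hc : (Y : ℝ) ≤ c) (hc1 : c < Y + 1) (hc' : c' ≤ c ^ 2) :
    (H.length : ℝ) + P'.card * c' ≤ P.card * c := by
  have h1 : ((Y : ℝ) + 2) * P'.card ≤ P.card := by exact_mod_cast h.card
  have h2 : (H.length : ℝ) + (Y + 2) * P'.card * Y ≤ (Y + 1) * P'.card + P.card * Y := by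
    exact_mod_cast h.len
  have hY' : (1 : ℝ) ≤ Y := by exact_mod_cast hY
  set N : ℝ := (P.card : ℝ)
  set N' : ℝ := (P'.card : ℝ)
  set y : ℝ := (Y : ℝ)
  have hN' : 0 ≤ N' := by positivity
  have h3 : N' * c' ≤ N' * c ^ 2 := mul_le_mul_of_nonneg_left hc' hN'
  have h4 : (y + 2) * N' * (c - y) ≤ N * (c - y) := mul_le_mul_of_nonneg_right h1 (by linarith)
  have h5 : 0 ≤ N' * ((1 - (c - y)) * (y - 1 + (c - y))) :=
    mul_nonneg hN' (mul_nonneg (by linarith) (by linarith))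
  nlinarith

section

variable {n R K B L : ℕ} {Near : ℕ → ℕ → ℕ → Prop} {P : ℕ → Finset ℕ} {H : ℕ → List (ℕ × ℕ × ℕ)}
  {Y : ℕ → ℕ}

theorem nat_le_rpow_inv {y n p : ℕ} (hp : 1 ≤ p) (h : y ^ p ≤ n) : (y : ℝ) ≤ (n : ℝ) ^ (1 / (p : ℝ)) := by
  have hp' : (p : ℝ) ≠ 0 := by positivity
  calc (y : ℝ) = ((y : ℝ) ^ p) ^ (1 / (p : ℝ)) := by
        rw [← Real.rpow_natCast, ← Real.rpow_mul (by positivity), mul_one_div_cancel hp', Real.rpow_one]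
    _ ≤ _ := Real.rpow_le_rpow (by positivity) (by exact_mod_cast h) (by positivity)

theorem rpow_inv_lt_nat {y n p : ℕ} (hp : 1 ≤ p) (h : n < y ^ p) : (n : ℝ) ^ (1 / (p : ℝ)) < y := by
  have hp' : (p : ℝ) ≠ 0 := by positivity
  calc (n : ℝ) ^ (1 / (p : ℝ)) < ((y : ℝ) ^ p) ^ (1 / (p : ℝ)) :=
        Real.rpow_lt_rpow (by positivity) (by exact_mod_cast h) (by positivity)
    _ = y := by
        rw [← Real.rpow_natCast, ← Real.rpow_mul (by positivity), mul_one_div_cancel hp', Real.rpow_one]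

/-- Telescoping of the potential `(P k).card * c k`. -/
theorem Phases.length_le (hP : Phases n Near R K B L P H Y) (hR : 1 ≤ R) (hRK : R ≤ K) (hn : 1 ≤ n) :
    (((List.range L).flatMap H).length : ℝ) ≤ (P 0).card * (n : ℝ) ^ (1 / (K : ℝ)) := by
  set c : ℕ → ℝ := fun i => (n : ℝ) ^ (1 / (expSeq R K i : ℝ)) with hc
  have hn' : (1 : ℝ) ≤ n := by exact_mod_cast hn
  have key : ∀ k ≤ L, (((List.range k).flatMap H).length : ℝ) + (P k).card * c k ≤ (P 0).card * c 0 := by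
    intro k
    induction k with
    | zero => intro _; simp
    | succ k ih =>
      intro hk
      have hp := le_expSeq hRK k
      have hp' := le_expSeq hRK (k + 1)
      have h1 := (hP.spec k (by omega)).potential (c := c k) (c' := c (k + 1)) (hP.one_le k (by omega))
        (nat_le_rpow_inv (by omega) (hP.pow_le k (by omega)))
        (by exact_mod_cast rpow_inv_lt_nat (by omega) (hP.lt_pow k (by omega)))
        (by
          simp only [hc]
          rw [← Real.rpow_natCast, ← Real.rpow_mul (by positivity)]
          refine Real.rpow_le_rpow_of_exponent_le hn' ?_
          -- Halving rounds up and the maximum with `R` only increases, so the next root is at most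
          -- the square of the current one.
          have e1 : expSeq R K k ≤ 2 * expSeq R K (k + 1) := by
            simp only [expSeq, nextExp]; omega
          have e2 : (expSeq R K k : ℝ) ≤ 2 * expSeq R K (k + 1) := by exact_mod_cast e1
          have e3 : (0 : ℝ) < expSeq R K k := by exact_mod_cast (by omega : 0 < expSeq R K k)
          have e4 : (0 : ℝ) < expSeq R K (k + 1) := by
            exact_mod_cast (by omega : 0 < expSeq R K (k + 1))
          push_cast
          rw [one_div_mul_eq_div, div_le_div_iff₀ e4 e3]
          linarith)
      have h2 := ih (by omega)
      rw [List.range_succ, List.flatMap_append, List.length_append]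
      push_cast
      simp only [List.flatMap_cons, List.flatMap_nil, List.append_nil]
      linarith
  have h := key L le_rfl
  have h0 : (0 : ℝ) ≤ (P L).card * c L := by positivity
  have e : c 0 = (n : ℝ) ^ (1 / (K : ℝ)) := rfl
  rw [← e]
  linarith

theorem expSeq_eq_of_le {R K l : ℕ} (hR : 1 ≤ R) (h : expSeq R K l = R) (i : ℕ) : expSeq R K (l + i) = R := by
  induction i with
  | zero => exact h
  | succ i ih =>
    rw [← add_assoc, expSeq, ih, nextExp]; omega

/-- Once the exponent is `R`, each phase divides the number of centers by at least `y + 1`, where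
`(y + 1) ^ R > n`. After `R` such phases fewer than one center is left. -/
theorem Phases.last_eq_empty {l : ℕ} (hP : Phases n Near R K B (R + l) P H Y) (hR : 1 ≤ R)
    (hl : expSeq R K l = R) (h0 : (P 0).card ≤ n) : P (R + l) = ∅ := by
  have hanti : ∀ i ≤ R + l, (P i).card ≤ n := by
    intro i
    induction i with
    | zero => intro _; exact h0
    | succ i ih =>
      intro hi
      exact (Finset.card_le_card (hP.spec i (by omega)).sub).trans (ih (by omega))
  -- Keeping the smaller of the thresholds seen so far avoids proving that integer roots are unique.
  have key : ∀ i, 1 ≤ i → i ≤ R → ∃ y, 1 ≤ y ∧ n < (y + 1) ^ R ∧ (P (l + i)).card * (y + 1) ^ i ≤ n := by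
    intro i h1
    induction i, h1 using Nat.le_induction with
    | base =>
      intro hi
      have h2 := hP.lt_pow l (by omega)
      rw [hl] at h2
      refine ⟨Y l, hP.one_le l (by omega), h2, ?_⟩
      have h3 := (hP.spec l (by omega)).card
      have h4 := hanti l (by omega)
      have h5 : (Y l + 1) * (P (l + 1)).card ≤ (Y l + 2) * (P (l + 1)).card :=
        Nat.mul_le_mul_right _ (by omega)
      rw [pow_one, Nat.mul_comm]
      omega
    | succ i h1 ih =>
      intro hi
      obtain ⟨y, hy, hyn, hc⟩ := ih (by omega)
      have h2 := hP.lt_pow (l + i) (by omega)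
      rw [expSeq_eq_of_le hR hl] at h2
      have h3 := (hP.spec (l + i) (by omega)).card
      have h6 := hP.pow_le (l + i) (by omega)
      rw [expSeq_eq_of_le hR hl] at h6
      rcases le_total y (Y (l + i)) with hle | hle
      · refine ⟨y, hy, hyn, ?_⟩
        have h5 : (y + 1) * (P (l + (i + 1))).card ≤ (Y (l + i) + 2) * (P (l + (i + 1))).card :=
          Nat.mul_le_mul_right _ (by omega)
        calc (P (l + (i + 1))).card * (y + 1) ^ (i + 1)
            = (y + 1) * (P (l + (i + 1))).card * (y + 1) ^ i := by ring
          _ ≤ (P (l + i)).card * (y + 1) ^ i := Nat.mul_le_mul_right _ (h5.trans h3)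
          _ ≤ n := hc
      · refine ⟨Y (l + i), hP.one_le _ (by omega), h2, ?_⟩
        have h5 : (Y (l + i) + 1) * (P (l + (i + 1))).card ≤ (Y (l + i) + 2) * (P (l + (i + 1))).card :=
          Nat.mul_le_mul_right _ (by omega)
        calc (P (l + (i + 1))).card * (Y (l + i) + 1) ^ (i + 1)
            = (Y (l + i) + 1) * (P (l + (i + 1))).card * (Y (l + i) + 1) ^ i := by ring
          _ ≤ (P (l + i)).card * (Y (l + i) + 1) ^ i := Nat.mul_le_mul_right _ (h5.trans h3)
          _ ≤ (P (l + i)).card * (y + 1) ^ i := Nat.mul_le_mul_left _ (Nat.pow_le_pow_left (by omega) _)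
          _ ≤ n := hc
  obtain ⟨y, hy, hyn, hc⟩ := key R hR le_rfl
  rw [Nat.add_comm, ← Finset.card_eq_zero]
  by_contra hne
  have : 1 * (y + 1) ^ R ≤ (P (l + R)).card * (y + 1) ^ R := Nat.mul_le_mul_right _ (by omega)
  omega

end

/-! ### The emulator -/

/-- A list of edges between vertices given by numbers. -/
def toFin {n : ℕ} (out : List (ℕ × ℕ × ℕ)) (h : ∀ e ∈ out, e.1 < n ∧ e.2.1 < n) :
    List (Fin n × Fin n × ℕ) :=
  out.pmap (fun e (he : e.1 < n ∧ e.2.1 < n) => (⟨e.1, he.1⟩, ⟨e.2.1, he.2⟩, e.2.2)) h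

theorem mem_toFin {n : ℕ} {out : List (ℕ × ℕ × ℕ)} {h : ∀ e ∈ out, e.1 < n ∧ e.2.1 < n}
    {u v : Fin n} {w : ℕ} : (u, v, w) ∈ toFin out h ↔ ((u : ℕ), (v : ℕ), w) ∈ out := by
  simp only [toFin, List.mem_pmap, Prod.mk.injEq]
  constructor
  · rintro ⟨⟨a, b, c⟩, hm, rfl, rfl, rfl⟩; exact hm
  · intro hm; exact ⟨_, hm, rfl, rfl, rfl⟩

theorem WWalk.toFin {n : ℕ} {out : List (ℕ × ℕ × ℕ)} (h : ∀ e ∈ out, e.1 < n ∧ e.2.1 < n)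
    {u v d : ℕ} (hw : WWalk out u v d) (hu : u < n) (hv : v < n) :
    WWalk (_root_.toFin out h) ⟨u, hu⟩ ⟨v, hv⟩ d := by
  induction hw with
  | nil => exact .nil _
  | fwd hm _ ih => exact .fwd (v := ⟨_, (h _ hm).2⟩) (mem_toFin.2 hm) (ih _ hv)
  | bwd hm _ ih => exact .bwd (v := ⟨_, (h _ hm).1⟩) (mem_toFin.2 hm) (ih _ hv)

/-- Edge weights are upper bounds on distances, so the triangle inequality applies along any walk.
-/
theorem edist_le_wdist {n : ℕ} {G : SimpleGraph (Fin n)} {H : List (Fin n × Fin n × ℕ)}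
    (h : ∀ u v w, (u, v, w) ∈ H → G.edist u v ≤ w) (u v : Fin n) : G.edist u v ≤ wdist H u v := by
  refine le_iInf₂ fun d hd => ?_
  induction hd with
  | nil => simp
  | @fwd u v x w d hm _ ih =>
    rw [Nat.cast_add]
    exact (SimpleGraph.edist_triangle (v := v)).trans (add_le_add (h _ _ _ hm) ih)
  | @bwd u v x w d hm _ ih =>
    rw [Nat.cast_add]
    refine (SimpleGraph.edist_triangle (v := v)).trans (add_le_add ?_ ih)
    rw [G.edist_comm]; exact h _ _ _ hm

/-- The cap holds because a path repeats no vertex and so has fewer than `n` edges. -/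
theorem nearMetric_near {n : ℕ} (G : SimpleGraph (Fin n)) : NearMetric n G.Near := by
  refine ⟨fun u hu => ⟨hu, hu, by simp⟩, ?_, ?_, ?_, ?_⟩
  · rintro k u v ⟨hu, hv, h⟩
    exact ⟨hv, hu, by rwa [G.edist_comm]⟩
  · rintro k l u v w ⟨hu, hv, h⟩ ⟨_, hw, h'⟩
    refine ⟨hu, hw, (SimpleGraph.edist_triangle (v := ⟨v, hv⟩)).trans ?_⟩
    rw [Nat.cast_add]
    exact add_le_add h h'
  · rintro k l u v hkl ⟨hu, hv, h⟩
    exact ⟨hu, hv, h.trans (by exact_mod_cast hkl)⟩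
  · rintro k u v ⟨hu, hv, h⟩
    refine ⟨hu, hv, ?_⟩
    have hne : G.edist ⟨u, hu⟩ ⟨v, hv⟩ ≠ ⊤ := ne_top_of_le_ne_top (ENat.natCast_ne_top _) h
    obtain ⟨p⟩ := G.reachable_of_edist_ne_top hne
    classical
    refine (G.edist_le p.toPath.1).trans ?_
    have := p.toPath.2.length_lt
    rw [Fintype.card_fin] at this
    exact_mod_cast this.le

/-- Apply the stretch bound at level `L` to a shortest walk: all its vertices have levels below `L`,
since no center survives the last phase. -/
theorem isEmulator_of_phases {n E R K l : ℕ} {G : SimpleGraph (Fin n)} {P : ℕ → Finset ℕ}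
    {H : ℕ → List (ℕ × ℕ × ℕ)} {Y : ℕ → ℕ} (hE : 1 ≤ E) (hR : 1 ≤ R)
    (hP : Phases n G.Near R K (112 * ((R + l) * E)) (R + l) P H Y) (hl : expSeq R K l = R)
    (h0 : ∀ u : Fin n, ∀ v, G.Adj u v → (u : ℕ) ∈ P 0) (hcard : (P 0).card ≤ n)
    (hfin : ∀ e ∈ (List.range (R + l)).flatMap H, e.1 < n ∧ e.2.1 < n) {ε β : ℝ}
    (hε : 1 / (E : ℝ) ≤ ε) (hβ : ((112 * ((R + l) * E) : ℕ) : ℝ) ^ (R + l) ≤ β) :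
    IsEmulator G (toFin ((List.range (R + l)).flatMap H) hfin) (1 + ε) β := by
  set L := R + l with hL
  set B := 112 * (L * E) with hB
  have hLE : L * 1 ≤ L * E := Nat.mul_le_mul_left _ hE
  have hB50 : 50 ≤ B := by omega
  have hsound : ∀ i < L, ∀ e ∈ H i, e.1 < n ∧ e.2.1 < n ∧ G.Near e.2.2 e.1 e.2.1 :=
    fun i hi => (hP.spec i hi).sound
  have hE' : (1 : ℝ) ≤ E := by exact_mod_cast hE
  have hε0 : 0 ≤ ε := le_trans (by positivity) hε
  have hβ0 : 0 ≤ β := le_trans (by positivity) hβ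
  refine fun u v => ⟨edist_le_wdist ?_ u v, ?_⟩
  · intro u v w hm
    obtain ⟨i, hi, hm⟩ := List.mem_flatMap.1 (mem_toFin.1 hm)
    obtain ⟨-, -, _, _, h⟩ := hsound i (List.mem_range.1 hi) _ hm
    exact h
  · by_cases htop : G.edist u v = ⊤
    · rw [htop]
      have : ENNReal.ofReal (1 + ε) ≠ 0 := by
        rw [Ne, ENNReal.ofReal_eq_zero]; linarith
      simp [ENNReal.mul_top this]
    obtain ⟨p, hp⟩ := (G.reachable_of_edist_ne_top htop).exists_walk_length_eq_edist
    have hw : ∃ w : ℕ, WWalk (toFin ((List.range L).flatMap H) hfin) u v w ∧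
        (w : ℝ) ≤ (1 + ε) * p.length + β := by
      -- Length zero is separate because an isolated vertex is no initial center and has no level.
      rcases Nat.eq_zero_or_pos p.length with hz | hpos
      · obtain rfl := SimpleGraph.Walk.eq_of_length_eq_zero hz
        exact ⟨0, .nil _, by simp [hz]; exact hβ0⟩
      · have hlev : ∀ t, 0 ≤ t → t ≤ 0 + p.length → ((p.getVert t : Fin n) : ℕ) < n ∧
            ∃ j < L, AtLevel G.Near B P ((List.range L).flatMap H) j (p.getVert t : Fin n) := by
          intro t _ ht
          refine ⟨Fin.is_lt _, ?_⟩
          have hmem : ((p.getVert t : Fin n) : ℕ) ∈ P 0 := by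
            rcases Nat.lt_or_ge t p.length with h | h
            · exact h0 _ _ (p.adj_getVert_succ h)
            · obtain ⟨t', rfl⟩ : ∃ t', t = t' + 1 := ⟨t - 1, by omega⟩
              exact h0 _ _ (p.adj_getVert_succ (i := t') (by omega)).symm
          exact hP.exists_atLevel (nearMetric_near G)
            (fun i hi e he => List.mem_flatMap.2 ⟨i, List.mem_range.2 hi, he⟩)
            (hP.last_eq_empty hR hl hcard) hmem (Fin.is_lt _)
        obtain ⟨w, hw, hwle⟩ := stretched (nearMetric_near G) hB50 L
          (fun t => ((p.getVert t : Fin n) : ℕ)) p.length 0 (fun t _ ht =>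
            .of_edist_le (le_of_eq (by
              simpa using SimpleGraph.edist_eq_one_iff_adj.2 (p.adj_getVert_succ (i := t) (by omega)))))
            hlev
        simp only [zero_add, SimpleGraph.Walk.getVert_zero, SimpleGraph.Walk.getVert_length] at hw
        refine ⟨w, hw.toFin hfin u.2 v.2, hwle.trans ?_⟩
        -- Here `L * 100 / B = 100 / (112 * E)`, so any constant of at least 100 in place of 112
        -- would do.
        have hm : mulStretch B L ≤ ε := by
          refine (mulStretch_le hB50 L).trans (le_trans ?_ hε)
          have hL0 : (0 : ℝ) < L := by exact_mod_cast (by omega : 0 < L)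
          have hBc : (B : ℝ) = 112 * (L * E) := by rw [hB]; push_cast; ring
          rw [hBc, ← mul_div_assoc, div_le_div_iff₀ (by positivity) (by positivity)]
          nlinarith [mul_pos hL0 (by linarith : (0 : ℝ) < E)]
        have ha := (addStretch_le hB50 L).trans hβ
        have : mulStretch B L * p.length ≤ ε * p.length := mul_le_mul_of_nonneg_right hm (by positivity)
        linarith
    obtain ⟨w, hw, hwle⟩ := hw
    have h1 : wdist (toFin ((List.range L).flatMap H) hfin) u v ≤ w := iInf₂_le w hw
    rw [← hp]
    calc ((wdist (toFin ((List.range L).flatMap H) hfin) u v : ℕ∞) : ENNReal) ≤ ((w : ℕ∞) : ENNReal) := by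
          exact_mod_cast h1
      _ = ENNReal.ofReal w := by simp
      _ ≤ ENNReal.ofReal ((1 + ε) * p.length + β) := ENNReal.ofReal_le_ofReal hwle
      _ = _ := by
          rw [ENNReal.ofReal_add (by positivity) hβ0, ENNReal.ofReal_mul (by positivity)]
          simp

/-! ### Bounds on the parameters -/

/-- As long as the exponent stays above `R`, the exponent minus one at least halves; subtracting one
neutralises the rounding. -/
theorem two_pow_mul_le {R K l : ℕ} (h : ∀ j < l, R < expSeq R K j) (hR : 1 ≤ R) (hRK : R ≤ K) :
    2 ^ l * R ≤ 2 * K := by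
  cases l with
  | zero => omega
  | succ l =>
    have key : ∀ j ≤ l, 2 ^ j * (expSeq R K j - 1) ≤ K := by
      intro j
      induction j with
      | zero => intro _; simp [expSeq]
      | succ j ih =>
        intro hj
        have h1 := h (j + 1) (by omega)
        have h2 : 2 * (expSeq R K (j + 1) - 1) ≤ expSeq R K j - 1 := by
          simp only [expSeq, nextExp] at h1 ⊢; omega
        calc 2 ^ (j + 1) * (expSeq R K (j + 1) - 1) = 2 ^ j * (2 * (expSeq R K (j + 1) - 1)) := by ring
          _ ≤ 2 ^ j * (expSeq R K j - 1) := Nat.mul_le_mul_left _ h2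
          _ ≤ K := ih (by omega)
    have h1 := key l le_rfl
    have h2 := h l (by omega)
    calc 2 ^ (l + 1) * R = 2 * (2 ^ l * R) := by ring
      _ ≤ 2 * (2 ^ l * (expSeq R K l - 1)) := by gcongr; omega
      _ ≤ 2 * K := by omega

/-- The exponent `log κρ + ρ⁻¹`. -/
noncomputable def phaseBound (κ ρ : ℝ) : ℝ := Real.logb 2 (κ * ρ) + ρ⁻¹

/-- The logarithm costs an extra 2, one from the factor in `two_pow_mul_le` and one from rounding
`κ` up; rounding `1 / ρ` up costs another 1. -/
theorem numPhases_le {κ ρ : ℝ} {l : ℕ} (hκ : 2 ≤ κ) (hρ : 0 < ρ)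
    (hR : 1 ≤ ⌈1 / ρ⌉₊) (hRK : ⌈1 / ρ⌉₊ ≤ ⌈κ⌉₊)
    (h : ∀ j < l, ⌈1 / ρ⌉₊ < expSeq ⌈1 / ρ⌉₊ ⌈κ⌉₊ j) :
    ((⌈1 / ρ⌉₊ + l : ℕ) : ℝ) ≤ phaseBound κ ρ + 3 := by
  have h1 : ((2 : ℝ)) ^ l * ⌈1 / ρ⌉₊ ≤ 2 * ⌈κ⌉₊ := by exact_mod_cast two_pow_mul_le h hR hRK
  have h2 := Nat.le_ceil (1 / ρ)
  have h3 := (Nat.ceil_lt_add_one (show 0 ≤ κ by linarith)).le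
  have h4 := (Nat.ceil_lt_add_one (show 0 ≤ 1 / ρ by positivity)).le
  have h5 : (2 : ℝ) ^ l * (1 / ρ) ≤ 4 * κ := by
    have : (2 : ℝ) ^ l * (1 / ρ) ≤ 2 ^ l * ⌈1 / ρ⌉₊ := by gcongr
    linarith
  have h6 : (2 : ℝ) ^ l ≤ 4 * (κ * ρ) := by
    rw [mul_one_div, div_le_iff₀ hρ] at h5
    linarith
  have h7 : (l : ℝ) ≤ 2 + Real.logb 2 (κ * ρ) := by
    have e1 : Real.logb 2 ((2 : ℝ) ^ l) = l := by
      rw [← Real.rpow_natCast, Real.logb_rpow (by norm_num) (by norm_num)]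
    have e2 : Real.logb 2 (4 * (κ * ρ)) = 2 + Real.logb 2 (κ * ρ) := by
      rw [Real.logb_mul (by norm_num) (by positivity)]
      congr 1
      rw [show (4 : ℝ) = 2 ^ (2 : ℝ) by norm_num, Real.logb_rpow (by norm_num) (by norm_num)]
    rw [← e1, ← e2]
    exact Real.logb_le_logb_of_le (by norm_num) (by positivity) h6
  unfold phaseBound
  push_cast
  rw [one_div] at h4 ⊢
  linarith

/-- With `Λ` the exponent without its constant and `X` the base of `β`, all factors are swallowed by
powers of `X`: `2 * B` and `L` are at most `X`, and `K` is of order `2 ^ Λ * X`. The result is at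
most `2 * X ^ (Λ + 5)`. -/
theorem betaBound_bounds {ε κ ρ : ℝ} {L E K : ℕ} (hε : 0 < ε) (hε1 : ε < 1) (hκ : 2 ≤ κ) (hρ : 0 < ρ)
    (hρ2 : ρ < 1 / 2) (hκρ : 1 < κ * ρ) (hL : (L : ℝ) ≤ phaseBound κ ρ + 3) (hL1 : 1 ≤ L)
    (hE : (E : ℝ) ≤ 2 / ε) (hE1 : 1 ≤ E) (hK : (K : ℝ) ≤ 2 * κ) :
    ((112 * (L * E) : ℕ) : ℝ) ^ L ≤ betaBound 100000 ε κ ρ ∧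
    100000 ≤ betaBound 100000 ε κ ρ ∧
    (L : ℝ) * (K * ((112 * (L * E) : ℕ) : ℝ) ^ L) ≤ 2 * betaBound 100000 ε κ ρ := by
  have hlog : 0 < Real.logb 2 (κ * ρ) := Real.logb_pos (by norm_num) hκρ
  have hinv : 2 < ρ⁻¹ := by
    rw [lt_inv_comm₀ (by norm_num) hρ]; linarith
  set Λ := phaseBound κ ρ with hΛ
  have hΛ' : Λ = Real.logb 2 (κ * ρ) + ρ⁻¹ := rfl
  have hΛ2 : 2 < Λ := by linarith
  set X : ℝ := 100000 * (Λ / (ε * ρ)) with hX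
  have hβ : betaBound 100000 ε κ ρ = X ^ (Λ + 100000) := rfl
  set B : ℝ := ((112 * (L * E) : ℕ) : ℝ) with hB
  have hL0 : (1 : ℝ) ≤ L := by exact_mod_cast hL1
  have hE0 : (1 : ℝ) ≤ E := by exact_mod_cast hE1
  have hερ : ε * ρ ≤ ρ := by nlinarith
  have hBeq : B = 112 * (L * E) := by rw [hB]; push_cast; ring
  have hB1 : 1 ≤ B := by rw [hBeq]; nlinarith
  have hq : Λ / ρ ≤ Λ / (ε * ρ) := div_le_div_of_nonneg_left (by linarith) (by positivity) hερ
  have hq2 : 2 * (Λ / ε) ≤ Λ / (ε * ρ) := by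
    rw [← mul_div_assoc, div_le_div_iff₀ hε (by positivity)]
    have : 0 < Λ * ε := by positivity
    nlinarith
  have hq3 : Λ ≤ Λ / ε := by rw [le_div_iff₀ hε]; nlinarith
  have hBX : B * 2 ≤ X := by
    have h1 : (L : ℝ) * E ≤ (Λ + 3) * (2 / ε) := mul_le_mul hL hE (by positivity) (by linarith)
    have h2 : (Λ + 3) * (2 / ε) ≤ 5 * (Λ / ε) := by
      rw [mul_div_assoc', mul_div_assoc', div_le_div_iff_of_pos_right hε]; linarith
    rw [hBeq, hX]; linarith
  have hX1 : 100000 ≤ X := by rw [hX]; nlinarith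
  have hLX : (L : ℝ) ≤ X := by rw [hX]; linarith
  have hρX : ρ⁻¹ ≤ X := by
    have : Λ / ρ = Λ * ρ⁻¹ := div_eq_mul_inv _ _
    rw [hX]; nlinarith
  -- `κ` does not occur polynomially in `β`, but `κ = 2 ^ log (κρ) / ρ`, and the power of two can be
  -- merged into the base.
  have hκX : κ ≤ 2 ^ Λ * X := by
    have e1 : κ = (2 : ℝ) ^ Real.logb 2 (κ * ρ) * ρ⁻¹ := by
      rw [Real.rpow_logb (by norm_num) (by norm_num) (by linarith)]
      field_simp
    rw [e1]
    exact mul_le_mul (Real.rpow_le_rpow_of_exponent_le (by norm_num) (by linarith)) hρX (by positivity)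
      (by positivity)
  have hBL : B ^ L ≤ B ^ (Λ + 3) := by
    rw [← Real.rpow_natCast]; exact Real.rpow_le_rpow_of_exponent_le hB1 hL
  have hBL2 : B ^ L * 2 ^ Λ ≤ X ^ (Λ + 3) := by
    have h2 : (2 : ℝ) ^ Λ ≤ 2 ^ (Λ + 3) :=
      Real.rpow_le_rpow_of_exponent_le (by norm_num) (by linarith)
    calc B ^ L * 2 ^ Λ ≤ B ^ (Λ + 3) * 2 ^ (Λ + 3) := mul_le_mul hBL h2 (by positivity) (by positivity)
      _ = (B * 2) ^ (Λ + 3) := (Real.mul_rpow (by linarith) (by norm_num)).symm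
      _ ≤ X ^ (Λ + 3) := Real.rpow_le_rpow (by linarith) hBX (by linarith)
  have hXX : X ^ (Λ + 3) * X * X = X ^ (Λ + 5) := by
    rw [show Λ + 5 = Λ + 3 + 1 + 1 by ring, Real.rpow_add_one (by linarith) (Λ + 3 + 1),
      Real.rpow_add_one (by linarith) (Λ + 3)]
  have hmon : ∀ a ≤ Λ + 100000, X ^ a ≤ betaBound 100000 ε κ ρ := by
    intro a ha
    rw [hβ]; exact Real.rpow_le_rpow_of_exponent_le (by linarith) ha
  refine ⟨?_, ?_, ?_⟩
  · have h1 : 1 ≤ (2 : ℝ) ^ Λ := Real.one_le_rpow (by norm_num) (by linarith)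
    have h2 : B ^ L ≤ B ^ L * 2 ^ Λ := le_mul_of_one_le_right (by positivity) h1
    exact (h2.trans hBL2).trans (hmon _ (by linarith))
  · have := hmon 1 (by linarith)
    rw [Real.rpow_one] at this
    linarith
  · have h1 : (K : ℝ) * B ^ L ≤ 2 * (X ^ (Λ + 3) * X) := by
      calc (K : ℝ) * B ^ L ≤ 2 * (2 ^ Λ * X) * B ^ L := by gcongr; linarith
        _ = 2 * (B ^ L * 2 ^ Λ * X) := by ring
        _ ≤ 2 * (X ^ (Λ + 3) * X) := by gcongr
    calc (L : ℝ) * (K * B ^ L) ≤ X * (2 * (X ^ (Λ + 3) * X)) :=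
          mul_le_mul hLX h1 (by positivity) (by positivity)
      _ = 2 * X ^ (Λ + 5) := by rw [← hXX]; ring
      _ ≤ _ := by have := hmon (Λ + 5) (by linarith); linarith

/-! ### The input -/

theorem IsEdgeList.ncard_edgeSet {n : ℕ} {G : SimpleGraph (Fin n)} {es : List (Fin n × Fin n)}
    (h : IsEdgeList G es) : G.edgeSet.ncard = es.length := by
  have : G.edgeSet = ((es.map fun e => s(e.1, e.2)).toFinset : Set (Sym2 (Fin n))) := by
    ext e
    induction e with
    | _ u v => rw [SimpleGraph.mem_edgeSet, Finset.mem_coe, List.mem_toFinset]; exact (h.2 u v).symm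
  rw [this, Set.ncard_coe_finset, List.toFinset_card_of_nodup h.1, List.length_map]

theorem IsEdgeList.length_le {n : ℕ} {G : SimpleGraph (Fin n)} {es : List (Fin n × Fin n)}
    (h : IsEdgeList G es) : es.length ≤ n * n := by
  have := h.1.of_map.length_le_card
  simpa using this

/-! ### Running the program on an encoded input -/

namespace RAM

theorem emulatorProg_exec {n E K R : ℕ} {G : SimpleGraph (Fin n)} {es : List (Fin n × Fin n)}
    (hes : IsEdgeList G es) (hn : 1 ≤ n) (hE2 : 2 ≤ E) (hR : 3 ≤ R) (hRK : R ≤ K) :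
    ∃ S t l P H Y, Exec ((n + E + K + R) ^ 6) emulatorProg
      (initState ([n, es.length, E, K, R] ++ es.flatMap fun e => [(e.1 : ℕ), (e.2 : ℕ)])) S t ∧
      (∀ j < l, R < expSeq R K j) ∧ expSeq R K l = R ∧
      (∀ u : Fin n, ∀ v, G.Adj u v → (u : ℕ) ∈ P 0) ∧ (P 0).card ≤ n ∧
      Phases n G.Near R K (112 * ((R + l) * E)) (R + l) P H Y ∧
      (∀ hfin : ∀ e ∈ (List.range (R + l)).flatMap H, e.1 < n ∧ e.2.1 < n,
        S.Outputs (toFin ((List.range (R + l)).flatMap H) hfin)) ∧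
      t ≤ 15 + 10000 * ((R + l) * (K * ((112 * ((R + l) * E)) ^ (R + l) * (2 * es.length + 1) *
        ⌊(n : ℝ) ^ (1 / (R : ℝ))⌋₊))) := by
  set fl := es.flatMap fun e => [(e.1 : ℕ), (e.2 : ℕ)] with hfl
  set input := [n, es.length, E, K, R] ++ fl with hinput
  have hlen : input.length = 5 + 2 * es.length := by
    rw [hinput, List.length_append, hfl, length_flatMap_pair]; simp
  have hm := hes.length_le
  set Z := n + E + K + R with hZ
  have hZ8 : 8 ≤ Z := by omega
  have hnn : n * n ≤ Z ^ 2 := by rw [sq]; exact Nat.mul_le_mul (by omega) (by omega)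
  have hZ2 : 8 * Z ≤ Z ^ 2 := by rw [sq]; exact Nat.mul_le_mul_right _ hZ8
  have hZ3 : 8 * Z ^ 2 ≤ Z ^ 3 := by
    rw [show Z ^ 3 = Z * Z ^ 2 by ring]; exact Nat.mul_le_mul_right _ hZ8
  -- The radix exceeds `n` and the number of phases, so it bounds every array index, and its sixth
  -- power leaves room for all intermediate numbers.
  let Γ : Ctx := ⟨Z ^ 6, Z, fun r => input.getD r 0, 5 + 2 * es.length, hZ8, le_rfl, by omega⟩
  have hget : ∀ r, Γ.inp (5 + r) = fl.getD r 0 := by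
    intro r
    change ([n, es.length, E, K, R] ++ fl).getD (5 + r) 0 = _
    rw [List.getD_append_right _ _ _ _ (by simp)]
    simp
  have hle : ∀ r, input.getD r 0 ≤ Γ.W := by
    have hW : Z ^ 3 ≤ Z ^ 6 := Nat.pow_le_pow_right (by omega) (by norm_num)
    have hall : ∀ a ∈ input, a ≤ Z ^ 6 := by
      intro a ha
      simp only [hinput, List.mem_append, List.mem_cons, List.not_mem_nil, or_false] at ha
      rcases ha with (rfl | rfl | rfl | rfl | rfl) | ha
      · omega
      · omega
      · omega
      · omega
      · omega
      · obtain ⟨e, -, he⟩ := List.mem_flatMap.1 ha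
        have h1 := e.1.is_lt
        have h2 := e.2.is_lt
        simp only [List.mem_cons, List.not_mem_nil, or_false] at he
        rcases he with rfl | rfl <;> omega
    intro r
    rcases Nat.lt_or_ge r input.length with h | h
    · rw [List.getD_eq_getElem _ _ h]; exact hall _ (List.getElem_mem h)
    · rw [List.getD_eq_default _ _ h]; exact Nat.zero_le _
  have hmet : EdgeMetric Γ n (2 * es.length) G.Near := edgeMetric_near hes (by change _ ≤ Z; omega) le_rfl
    (fun j hj => by rw [hget]; exact (getD_flatMap_pair es j hj).1)
    (fun j hj => by rw [hget]; exact (getD_flatMap_pair es j hj).2)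
  obtain ⟨S1, hx1, hr1⟩ := prologue_exec (Γ := Γ) (input := input) (fun _ _ => rfl) hlen hle
    (Nat.le_add_right _ _) rfl
  obtain ⟨S, s, t, hx, hr, l, P, H, Y, -, hl, hlj, hP0, hP, hout, ht⟩ :=
    mainProg_spec (Γ := Γ) (m := es.length) (E := E) (K := K) (R := R) (M := ⌊(n : ℝ) ^ (1 / (R : ℝ))⌋₊) hmet (s := Store.init)
      (fun _ _ _ _ => rfl) rfl rfl rfl rfl rfl rfl rfl hn hE2 hR hRK
      (fun y hy => Nat.le_floor (nat_le_rpow_inv (by omega) hy)) S1 hr1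
  refine ⟨S, 15 + t, l, P, H, Y, .seq hx1 hx, hlj, hl, ?_, ?_, hP, ?_, by omega⟩
  · intro u v huv
    obtain ⟨e, he, heq⟩ := List.mem_map.1 ((hes.2 u v).2 huv)
    obtain ⟨j, hj, rfl⟩ := List.mem_iff_getElem.1 he
    rw [hP0, Finset.mem_image]
    rcases Sym2.eq_iff.1 heq with ⟨a, -⟩ | ⟨-, b⟩
    · exact ⟨2 * j, by simpa using hj, by
        rw [Ctx.src, hget, (getD_flatMap_pair es j hj).1, a]⟩
    · exact ⟨2 * j + 1, by simp; omega, by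
        rw [Ctx.src, hget, (getD_flatMap_pair es j hj).2, b]⟩
  · have : P 0 ⊆ Finset.range n := by
      intro c hc
      rw [hP0] at hc
      obtain ⟨e, he, rfl⟩ := Finset.mem_image.1 hc
      exact Finset.mem_range.2 (hmet.src_lt e (Finset.mem_range.1 he))
    simpa using Finset.card_le_card this
  · intro hfin
    have hlen' : (toFin ((List.range (R + l)).flatMap H) hfin).length = s.out.length := by
      rw [toFin, List.length_pmap, hout]
    refine ⟨by rw [hr.count, hlen'], fun j hj => ?_⟩
    have hj' : j < s.out.length := by rwa [← hlen']
    have h3 := hr.out j hj'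
    rw [hr.base]
    simpa [toFin, hout] using h3

end RAM

/-! ### The main theorem -/

/-- There are one program `P` and absolute constants `C` (in `β` and in the running time) and
`b` (words have `O(log (n + ⌈1/ε⌉ + ⌈κ⌉ + ⌈1/ρ⌉))` bits) such that, for all admissible
parameters and every graph on `n ≥ 1` vertices, `P` halts and outputs a `(1+ε, β)`-emulator with
at most `n^(1+1/κ)` edges within `C * max(|E|, 1) * β * n^ρ` steps. -/
theorem theorem3p3 :
    ∃ (P : RAM.Prog) (C : ℝ) (b : ℕ), 0 < C ∧
      ∀ (ε κ ρ : ℝ), 0 < ε → ε < 1 → 2 ≤ κ → 1 / κ < ρ → ρ < 1 / 2 →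
      ∀ (n : ℕ), 1 ≤ n → ∀ (G : SimpleGraph (Fin n)) (es : List (Fin n × Fin n)),
        IsEdgeList G es →
        ∃ (s : RAM.State) (t : ℕ) (H : List (Fin n × Fin n × ℕ)),
          RAM.Exec ((n + ⌈1 / ε⌉₊ + ⌈κ⌉₊ + ⌈1 / ρ⌉₊) ^ b) P
            (RAM.initState (emulatorInput es ε κ ρ)) s t ∧
          s.Outputs H ∧
          IsEmulator G H (1 + ε) (betaBound C ε κ ρ) ∧
          (H.length : ℝ) ≤ (n : ℝ) ^ (1 + 1 / κ) ∧
          (t : ℝ) ≤ C * max (G.edgeSet.ncard : ℝ) 1 * betaBound C ε κ ρ * (n : ℝ) ^ ρ := by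
  refine ⟨RAM.emulatorProg, 100000, 6, by norm_num, ?_⟩
  intro ε κ ρ hε hε1 hκ hκρ' hρ2 n hn G es hes
  have hκ0 : 0 < κ := by linarith
  have hρ : 0 < ρ := lt_trans (by positivity) hκρ'
  have hκρ : 1 < κ * ρ := by rwa [div_lt_iff₀' hκ0] at hκρ'
  have hE2 : 2 ≤ ⌈1 / ε⌉₊ := by
    rw [Nat.succ_le_iff, Nat.lt_ceil]
    rw [lt_div_iff₀ hε]; push_cast; linarith
  have hR3 : 3 ≤ ⌈1 / ρ⌉₊ := by
    rw [Nat.succ_le_iff, Nat.lt_ceil]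
    rw [lt_div_iff₀ hρ]; push_cast; linarith
  have hRK : ⌈1 / ρ⌉₊ ≤ ⌈κ⌉₊ := by
    refine Nat.ceil_le_ceil ?_
    rw [div_le_iff₀ hρ]; exact hκρ.le
  obtain ⟨S, t, l, P, H, Y, hx, hlj, hl, hadj, hcard, hP, hout, ht⟩ :=
    RAM.emulatorProg_exec hes hn hE2 hR3 hRK
  have hfin : ∀ e ∈ (List.range (⌈1 / ρ⌉₊ + l)).flatMap H, e.1 < n ∧ e.2.1 < n := by
    intro e he
    obtain ⟨i, hi, he⟩ := List.mem_flatMap.1 he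
    obtain ⟨h1, h2, -⟩ := (hP.spec i (List.mem_range.1 hi)).sound e he
    exact ⟨h1, h2⟩
  have hEle : (⌈1 / ε⌉₊ : ℝ) ≤ 2 / ε := by
    have h1 := (Nat.ceil_lt_add_one (show 0 ≤ 1 / ε by positivity)).le
    have h2 : 1 ≤ 1 / ε := by rw [le_div_iff₀ hε]; linarith
    have h3 : 2 / ε = 1 / ε + 1 / ε := by ring
    linarith
  have hKle : (⌈κ⌉₊ : ℝ) ≤ 2 * κ := by
    have h1 := (Nat.ceil_lt_add_one hκ0.le).le
    linarith
  obtain ⟨b1, b2, b3⟩ := betaBound_bounds hε hε1 hκ hρ hρ2 hκρ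
    (numPhases_le hκ hρ (by omega) hRK hlj) (by omega) hEle (by omega) hKle
  -- From here on the real parameters replace their roundings: `1 / ⌈1/ε⌉ ≤ ε`, `1 / ⌈κ⌉ ≤ 1 / κ`
  -- and `1 / ⌈1/ρ⌉ ≤ ρ`, each in the favourable direction.
  have hn' : (1 : ℝ) ≤ n := by exact_mod_cast hn
  refine ⟨S, t, toFin ((List.range (⌈1 / ρ⌉₊ + l)).flatMap H) hfin, hx, hout hfin, ?_, ?_, ?_⟩
  · refine isEmulator_of_phases (by omega) (by omega) hP hl hadj hcard hfin ?_ b1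
    rw [one_div_le (by positivity) hε]
    exact Nat.le_ceil _
  · rw [toFin, List.length_pmap]
    refine (hP.length_le (by omega) hRK hn).trans ?_
    rw [Real.rpow_add (by positivity), Real.rpow_one]
    refine mul_le_mul (by exact_mod_cast hcard) (Real.rpow_le_rpow_of_exponent_le hn' ?_)
      (by positivity) (by positivity)
    exact one_div_le_one_div_of_le hκ0 (Nat.le_ceil κ)
  · rw [hes.ncard_edgeSet]
    set β := betaBound 100000 ε κ ρ
    set B : ℕ := 112 * ((⌈1 / ρ⌉₊ + l) * ⌈1 / ε⌉₊)
    set L := ⌈1 / ρ⌉₊ + l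
    set K := ⌈κ⌉₊
    set m := es.length
    set M := ⌊(n : ℝ) ^ (1 / (⌈1 / ρ⌉₊ : ℝ))⌋₊
    have hM : (M : ℝ) ≤ (n : ℝ) ^ ρ := by
      refine (Nat.floor_le (by positivity)).trans (Real.rpow_le_rpow_of_exponent_le hn' ?_)
      rw [one_div_le (by positivity) hρ]
      exact Nat.le_ceil _
    have hnρ : 1 ≤ (n : ℝ) ^ ρ := Real.one_le_rpow hn' hρ.le
    set N := (n : ℝ) ^ ρ
    set μ : ℝ := max (m : ℝ) 1
    have hμ1 : 1 ≤ μ := le_max_right _ _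
    have hm : 2 * (m : ℝ) + 1 ≤ 3 * μ := by have : (m : ℝ) ≤ μ := le_max_left _ _; linarith
    have ht' : (t : ℝ) ≤ 15 + 10000 * (L * (K * (B : ℝ) ^ L) * ((2 * m + 1) * M)) := by
      calc (t : ℝ) ≤ ((15 + 10000 * (L * (K * (B ^ L * (2 * m + 1) * M))) : ℕ) : ℝ) := by
            exact_mod_cast ht
        _ = _ := by push_cast; ring
    have h1 : (2 * (m : ℝ) + 1) * M ≤ 3 * μ * N := mul_le_mul hm hM (by positivity) (by positivity)
    have h2 : L * (K * (B : ℝ) ^ L) * ((2 * m + 1) * M) ≤ 2 * β * (3 * μ * N) :=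
      mul_le_mul b3 h1 (by positivity) (by linarith)
    have h3 : 1 ≤ μ * β * N := by
      have : 1 ≤ μ * β := one_le_mul_of_one_le_of_one_le hμ1 (by linarith)
      exact one_le_mul_of_one_le_of_one_le this hnρ
    -- The constants add up to `15 + 10000 * 2 * 3 = 60015`, below 100000.
    linarith
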